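/- Let $p$ be a prime and let $k$ be an algebraically closed field, complete with respect to a non-archimedean (real-valued) absolute value, with residue field of characteristic $p$. A pointed disc is a closed disc $D=\mathcal M(\mathcal A)$, $\mathcal A\simeq k\{t\}$, with a fixed $k$-point $O$, its origin. Its skeleton is the interval $l=[O,q]$, where $q$ is the maximal point of $D$. A monic coordinate on $D$ is a function vanishing at $O$ and mapping $D$ isomorphically onto the closed unit disc $\mathcal M(k\{t\})$. For any monic coordinate $y$, the function $|y|$ identifies $l$ with $[0,1]$, and this identification does not depend on $y$. Let $f\colon Y\to X$ be an étale $p$-cover of pointed discs, that is, a finite morphism of degree $p$ such that the preimage of the origin of $X$ is the origin $O$ of $Y$, and such that $f$ is étale on $Y\setminus\{O\}$. Let $l$ be the skeleton of $Y$. For $z\in l\setminus\{O\}$ let $\delta_f(z)$ be the different of the extension $L=\mathcal H(z)$ of $K=\mathcal H(f(z))$, i.e. the absolute value (the supremum of the absolute values of the elements) of the annihilator of $\Omega_{L^\circ/K^\circ}$. (1) If $k$ is of mixed characteristic (i.e. $\operatorname{char} k=0$), then $f$ is Kummer: there are monic coordinates $x$ on $X$ and $y$ on $Y$ such that $x=y^p$,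 where $x$ is identified with its pullback $f^*x$. (2) If $k$ is of equal characteristic (i.e. $\operatorname{char} k=p$), then $f$ is binomial: there are monic coordinates $x$ on $X$ and $y$ on $Y$, an element $c_n\in k$ and an integer $n\ge 0$ such that $x=y^p+c_ny^n$. More precisely, for any $c_n\in k$ and any integer $n\ge 0$, $f$ admits such a presentation $x=y^p+c_ny^n$ in some monic coordinates $x,y$ if and only if $|c_ny^{n-p}|=\delta_f$ on $l\setminus\{O\}$, where in the latter condition $|y|$ is computed in any given monic coordinate $y$ on $Y$. -/

import Mathlib

open Filter Topology
open scoped NNReal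

/-! ### The Tate algebra and closed discs -/

section TateAlgebra

variable (k : Type*) [NormedField k] [IsUltrametricDist k]

/-- The Tate algebra `k{t}`: the `k`-algebra of power series over `k` whose coefficients tend
to zero, i.e. the ring of analytic functions on the closed unit disc. -/
def TateAlgebra : Subalgebra k (PowerSeries k) where
  carrier := {f | PowerSeries.IsRestricted 1 f}
  mul_mem' hf hg := PowerSeries.isRestricted.mul 1 hf hg
  add_mem' hf hg := PowerSeries.isRestricted.add 1 hf hg
  algebraMap_mem' c := PowerSeries.isRestricted_C 1 c

variable {k}

theorem TateAlgebra.mem_iff (f : PowerSeries k) :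
    f ∈ TateAlgebra k ↔ Tendsto (fun n => ‖PowerSeries.coeff n f‖) atTop (𝓝 0) := by
  change PowerSeries.IsRestricted 1 f ↔ _
  rw [PowerSeries.isRestricted_iff']
  simp

variable (k) in
/-- The coordinate `t` of the standard closed unit disc. -/
noncomputable def TateAlgebra.T : TateAlgebra k :=
  ⟨PowerSeries.X, PowerSeries.isRestricted_monomial 1 1 1⟩

/-- The Gauss norm `max_n |a_n|` of `∑ a_n t^n`. It is the spectral norm of the Tate algebra. -/
noncomputable def TateAlgebra.gaussNorm (f : TateAlgebra k) : ℝ :=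
  ⨆ n : ℕ, ‖PowerSeries.coeff n (f : PowerSeries k)‖

end TateAlgebra

universe u v w

/-- A pointed closed disc over `k`, given by its affinoid algebra of analytic functions, which is
isomorphic to `k{t}`, and by a `k`-point `O`, the origin. A morphism of discs `Y → X` is the same
thing as a homomorphism of `k`-algebras from the functions on `X` to the functions on `Y`
(such homomorphisms are automatically bounded). -/
structure PointedDisc (k : Type u) [NormedField k] [IsUltrametricDist k] where
  /-- The ring of analytic functions on the disc. -/
  ring : Type v
  [commRing : CommRing ring]
  [algebra : Algebra k ring]
  exists_equiv : Nonempty (TateAlgebra k ≃ₐ[k] ring)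
  /-- Evaluation of functions at the origin. -/
  origin : ring →ₐ[k] k

attribute [instance] PointedDisc.commRing PointedDisc.algebra

/-! ### Completed residue fields -/

section ResidueField

variable {A : Type*} [CommRing A]

/-- The valuation induced by a nonarchimedean multiplicative seminorm `z` on `A` on the fraction
field of `A / ker z`. -/
noncomputable def residueValuation (z : Valuation A ℝ≥0) : Valuation z.supp.ResidueField ℝ≥0 :=
  (z.onQuot le_rfl).extendToLocalization (S := nonZeroDivisors (A ⧸ z.supp))
    (by
      intro a ha
      change a ∉ (z.onQuot le_rfl).supp
      rw [Valuation.supp_quot_supp]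
      exact nonZeroDivisors.ne_zero ha) z.supp.ResidueField

theorem residueValuation_algebraMap (z : Valuation A ℝ≥0) (a : A) :
    residueValuation z (algebraMap A z.supp.ResidueField a) = z a := by
  rw [IsScalarTower.algebraMap_apply A (A ⧸ z.supp) z.supp.ResidueField]
  unfold residueValuation
  rw [Valuation.extendToLocalization_apply_map_apply]
  rfl

/-- The same, as a real absolute value. -/
noncomputable def residueAbs (z : Valuation A ℝ≥0) : AbsoluteValue z.supp.ResidueField ℝ where
  toFun a := residueValuation z a
  map_mul' a b := by simp
  nonneg' a := NNReal.coe_nonneg _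
  eq_zero' a := by simp
  add_le' a b := by
    have h := (residueValuation z).map_add a b
    have h' : max (residueValuation z a) (residueValuation z b) ≤
        residueValuation z a + residueValuation z b :=
      max_le (le_add_of_nonneg_right (zero_le)) (le_add_of_nonneg_left (zero_le))
    exact_mod_cast h.trans h'

/-- The completed residue field `H(z)` of a point `z` of a Berkovich spectrum: the completion of
the fraction field of `A / ker z` with respect to the absolute value induced by `z`. -/
abbrev CompletedResidueField (z : Valuation A ℝ≥0) : Type _ := (residueAbs z).Completion

instance (z : Valuation A ℝ≥0) : IsUltrametricDist (WithAbs (residueAbs z)) :=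
  IsUltrametricDist.isUltrametricDist_of_forall_norm_add_le_max_norm fun a b => by
    have h := (residueValuation z).map_add a.ofAbs b.ofAbs
    change ((residueValuation z (a.ofAbs + b.ofAbs) : ℝ≥0) : ℝ) ≤
      max ((residueValuation z a.ofAbs : ℝ≥0) : ℝ) ((residueValuation z b.ofAbs : ℝ≥0) : ℝ)
    exact_mod_cast h

instance (z : Valuation A ℝ≥0) : IsUltrametricDist (CompletedResidueField z) :=
  IsUltrametricDist.isUltrametricDist_of_forall_norm_add_le_max_norm fun a b => by
    induction a, b using UniformSpace.Completion.induction_on₂ with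
    | hp => exact isClosed_le (by fun_prop) (by fun_prop)
    | ih a b =>
      rw [← UniformSpace.Completion.coe_add]
      simp only [UniformSpace.Completion.norm_coe]
      exact IsUltrametricDist.norm_add_le_max a b

variable {B : Type*} [CommRing B]

/-- The map on (uncompleted) residue fields induced by `f : B → A`, from the image `z ∘ f` of a
point `z` to the point `z`. -/
noncomputable def residueMap (f : B →+* A) (z : Valuation A ℝ≥0) :
    (z.comap f).supp.ResidueField →+* z.supp.ResidueField :=
  Ideal.ResidueField.map _ _ f (Valuation.comap_supp z f)

theorem residueAbs_residueMap (f : B →+* A) (z : Valuation A ℝ≥0)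
    (a : (z.comap f).supp.ResidueField) :
    residueAbs z (residueMap f z a) = residueAbs (z.comap f) a := by
  have key : ∀ b : B, residueValuation z (residueMap f z (algebraMap B _ b)) =
      residueValuation (z.comap f) (algebraMap B _ b) := fun b => by
    rw [residueMap, Ideal.ResidueField.map_algebraMap, residueValuation_algebraMap,
      residueValuation_algebraMap]
    rfl
  change ((residueValuation z (residueMap f z a) : ℝ≥0) : ℝ) =
    ((residueValuation (z.comap f) a : ℝ≥0) : ℝ)
  congr 1
  obtain ⟨x, y, -, rfl⟩ := IsFractionRing.div_surjective (B ⧸ (z.comap f).supp) a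
  obtain ⟨x, rfl⟩ := Ideal.Quotient.mk_surjective x
  obtain ⟨y, rfl⟩ := Ideal.Quotient.mk_surjective y
  simp only [Ideal.algebraMap_quotient_residueField_mk, map_div₀, key]

/-- The isometric embedding `H(z ∘ f) → H(z)` of completed residue fields induced by
`f : B → A`. -/
noncomputable def completedResidueMap (f : B →+* A) (z : Valuation A ℝ≥0) :
    CompletedResidueField (z.comap f) →+* CompletedResidueField z :=
  UniformSpace.Completion.mapRingHom
    ((WithAbs.equiv (residueAbs z)).symm.toRingHom.comp
      ((residueMap f z).comp (WithAbs.equiv (residueAbs (z.comap f))).toRingHom))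
    (AddMonoidHomClass.isometry_of_norm _ fun a => residueAbs_residueMap f z a.ofAbs).continuous

theorem norm_completedResidueMap (f : B →+* A) (z : Valuation A ℝ≥0)
    (a : CompletedResidueField (z.comap f)) : ‖completedResidueMap f z a‖ = ‖a‖ := by
  induction a using UniformSpace.Completion.induction_on with
  | hp =>
    exact isClosed_eq (UniformSpace.Completion.continuous_map.norm) continuous_norm
  | ih a =>
    rw [completedResidueMap, UniformSpace.Completion.mapRingHom_coe]
    simp only [UniformSpace.Completion.norm_coe]
    exact residueAbs_residueMap f z a.ofAbs

end ResidueField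

/-! ### The different -/

section Different

/-- The ring of integers `K°` of a nonarchimedean field. -/
noncomputable abbrev normIntegers (K : Type*) [NormedField K] [IsUltrametricDist K] : Subring K :=
  (NormedField.valuation (K := K)).integer

/-- The embedding `K° → L°` induced by an isometric embedding of nonarchimedean fields. -/
noncomputable def normIntegersMap {K L : Type*} [NormedField K] [IsUltrametricDist K] [NormedField L]
    [IsUltrametricDist L] (φ : K →+* L) (hφ : ∀ a, ‖φ a‖ = ‖a‖) :
    normIntegers K →+* normIntegers L :=
  φ.restrict _ _ fun a ha => by
    rw [Valuation.mem_integer_iff] at ha ⊢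
    have h : ‖a‖ ≤ 1 := ha
    exact (hφ a).trans_le h

/-- The different `δ_{L/K}` of an extension of nonarchimedean fields: the absolute value of the
annihilator of the module of Kähler differentials of `L°` over `K°`. -/
noncomputable def fieldDifferent {K L : Type*} [NormedField K] [IsUltrametricDist K]
    [NormedField L] [IsUltrametricDist L] (φ : K →+* L) (hφ : ∀ a, ‖φ a‖ = ‖a‖) : ℝ :=
  letI : Algebra (normIntegers K) (normIntegers L) := (normIntegersMap φ hφ).toAlgebra
  sSup {r : ℝ | ∃ a ∈ Module.annihilator (normIntegers L)
    (KaehlerDifferential (normIntegers K) (normIntegers L)), r = ‖(a : L)‖}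

/-- The value at the point `z` of the different function of the morphism given by `f : B → A`: the
different of the extension of completed residue fields `H(z) / H(z ∘ f)`. -/
noncomputable def different {A B : Type*} [CommRing A] [CommRing B] (f : B →+* A)
    (z : Valuation A ℝ≥0) : ℝ :=
  fieldDifferent (completedResidueMap f z) (norm_completedResidueMap f z)

end Different

namespace PointedDisc

variable {k : Type u} [NormedField k] [IsUltrametricDist k]

/-! ### Points, the skeleton, coordinates -/

/-- A point of the Berkovich spectrum of the disc `D`: a bounded multiplicative seminorm on the
ring of functions which extends the absolute value of `k`. (It is automatically nonarchimedean.
The spectral norm on functions is the Gauss norm in any coordinate.) -/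
structure Point (D : PointedDisc.{u, v} k) where
  /-- The seminorm. -/
  val : Valuation D.ring ℝ≥0
  val_algebraMap : ∀ c : k, val (algebraMap k D.ring c) = ‖c‖₊
  val_le : ∀ (e : D.ring ≃ₐ[k] TateAlgebra k) (a : D.ring),
    (val a : ℝ) ≤ TateAlgebra.gaussNorm (e a)

/-- The origin as a multiplicative seminorm, `a ↦ |a(O)|`. -/
noncomputable def originVal (D : PointedDisc.{u, v} k) : Valuation D.ring ℝ≥0 :=
  (NormedField.valuation (K := k)).comap (D.origin : D.ring →+* k)

/-- The skeleton `l = [O, q]` of a pointed disc without its endpoint `O`. Here `q`, the spectral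
norm, is the maximal point of the disc, and `[O, q]` is the interval of points `z` with
`O ≤ z ≤ q` for the pointwise order on seminorms; in a coordinate `t` vanishing at `O` it consists
of the seminorms `∑ a_n t^n ↦ max_n |a_n| r^n`, where `0 ≤ r ≤ 1`. -/
def puncturedSkeleton (D : PointedDisc.{u, v} k) : Set D.Point :=
  {z | (∀ a, D.originVal a ≤ z.val a) ∧ z.val ≠ D.originVal}

/-- A monic coordinate on a pointed disc: a function which vanishes at the origin and maps the
disc isomorphically onto the closed unit disc with ring of functions `k{t}`. -/
def IsMonicCoordinate (D : PointedDisc.{u, v} k) (y : D.ring) : Prop :=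
  D.origin y = 0 ∧ ∃ e : TateAlgebra k ≃ₐ[k] D.ring, e (TateAlgebra.T k) = y

/-! ### Covers -/

variable {Y : PointedDisc.{u, v} k} {X : PointedDisc.{u, w} k}

/-- An `m`-cover `f : Y → X` of pointed discs: a finite morphism of degree `m` such that the
preimage of the origin of `X` is the origin of `Y`, so that it restricts to a finite morphism of
the punctured discs. -/
structure IsCover (f : X.ring →ₐ[k] Y.ring) (m : ℕ) : Prop where
  finite : (f : X.ring →+* Y.ring).Finite
  degree : letI := (f : X.ring →+* Y.ring).toAlgebra
    Module.finrank X.ring Y.ring = m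
  fiber_origin : ∀ y : Y.ring →ₐ[k] k, y.comp f = X.origin ↔ y = Y.origin

/-- A finite morphism of pointed discs `f : Y → X` is étale on the punctured disc: the ring of
functions on `Y` is étale over the ring of functions on `X` at every prime ideal other than the
maximal ideal of the origin of `Y`. -/
def IsEtaleOutsideOrigin (f : X.ring →ₐ[k] Y.ring) : Prop :=
  letI := (f : X.ring →+* Y.ring).toAlgebra
  ∀ q : PrimeSpectrum Y.ring, q.asIdeal ≠ RingHom.ker Y.origin →
    Algebra.IsEtaleAt X.ring q.asIdeal

/-- An étale `m`-cover of pointed discs. -/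
structure IsEtaleCover (f : X.ring →ₐ[k] Y.ring) (m : ℕ) : Prop extends IsCover f m where
  etale : IsEtaleOutsideOrigin f

/-- The morphism `f : Y → X` is given by `x = y ^ m` in suitable monic coordinates. -/
def IsKummer (f : X.ring →ₐ[k] Y.ring) (m : ℕ) : Prop :=
  ∃ (x : X.ring) (y : Y.ring), X.IsMonicCoordinate x ∧ Y.IsMonicCoordinate y ∧ f x = y ^ m

/-- The morphism `f : Y → X` is given by `x = y ^ m + c * y ^ n` in suitable monic coordinates. -/
def HasBinomialPresentation (f : X.ring →ₐ[k] Y.ring) (m : ℕ) (c : k) (n : ℕ) : Prop :=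
  ∃ (x : X.ring) (y : Y.ring), X.IsMonicCoordinate x ∧ Y.IsMonicCoordinate y ∧
    f x = y ^ m + algebraMap k Y.ring c * y ^ n

end PointedDisc

/-! In centered coordinates `f` is an endomorphism `F` of `k{t}`, determined by `h = F(T)`. The
origin is the only point above the origin, so `h = t^m u` with `u` a unit. Finiteness forces `‖u‖ =
1`; then `1, t, ..., t^(m-1)` is a basis, so `m = p` (`exists_coeff_of_isIntegral`,
`bijective_sum_mul_T_pow`). Étaleness means that `h'` has no zero outside the origin, so `h' =
t^(n-1)` times a unit: `n a_n` is the first nonzero `i a_i`, and it strictly dominates all later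
ones (`exists_dominant_deriv_coeff`).

Write `h = φ(t^p) + δ`, where `δ` collects the exponents prime to `p` and `φ` is a coordinate after
normalizing `a_p = 1`. On these exponents `‖i‖ = 1`, so `‖n a_n‖` bounds `δ`. In mixed
characteristic `n = p`, and the coefficients of `δ` are smaller than `‖p‖`; in characteristic `p`,
`δ` is `c t^n` plus strictly smaller terms of higher degree, with `n` prime to `p`. A Newton
iteration then solves `F(a) = z^p + c z^n` with `z = t(1 + g)`, and with `c = 0` in mixed
characteristic (`NormalFormData.exists_step`, `NormalFormData.exists_normalForm`). Its linear term
removes the error. The term `(t d)^p`, which the linear term cannot control, is a series in `t^p`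
modulo `p`, so it is nearly a value of `F` and is absorbed into `a`.

For the last claim one computes the different of `x = y^p + c y^n` at the point of radius `r`; it is
`‖c‖ r^(n-p)` (`IsSkeletal.fieldDifferent_eq`). The upper bound comes from the derivation `d/dy` of
`L = H(z)`: it maps `K°` into a ball of radius `‖h'‖ / ‖h‖`, while it takes a value of norm close to
`1 / r` on a suitable multiple of `y` in `L°`. The lower bound comes from `L° ` being almost
generated over `K°` by a multiple of `y` of norm close to 1, because the powers `y^j`, `j < p`, span
`L` over `K` with control of norms.

The different on the skeleton thus determines `‖c‖` (at `r = 1`) and `n` (at a radius below 1).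
Conversely, if `‖c‖ = ‖c'‖`, rescaling the coordinates by elements of norm 1 turns `c'` into `c`,
since `k` is algebraically closed. -/

namespace TateAlgebra

/-! ### The Gauss norm, the formal derivative and units -/

section Norm

variable {k : Type*} [NormedField k] [IsUltrametricDist k]

/-- The coefficient of `t ^ i`. -/
noncomputable def coeff (i : ℕ) : TateAlgebra k →ₗ[k] k :=
  (PowerSeries.coeff i).comp (TateAlgebra k).val.toLinearMap

theorem coeff_def (i : ℕ) (f : TateAlgebra k) :
    coeff i f = PowerSeries.coeff i (f : PowerSeries k) := rfl

@[ext] theorem ext {f g : TateAlgebra k} (h : ∀ i, coeff i f = coeff i g) : f = g :=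
  Subtype.ext (PowerSeries.ext h)

theorem tendsto_norm_coeff (f : TateAlgebra k) :
    Tendsto (fun i => ‖coeff i f‖) atTop (𝓝 0) := (mem_iff _).1 f.2

theorem tendsto_coeff (f : TateAlgebra k) : Tendsto (fun i => coeff i f) atTop (𝓝 0) :=
  tendsto_zero_iff_norm_tendsto_zero.2 (tendsto_norm_coeff f)

/-- The restricted power series with given coefficients. -/
noncomputable def mk (a : ℕ → k) (h : Tendsto a atTop (𝓝 0)) : TateAlgebra k :=
  ⟨PowerSeries.mk a, (mem_iff _).2 (by simpa using tendsto_zero_iff_norm_tendsto_zero.1 h)⟩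

@[simp] theorem coeff_mk (a : ℕ → k) (h : Tendsto a atTop (𝓝 0)) (i : ℕ) :
    coeff i (mk a h) = a i := PowerSeries.coeff_mk _ _

theorem coeff_mul (n : ℕ) (f g : TateAlgebra k) :
    coeff n (f * g) = ∑ ij ∈ Finset.HasAntidiagonal.antidiagonal n, coeff ij.1 f * coeff ij.2 g :=
  PowerSeries.coeff_mul n _ _

theorem coeff_one (n : ℕ) : coeff n (1 : TateAlgebra k) = if n = 0 then 1 else 0 :=
  PowerSeries.coeff_one n

theorem coeff_algebraMap (n : ℕ) (a : k) :
    coeff n (algebraMap k (TateAlgebra k) a) = if n = 0 then a else 0 :=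
  PowerSeries.coeff_C n a

@[simp] theorem coeff_zero_algebraMap (a : k) : coeff 0 (algebraMap k (TateAlgebra k) a) = a := by
  simp [coeff_algebraMap]

theorem coeff_T_pow (m n : ℕ) : coeff n (T k ^ m) = if n = m then 1 else 0 := by
  have : ((T k ^ m : TateAlgebra k) : PowerSeries k) = PowerSeries.X ^ m := by
    simp [T]
  rw [coeff_def, this, PowerSeries.coeff_X_pow]

theorem coeff_T (n : ℕ) : coeff n (T k) = if n = 1 then 1 else 0 := by
  simpa using coeff_T_pow (k := k) 1 n

theorem coeff_T_pow_mul (m n : ℕ) (f : TateAlgebra k) :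
    coeff n (T k ^ m * f) = if m ≤ n then coeff (n - m) f else 0 := by
  have : ((T k ^ m * f : TateAlgebra k) : PowerSeries k) =
      PowerSeries.X ^ m * (f : PowerSeries k) := by
    simp [T]
  rw [coeff_def, this, PowerSeries.coeff_X_pow_mul']
  rfl

theorem coeff_zero_mul (f g : TateAlgebra k) : coeff 0 (f * g) = coeff 0 f * coeff 0 g := by
  simp [coeff_mul]

theorem bddAbove_norm_coeff (f : TateAlgebra k) : BddAbove (Set.range fun i => ‖coeff i f‖) :=
  (tendsto_norm_coeff f).bddAbove_range

noncomputable instance : Norm (TateAlgebra k) := ⟨gaussNorm⟩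

theorem norm_def (f : TateAlgebra k) : ‖f‖ = ⨆ i, ‖coeff i f‖ := rfl

theorem norm_coeff_le (f : TateAlgebra k) (i : ℕ) : ‖coeff i f‖ ≤ ‖f‖ :=
  le_ciSup (bddAbove_norm_coeff f) i

theorem norm_le_of_coeff {f : TateAlgebra k} {C : ℝ} (h : ∀ i, ‖coeff i f‖ ≤ C) : ‖f‖ ≤ C :=
  ciSup_le h

theorem gaussNorm_nonneg (f : TateAlgebra k) : 0 ≤ ‖f‖ :=
  (norm_nonneg _).trans (norm_coeff_le f 0)

theorem eq_zero_of_gaussNorm (f : TateAlgebra k) (h : ‖f‖ = 0) : f = 0 := by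
  ext i
  simpa using (norm_coeff_le f i).trans h.le

theorem gaussNorm_add_le (f g : TateAlgebra k) : ‖f + g‖ ≤ max ‖f‖ ‖g‖ := by
  refine norm_le_of_coeff fun i => ?_
  rw [map_add]
  exact (IsUltrametricDist.norm_add_le_max _ _).trans
    (max_le_max (norm_coeff_le f i) (norm_coeff_le g i))

theorem gaussNorm_neg (f : TateAlgebra k) : ‖-f‖ = ‖f‖ := by
  simp [norm_def]

theorem gaussNorm_mul_le (f g : TateAlgebra k) : ‖f * g‖ ≤ ‖f‖ * ‖g‖ := by
  refine norm_le_of_coeff fun i => ?_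
  rw [coeff_mul]
  refine IsUltrametricDist.norm_sum_le_of_forall_le_of_nonneg
    (mul_nonneg (gaussNorm_nonneg f) (gaussNorm_nonneg g)) fun j _ => ?_
  rw [norm_mul]
  exact mul_le_mul (norm_coeff_le f _) (norm_coeff_le g _) (norm_nonneg _) (gaussNorm_nonneg f)

noncomputable instance : NormedCommRing (TateAlgebra k) :=
  { (RingNorm.toNormedRing
      { toFun := fun f : TateAlgebra k => ‖f‖
        map_zero' := by simp [norm_def]
        add_le' := fun f g => (gaussNorm_add_le f g).trans
          (max_le_add_of_nonneg (gaussNorm_nonneg f) (gaussNorm_nonneg g))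
        neg' := gaussNorm_neg
        mul_le' := gaussNorm_mul_le
        eq_zero_of_map_eq_zero' := eq_zero_of_gaussNorm } : NormedRing (TateAlgebra k)) with
    mul_comm := mul_comm }

instance : IsUltrametricDist (TateAlgebra k) :=
  IsUltrametricDist.isUltrametricDist_of_forall_norm_add_le_max_norm gaussNorm_add_le

instance : NonarchimedeanRing (TateAlgebra k) := ⟨NonarchimedeanAddGroup.is_nonarchimedean⟩

@[simp] theorem gaussNorm_smul (c : k) (f : TateAlgebra k) : ‖c • f‖ = ‖c‖ * ‖f‖ := by
  simp only [norm_def, map_smul, smul_eq_mul, norm_mul]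
  rw [Real.mul_iSup_of_nonneg (norm_nonneg c)]

noncomputable instance : NormedAlgebra k (TateAlgebra k) where
  norm_smul_le c f := (gaussNorm_smul c f).le

theorem continuous_coeff (i : ℕ) : Continuous (coeff (k := k) i) :=
  AddMonoidHomClass.continuous_of_bound (coeff (k := k) i) 1 fun f => by
    simpa using (norm_coeff_le f) i

/-- The norm is attained, and there is a last index at which it is attained. -/
theorem exists_last (f : TateAlgebra k) (hf : f ≠ 0) :
    ∃ N, ‖coeff N f‖ = ‖f‖ ∧ ∀ i, N < i → ‖coeff i f‖ < ‖f‖ := by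
  have hpos : 0 < ‖f‖ := norm_pos_iff.2 hf
  obtain ⟨M, hM⟩ := eventually_atTop.1 ((tendsto_norm_coeff f).eventually_lt_const (half_pos hpos))
  have hex : ∃ i, ‖coeff i f‖ = ‖f‖ := by
    by_contra! hne
    have hlt : ∀ i, ‖coeff i f‖ < ‖f‖ := fun i => lt_of_le_of_ne (norm_coeff_le f i) (hne i)
    obtain ⟨j, -, hj⟩ := Finset.exists_max_image (Finset.range (M + 1)) (fun i => ‖coeff i f‖)
      ⟨0, by simp⟩
    have : ‖f‖ ≤ max (‖coeff j f‖) (‖f‖ / 2) := norm_le_of_coeff fun i => by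
      rcases lt_or_ge i (M + 1) with h | h
      · exact (hj i (by simpa using h)).trans (le_max_left _ _)
      · exact (hM i (by omega)).le.trans (le_max_right _ _)
    exact absurd this (not_le.2 (max_lt (hlt j) (half_lt_self hpos)))
  have hlt : ∀ i, ‖coeff i f‖ = ‖f‖ → i ≤ M := fun i hi => by
    by_contra! h
    have := hM i h.le
    linarith
  classical
  refine ⟨Nat.findGreatest (fun i => ‖coeff i f‖ = ‖f‖) M, ?_, fun i hi => ?_⟩
  · obtain ⟨i, hi⟩ := hex
    exact Nat.findGreatest_spec (P := fun i => ‖coeff i f‖ = ‖f‖) (hlt i hi) hi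
  · refine lt_of_le_of_ne (norm_coeff_le f i) fun h => ?_
    exact absurd (Nat.le_findGreatest (P := fun i => ‖coeff i f‖ = ‖f‖) (hlt i h) h) (by omega)

/-- The coefficient of a product at the sum of the last dominant indices. -/
theorem norm_coeff_mul_last {f g : TateAlgebra k} {M N : ℕ} (hf : ‖coeff M f‖ = ‖f‖)
    (hf' : ∀ i, M < i → ‖coeff i f‖ < ‖f‖) (hg : ‖coeff N g‖ = ‖g‖)
    (hg' : ∀ i, N < i → ‖coeff i g‖ < ‖g‖) : ‖coeff (M + N) (f * g)‖ = ‖f‖ * ‖g‖ := by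
  rcases eq_or_ne f 0 with rfl | hf0
  · simp
  rcases eq_or_ne g 0 with rfl | hg0
  · simp
  have hfp : 0 < ‖f‖ := norm_pos_iff.2 hf0
  have hgp : 0 < ‖g‖ := norm_pos_iff.2 hg0
  rw [coeff_mul, ← Finset.add_sum_erase _ _ (
    Finset.HasAntidiagonal.mem_antidiagonal.2 rfl : (M, N) ∈ _)]
  have hmain : ‖coeff M f * coeff N g‖ = ‖f‖ * ‖g‖ := by rw [norm_mul, hf, hg]
  have hrest : ‖∑ x ∈ (Finset.HasAntidiagonal.antidiagonal (M + N)).erase (M, N), coeff x.1 f * coeff x.2 g‖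
      < ‖f‖ * ‖g‖ := by
    rcases ((Finset.HasAntidiagonal.antidiagonal (M + N)).erase (M, N)).eq_empty_or_nonempty with h | h
    · rw [h]; simpa using mul_pos hfp hgp
    · obtain ⟨x, hx, hle⟩ := IsUltrametricDist.exists_norm_finsetSum_le_of_nonempty h
        (fun x => coeff x.1 f * coeff x.2 g)
      refine hle.trans_lt ?_
      rw [norm_mul]
      simp only [Finset.mem_erase, Finset.HasAntidiagonal.mem_antidiagonal, ne_eq] at hx
      rcases lt_trichotomy x.1 M with h1 | h1 | h1
      · exact mul_lt_mul' (norm_coeff_le f _) (hg' _ (by omega)) (norm_nonneg _) hfp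
      · exact absurd (Prod.ext h1 (by simp; omega)) hx.1
      · exact (mul_le_mul_of_nonneg_left (norm_coeff_le g _) (norm_nonneg _)).trans_lt
          (mul_lt_mul_of_pos_right (hf' _ h1) hgp)
  rw [IsUltrametricDist.norm_add_eq_max_of_norm_ne_norm (by rw [hmain]; exact hrest.ne'), hmain,
    max_eq_left hrest.le]

theorem norm_lt_of_coeff {f : TateAlgebra k} {C : ℝ} (hC : 0 < C) (h : ∀ i, ‖coeff i f‖ < C) :
    ‖f‖ < C := by
  rcases eq_or_ne f 0 with rfl | hf
  · simpa using hC
  · obtain ⟨N, hN, -⟩ := exists_last f hf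
    exact hN ▸ h N

/-- Gauss's lemma: the product of the last dominant coefficients is strictly larger than the other
terms of the coefficient in which it occurs, so it is not cancelled. -/
instance : NormMulClass (TateAlgebra k) where
  norm_mul f g := by
    refine le_antisymm (norm_mul_le f g) ?_
    rcases eq_or_ne f 0 with rfl | hf
    · simp
    rcases eq_or_ne g 0 with rfl | hg
    · simp
    obtain ⟨M, hM, hM'⟩ := exists_last f hf
    obtain ⟨N, hN, hN'⟩ := exists_last g hg
    rw [← norm_coeff_mul_last hM hM' hN hN']
    exact norm_coeff_le _ _

instance : NormOneClass (TateAlgebra k) where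
  norm_one := by
    refine le_antisymm (norm_le_of_coeff fun i => ?_) ?_
    · rw [coeff_one]; split_ifs <;> simp
    · simpa [coeff_one] using norm_coeff_le (1 : TateAlgebra k) 0

instance : Nontrivial (TateAlgebra k) := NormOneClass.nontrivial

instance : IsDomain (TateAlgebra k) := NoZeroDivisors.to_isDomain _

@[simp] theorem norm_T : ‖T k‖ = 1 := by
  refine le_antisymm (norm_le_of_coeff fun i => ?_) ?_
  · rw [coeff_T]; split_ifs <;> simp
  · simpa [coeff_T] using norm_coeff_le (T k) 1

theorem hasSum_coeff_smul (f : TateAlgebra k) : HasSum (fun i => coeff i f • T k ^ i) f := by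
  rw [HasSum, SummationFilter.unconditional_filter, Metric.tendsto_atTop]
  intro ε hε
  obtain ⟨M, hM⟩ := eventually_atTop.1 ((tendsto_norm_coeff f).eventually_lt_const (half_pos hε))
  refine ⟨Finset.range M, fun s hs => ?_⟩
  rw [dist_eq_norm]
  refine (norm_le_of_coeff fun i => ?_).trans_lt (half_lt_self hε)
  simp only [map_sub, map_sum, map_smul, coeff_T_pow, smul_eq_mul, mul_ite, mul_one, mul_zero,
    Finset.sum_ite_eq]
  split_ifs with h
  · simpa using (half_pos hε).le
  · have : M ≤ i := by
      by_contra! hi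
      exact h (hs (Finset.mem_range.2 hi))
    simpa using (hM i this).le

theorem algHom_ext {B : Type*} [Semiring B] [Algebra k B] [TopologicalSpace B] [T2Space B]
    {F G : TateAlgebra k →ₐ[k] B} (hF : Continuous F) (hG : Continuous G)
    (h : F (T k) = G (T k)) : F = G := by
  ext f
  have h1 := (hasSum_coeff_smul f).map F hF
  have h2 := (hasSum_coeff_smul f).map G hG
  have : (F ∘ fun i => coeff i f • T k ^ i) = G ∘ fun i => coeff i f • T k ^ i := by
    ext i; simp [h]
  rw [this] at h1
  exact h1.unique h2

/-- The formal derivative. -/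
noncomputable def deriv : Derivation k (TateAlgebra k) (TateAlgebra k) :=
  have hmem (f : TateAlgebra k) :
      PowerSeries.derivative k (f : PowerSeries k) ∈ TateAlgebra k := by
    rw [mem_iff]
    refine squeeze_zero (fun _ => norm_nonneg _) (fun i => ?_)
      ((tendsto_norm_coeff f).comp (tendsto_add_atTop_nat 1))
    rw [PowerSeries.coeff_derivative, norm_mul]
    refine mul_le_of_le_one_right (norm_nonneg _) ?_
    exact_mod_cast IsUltrametricDist.norm_natCast_le_one k (i + 1)
  Derivation.mk'
    { toFun := fun f => ⟨PowerSeries.derivative k (f : PowerSeries k), hmem f⟩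
      map_add' := fun f g => Subtype.ext (by simp)
      map_smul' := fun c f => Subtype.ext (by simp) }
    fun f g => Subtype.ext (by simp)

theorem coeff_deriv (i : ℕ) (f : TateAlgebra k) :
    coeff i (deriv f) = coeff (i + 1) f * (i + 1) :=
  PowerSeries.coeff_derivative _ _

@[simp] theorem deriv_T : deriv (T k) = 1 := by
  ext i
  rw [coeff_deriv, coeff_T, coeff_one]
  by_cases h : i = 0 <;> simp [h]

/-- Division by the coordinate. -/
theorem exists_eq_add_T_mul (f : TateAlgebra k) :
    ∃ g : TateAlgebra k, f = algebraMap k _ (coeff 0 f) + T k * g ∧ ‖g‖ ≤ ‖f‖ := by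
  refine ⟨mk (fun i => coeff (i + 1) f) ((tendsto_coeff f).comp (tendsto_add_atTop_nat 1)), ?_,
    norm_le_of_coeff fun i => by simpa using norm_coeff_le f (i + 1)⟩
  ext i
  have := coeff_T_pow_mul 1 i
    (mk (fun i => coeff (i + 1) f) ((tendsto_coeff f).comp (tendsto_add_atTop_nat 1)))
  rw [pow_one] at this
  rw [map_add, this, coeff_algebraMap]
  rcases i with - | i <;> simp

theorem exists_eq_T_pow_mul {f : TateAlgebra k} {n : ℕ} (h : ∀ i < n, coeff i f = 0) :
    ∃ g : TateAlgebra k, f = T k ^ n * g ∧ ∀ i, coeff i g = coeff (n + i) f := by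
  refine ⟨mk (fun i => coeff (n + i) f) ((tendsto_coeff f).comp
    (tendsto_atTop_mono (fun i => Nat.le_add_left i n) tendsto_id)), ?_, by simp⟩
  ext i
  rw [coeff_T_pow_mul]
  split_ifs with hi
  · simp [hi]
  · exact h i (by omega)

theorem exists_eq_T_pow_mul_coeff_zero_ne {f : TateAlgebra k} (hf : f ≠ 0) :
    ∃ (n : ℕ) (g : TateAlgebra k), f = T k ^ n * g ∧ coeff 0 g ≠ 0 := by
  classical
  have hex : ∃ n, coeff n f ≠ 0 := by
    by_contra! h
    exact hf (ext fun i => by simp [h i])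
  obtain ⟨g, hg, hgc⟩ := exists_eq_T_pow_mul (f := f) (n := Nat.find hex)
    fun i hi => not_not.1 (Nat.find_min hex hi)
  exact ⟨_, g, hg, by rw [hgc]; exact Nat.find_spec hex⟩

/-- The last dominant index is additive under multiplication and is 0 for the constant 1, so it is 0
for every unit. -/
theorem norm_coeff_zero_of_isUnit {u : TateAlgebra k} (hu : IsUnit u) :
    ‖coeff 0 u‖ = ‖u‖ ∧ ∀ i, 0 < i → ‖coeff i u‖ < ‖u‖ := by
  obtain ⟨v, huv⟩ := hu.exists_right_inv
  have hu0 : u ≠ 0 := hu.ne_zero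
  have hv0 : v ≠ 0 := by rintro rfl; simp at huv
  obtain ⟨M, hM, hM'⟩ := exists_last u hu0
  obtain ⟨N, hN, hN'⟩ := exists_last v hv0
  have h := norm_coeff_mul_last hM hM' hN hN'
  rw [huv, coeff_one, ← norm_mul, huv, norm_one] at h
  have hMN : M + N = 0 := by
    by_contra hne
    rw [if_neg hne] at h
    simp at h
  obtain rfl : M = 0 := by omega
  exact ⟨hM, hM'⟩

section Complete

variable [CompleteSpace k]

instance : CompleteSpace (TateAlgebra k) := by
  refine Metric.complete_of_cauchySeq_tendsto fun u hu => ?_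
  have hc : ∀ i, ∃ a, Tendsto (fun n => coeff i (u n)) atTop (𝓝 a) := fun i =>
    cauchySeq_tendsto_of_complete
      (hu.map ((AddMonoidHomClass.lipschitz_of_bound (coeff (k := k) i) 1 fun f => by
        simpa using norm_coeff_le f i).uniformContinuous))
  choose a ha using hc
  have key : ∀ ε > 0, ∃ N, ∀ n ≥ N, ∀ i, ‖coeff i (u n) - a i‖ ≤ ε := by
    intro ε hε
    obtain ⟨N, hN⟩ := Metric.cauchySeq_iff.1 hu ε hε
    refine ⟨N, fun n hn i => ?_⟩
    refine le_of_tendsto ((tendsto_const_nhds.sub (ha i)).norm) (eventually_atTop.2 ⟨N, ?_⟩)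
    intro m hm
    rw [← map_sub]
    exact (norm_coeff_le _ _).trans (by simpa [dist_eq_norm] using (hN n hn m hm).le)
  have ha0 : Tendsto a atTop (𝓝 0) := by
    rw [Metric.tendsto_atTop]
    intro ε hε
    obtain ⟨N, hN⟩ := key (ε / 2) (half_pos hε)
    obtain ⟨M, hM⟩ := eventually_atTop.1
      ((tendsto_norm_coeff (u N)).eventually_lt_const (half_pos hε))
    refine ⟨M, fun i hi => ?_⟩
    have h1 := hN N le_rfl i
    have h2 := hM i hi
    rw [dist_zero_right]
    calc ‖a i‖ = ‖coeff i (u N) - (coeff i (u N) - a i)‖ := by rw [sub_sub_cancel]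
      _ ≤ ‖coeff i (u N)‖ + ‖coeff i (u N) - a i‖ := norm_sub_le _ _
      _ < ε := by linarith
  refine ⟨mk a ha0, Metric.tendsto_atTop.2 fun ε hε => ?_⟩
  obtain ⟨N, hN⟩ := key (ε / 2) (half_pos hε)
  refine ⟨N, fun n hn => ?_⟩
  rw [dist_eq_norm]
  refine (norm_le_of_coeff fun i => ?_).trans_lt (half_lt_self hε)
  simpa using hN n hn i

theorem isUnit_of_norm_sub_lt {u : TateAlgebra k} {c : k}
    (h : ‖u - algebraMap k _ c‖ < ‖c‖) : IsUnit u := by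
  have hc : c ≠ 0 := by rintro rfl; simpa using (norm_nonneg _).trans_lt h
  have h1 : u = algebraMap k _ c * (1 - -(c⁻¹ • (u - algebraMap k _ c))) := by
    rw [Algebra.smul_def, sub_neg_eq_add, mul_add, ← mul_assoc, ← map_mul, mul_inv_cancel₀ hc]
    simp
  rw [h1]
  refine ((IsUnit.mk0 c hc).map (algebraMap k _)).mul (isUnit_one_sub_of_norm_lt_one ?_)
  rw [norm_neg, gaussNorm_smul, norm_inv, inv_mul_lt_one₀ (norm_pos_iff.2 hc)]
  exact h

end Complete

/-! ### Evaluation of restricted power series -/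

section Eval

set_option linter.unusedSectionVars false

variable {B : Type*} [NormedCommRing B] [NormOneClass B] [IsUltrametricDist B] [CompleteSpace B]
  [NormedAlgebra k B]

theorem norm_pow_le_one_of_norm_le_one {b : B} (hb : ‖b‖ ≤ 1) (i : ℕ) : ‖b ^ i‖ ≤ 1 :=
  (norm_pow_le b i).trans (pow_le_one₀ (norm_nonneg _) hb)

theorem summable_coeff_smul (f : TateAlgebra k) {b : ℕ → B} (hb : ∀ i, ‖b i‖ ≤ 1) :
    Summable fun i => coeff i f • b i := by
  refine NonarchimedeanAddGroup.summable_of_tendsto_cofinite_zero ?_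
  rw [Nat.cofinite_eq_atTop, tendsto_zero_iff_norm_tendsto_zero]
  refine squeeze_zero (fun _ => norm_nonneg _) (fun i => ?_) (tendsto_norm_coeff f)
  rw [norm_smul]
  exact mul_le_of_le_one_right (norm_nonneg _) (hb i)

theorem norm_tsum_coeff_smul_le (f : TateAlgebra k) {b : ℕ → B} (hb : ∀ i, ‖b i‖ ≤ 1) :
    ‖∑' i, coeff i f • b i‖ ≤ ‖f‖ :=
  IsUltrametricDist.norm_tsum_le_of_forall_le_of_nonneg (norm_nonneg _) fun i => by
    rw [norm_smul]
    exact (mul_le_of_le_one_right (norm_nonneg _) (hb i)).trans (norm_coeff_le f i)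

theorem smul_pow_add (b : B) (c d : k) (i j : ℕ) :
    (c * d) • b ^ (i + j) = (c • b ^ i) * (d • b ^ j) := by
  rw [pow_add, smul_mul_assoc, mul_smul_comm, mul_smul]

theorem tsum_mul_tsum_of_ultrametric {f g : ℕ → B} (hf : Summable f) (hg : Summable g) :
    (∑' i, f i) * ∑' i, g i =
      ∑' n, ∑ x ∈ Finset.HasAntidiagonal.antidiagonal n, f x.1 * g x.2 := by
  have : NonarchimedeanRing B := ⟨NonarchimedeanAddGroup.is_nonarchimedean⟩
  exact hf.tsum_mul_tsum_eq_tsum_sum_antidiagonal hg (hf.mul_of_nonarchimedean hg)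

theorem tsum_coeff_mul_smul_pow {b : B} (hb : ‖b‖ ≤ 1) (f g : TateAlgebra k) :
    ∑' i, coeff i (f * g) • b ^ i = (∑' i, coeff i f • b ^ i) * ∑' i, coeff i g • b ^ i := by
  rw [tsum_mul_tsum_of_ultrametric
    (summable_coeff_smul f (norm_pow_le_one_of_norm_le_one hb))
    (summable_coeff_smul g (norm_pow_le_one_of_norm_le_one hb))]
  refine tsum_congr fun n => ?_
  rw [coeff_mul, Finset.sum_smul]
  refine Finset.sum_congr rfl fun x hx => ?_
  rw [← smul_pow_add, Finset.HasAntidiagonal.mem_antidiagonal.1 hx]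

/-- Evaluation of restricted power series at an element of norm at most one. -/
noncomputable def eval (b : B) (hb : ‖b‖ ≤ 1) : TateAlgebra k →ₐ[k] B :=
  AlgHom.ofLinearMap
    { toFun := fun f => ∑' i, coeff i f • b ^ i
      map_add' := fun f g => by
        rw [← (summable_coeff_smul f (norm_pow_le_one_of_norm_le_one hb)).tsum_add
          (summable_coeff_smul g (norm_pow_le_one_of_norm_le_one hb))]
        simp [add_smul]
      map_smul' := fun c f => by
        rw [RingHom.id_apply,
          ← (summable_coeff_smul f (norm_pow_le_one_of_norm_le_one hb)).tsum_const_smul c]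
        simp [smul_smul] }
    (by
      change ∑' i, coeff i (1 : TateAlgebra k) • b ^ i = 1
      rw [tsum_eq_single 0 fun i hi => by simp [coeff_one, hi]]
      simp [coeff_one])
    (tsum_coeff_mul_smul_pow hb)

theorem eval_apply (b : B) (hb : ‖b‖ ≤ 1) (f : TateAlgebra k) :
    eval b hb f = ∑' i, coeff i f • b ^ i := rfl

@[simp] theorem eval_T (b : B) (hb : ‖b‖ ≤ 1) : eval b hb (T k) = b := by
  rw [eval_apply, tsum_eq_single 1 fun i hi => by simp [coeff_T, hi]]
  simp [coeff_T]

theorem norm_eval_le (b : B) (hb : ‖b‖ ≤ 1) (f : TateAlgebra k) : ‖eval b hb f‖ ≤ ‖f‖ :=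
  norm_tsum_coeff_smul_le f (norm_pow_le_one_of_norm_le_one hb)

theorem continuous_of_norm_le {F : TateAlgebra k →ₐ[k] B} (h : ∀ f, ‖F f‖ ≤ ‖f‖) : Continuous F :=
  AddMonoidHomClass.continuous_of_bound F 1 fun f => by simpa using h f

/-- Each `a ^ i - b ^ i` is `a - b` times a sum of norm at most 1. Having the quotient `q`, and not
only a norm estimate, lets the Newton iteration keep an exact factor `T ^ n` in its error term. -/
theorem eval_sub_eval {a b : B} (ha : ‖a‖ ≤ 1) (hb : ‖b‖ ≤ 1) (f : TateAlgebra k) :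
    ∃ q : B, ‖q‖ ≤ ‖f‖ ∧ eval a ha f - eval b hb f = (a - b) * q := by
  have hc : ∀ i, ‖∑ j ∈ Finset.range i, a ^ j * b ^ (i - 1 - j)‖ ≤ 1 := fun i =>
    IsUltrametricDist.norm_sum_le_of_forall_le_of_nonneg zero_le_one fun j _ =>
      (norm_mul_le _ _).trans (mul_le_one₀ (norm_pow_le_one_of_norm_le_one ha _) (norm_nonneg _)
        (norm_pow_le_one_of_norm_le_one hb _))
  refine ⟨∑' i, coeff i f • ∑ j ∈ Finset.range i, a ^ j * b ^ (i - 1 - j),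
    norm_tsum_coeff_smul_le f hc, ?_⟩
  rw [eval_apply, eval_apply,
    ← (summable_coeff_smul f (norm_pow_le_one_of_norm_le_one ha)).tsum_sub
      (summable_coeff_smul f (norm_pow_le_one_of_norm_le_one hb)),
    ← (summable_coeff_smul f hc).tsum_mul_left]
  refine tsum_congr fun i => ?_
  rw [mul_smul_comm, mul_comm (a - b), geom_sum₂_mul, smul_sub]

end Eval

end Norm
end TateAlgebra

/-! ### Successive approximation -/

/-- A bounded additive map between ultrametric groups, the source being complete, which is
approximately surjective with control on preimages is surjective with the same control. -/
theorem exists_preimage_of_approx {E F : Type*} [NormedAddCommGroup E] [CompleteSpace E]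
    [NormedAddCommGroup F] (S : E →+ F) (hS : Continuous S)
    (w : E → ℝ) (hw : Continuous w) (hw0 : w 0 ≤ 0) (hadd : ∀ u v, w (u + v) ≤ max (w u) (w v))
    {C : ℝ} (hC0 : 0 ≤ C) (hC : ∀ u, ‖u‖ ≤ C * w u) {ε : ℝ} (hε0 : 0 ≤ ε) (hε : ε < 1)
    (h : ∀ v, ∃ u, w u ≤ ‖v‖ ∧ ‖v - S u‖ ≤ ε * ‖v‖) (v : F) :
    ∃ u, S u = v ∧ w u ≤ ‖v‖ := by
  -- `r n` is the error left after `n` corrections, and the preimage is the sum of all corrections.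
  -- The size `w` is kept apart from the norm so that a weighted bound survives without loss; `C`
  -- only ensures convergence.
  choose g hg hg' using h
  let r : ℕ → F := fun n => (fun x => x - S (g x))^[n] v
  have hr : ∀ n, r (n + 1) = r n - S (g (r n)) := fun n => Function.iterate_succ_apply' _ _ _
  have hrn : ∀ n, ‖r n‖ ≤ ε ^ n * ‖v‖ := by
    intro n
    induction n with
    | zero => simp [r]
    | succ n ih =>
      rw [hr, pow_succ', mul_assoc]
      exact (hg' _).trans (mul_le_mul_of_nonneg_left ih hε0)
  have hrv : ∀ n, ‖r n‖ ≤ ‖v‖ := fun n => (hrn n).trans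
    (mul_le_of_le_one_left (norm_nonneg _) (pow_le_one₀ hε0 hε.le))
  have hb : ∀ n, ‖g (r n)‖ ≤ C * ‖v‖ * ε ^ n := by
    intro n
    calc ‖g (r n)‖ ≤ C * w (g (r n)) := hC _
      _ ≤ C * ‖r n‖ := mul_le_mul_of_nonneg_left (hg _) hC0
      _ ≤ C * (ε ^ n * ‖v‖) := mul_le_mul_of_nonneg_left (hrn n) hC0
      _ = _ := by ring
  have hsum : Summable fun n => g (r n) :=
    Summable.of_norm_bounded ((summable_geometric_of_lt_one hε0 hε).mul_left _) hb
  refine ⟨∑' n, g (r n), ?_, ?_⟩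
  · have h1 := (hsum.hasSum.map S hS).tendsto_sum_nat
    have h2 : ∀ n, ∑ i ∈ Finset.range n, (S ∘ fun n => g (r n)) i = v - r n := by
      intro n
      induction n with
      | zero => simp [r]
      | succ n ih => rw [Finset.sum_range_succ, ih, hr, Function.comp_apply]; abel
    simp_rw [h2] at h1
    have h3 : Tendsto r atTop (𝓝 0) := by
      rw [tendsto_zero_iff_norm_tendsto_zero]
      refine squeeze_zero (fun _ => norm_nonneg _) hrn ?_
      simpa using (tendsto_pow_atTop_nhds_zero_of_lt_one hε0 hε).mul_const ‖v‖
    have h4 := (tendsto_const_nhds (x := v)).sub h3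
    rw [sub_zero] at h4
    exact tendsto_nhds_unique h1 h4
  · have h1 := (hw.tendsto _).comp hsum.hasSum.tendsto_sum_nat
    refine le_of_tendsto h1 (Eventually.of_forall fun n => ?_)
    change w (∑ i ∈ Finset.range n, g (r i)) ≤ ‖v‖
    induction n with
    | zero => simpa using hw0.trans (norm_nonneg v)
    | succ n ih =>
      rw [Finset.sum_range_succ]
      exact (hadd _ _).trans (max_le ih ((hg _).trans (hrv n)))

theorem IsUltrametricDist.norm_sub_le_max' {E : Type*} [SeminormedAddCommGroup E]
    [IsUltrametricDist E] (x y : E) : ‖x - y‖ ≤ max ‖x‖ ‖y‖ := by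
  simpa [sub_eq_add_neg] using IsUltrametricDist.norm_add_le_max x (-y)

namespace TateAlgebra

variable {k : Type*} [NormedField k] [IsUltrametricDist k]

theorem exists_norm_sub_sum_lt (f : TateAlgebra k) {ε : ℝ} (hε : 0 < ε) :
    ∃ M, ‖f - ∑ i ∈ Finset.range M, coeff i f • T k ^ i‖ < ε := by
  have h := Metric.tendsto_atTop.1 (hasSum_coeff_smul f).tendsto_sum_nat ε hε
  obtain ⟨M, hM⟩ := h
  exact ⟨M, by simpa [dist_eq_norm, norm_sub_rev] using hM M le_rfl⟩

/-! ### Weierstrass division and zeros of functions on the disc -/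

section Division

/-- Polynomial division by the truncation of `u` at degree `N`: its leading coefficient has norm 1
and the others at most 1, so rewriting `t ^ N` through lower powers never increases norms. -/
theorem exists_T_pow_eq_mul_add {u : TateAlgebra k} {N : ℕ} (hu : ‖u‖ = 1)
    (hN : ‖coeff N u‖ = 1) (m : ℕ) :
    ∃ (q : TateAlgebra k) (r : Fin N → k), ‖q‖ ≤ 1 ∧ ‖r‖ ≤ 1 ∧
      T k ^ m = (∑ i ∈ Finset.range (N + 1), coeff i u • T k ^ i) * q +
        ∑ i, r i • T k ^ (i : ℕ) := by
  set U := ∑ i ∈ Finset.range (N + 1), coeff i u • T k ^ i with hU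
  induction m using Nat.strong_induction_on with
  | _ m ih =>
    rcases lt_or_ge m N with hm | hm
    · refine ⟨0, Pi.single ⟨m, hm⟩ 1, by simp, ?_, ?_⟩
      · refine (pi_norm_le_iff_of_nonneg zero_le_one).2 fun i => ?_
        rcases eq_or_ne i ⟨m, hm⟩ with rfl | h
        · simp
        · simp [h]
      · rw [mul_zero, zero_add, Finset.sum_eq_single ⟨m, hm⟩] <;> simp +contextual
    · have hne : coeff N u ≠ 0 := norm_ne_zero_iff.1 (by rw [hN]; exact one_ne_zero)
      have ih' : ∀ i : Fin N, ∃ (q : TateAlgebra k) (r : Fin N → k), ‖q‖ ≤ 1 ∧ ‖r‖ ≤ 1 ∧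
          T k ^ (m - N + i) = U * q + ∑ i, r i • T k ^ (i : ℕ) := fun i => ih _ (by omega)
      choose q r hq hr hqr using ih'
      have hc : ∀ i, ‖coeff i u / coeff N u‖ ≤ 1 := fun i => by
        rw [norm_div, hN, div_one, ← hu]; exact norm_coeff_le u i
      refine ⟨(coeff N u)⁻¹ • T k ^ (m - N) - ∑ i : Fin N, (coeff i u / coeff N u) • q i,
        -∑ i : Fin N, (coeff i u / coeff N u) • r i, ?_, ?_, ?_⟩
      · refine (IsUltrametricDist.norm_sub_le_max' _ _).trans (max_le ?_ ?_)
        · simp [norm_smul, hN]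
        · refine IsUltrametricDist.norm_sum_le_of_forall_le_of_nonneg zero_le_one fun i _ => ?_
          rw [norm_smul]
          exact mul_le_one₀ (hc _) (norm_nonneg _) (hq i)
      · rw [norm_neg]
        refine (pi_norm_le_iff_of_nonneg zero_le_one).2 fun j => ?_
        rw [Finset.sum_apply]
        refine IsUltrametricDist.norm_sum_le_of_forall_le_of_nonneg zero_le_one fun i _ => ?_
        rw [Pi.smul_apply, norm_smul]
        exact mul_le_one₀ (hc _) (norm_nonneg _) ((norm_le_pi_norm _ _).trans (hr i))
      · have h1 : U = (∑ i : Fin N, coeff i u • T k ^ (i : ℕ)) + coeff N u • T k ^ N := by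
          rw [hU, Finset.sum_range_succ, Finset.sum_range]
        have h2 : T k ^ m = (coeff N u)⁻¹ • (T k ^ (m - N) * (U - ∑ i : Fin N, coeff i u • T k ^ (i : ℕ))) := by
          rw [h1, add_sub_cancel_left, mul_smul_comm, ← pow_add, Nat.sub_add_cancel hm,
            inv_smul_smul₀ hne]
        have h3 : T k ^ (m - N) * ∑ i : Fin N, coeff i u • T k ^ (i : ℕ) =
            ∑ i : Fin N, coeff i u • (U * q i + ∑ j, r i j • T k ^ (j : ℕ)) := by
          rw [Finset.mul_sum]
          refine Finset.sum_congr rfl fun i _ => ?_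
          rw [mul_smul_comm, ← pow_add, hqr]
        rw [h2, mul_sub, h3]
        simp only [smul_sub, Finset.smul_sum, smul_add, smul_smul, mul_sub, Finset.mul_sum,
          mul_smul_comm, Finset.sum_add_distrib, Pi.neg_apply, Finset.sum_apply, Pi.smul_apply,
          neg_smul, Finset.sum_smul, smul_eq_mul, Finset.sum_neg_distrib, mul_comm (T k ^ (m - N)) U,
          inv_mul_eq_div]
        rw [Finset.sum_comm (f := fun (i j : Fin N) =>
          (coeff (i : ℕ) u * r i j / coeff N u) • T k ^ (j : ℕ))]
        simp only [div_mul_eq_mul_div]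
        abel

variable [CompleteSpace k]

/-- Weierstrass division, with quotient and remainder of controlled norm. -/
theorem exists_eq_mul_add {u : TateAlgebra k} {N : ℕ} (hu : ‖u‖ = 1)
    (hN : ‖coeff N u‖ = 1) (hN' : ∀ i, N < i → ‖coeff i u‖ < 1) (g : TateAlgebra k) :
    ∃ (q : TateAlgebra k) (r : Fin N → k), g = u * q + ∑ i, r i • T k ^ (i : ℕ) := by
  set U := ∑ i ∈ Finset.range (N + 1), coeff i u • T k ^ i with hU
  have hε : ‖u - U‖ < 1 := by
    refine norm_lt_of_coeff one_pos fun i => ?_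
    simp only [hU, map_sub, map_sum, map_smul, coeff_T_pow, smul_eq_mul, mul_ite, mul_one,
      mul_zero, Finset.sum_ite_eq, Finset.mem_range]
    split_ifs with h
    · simp
    · simpa using hN' i (by omega)
  let S : TateAlgebra k × (Fin N → k) →+ TateAlgebra k :=
    { toFun := fun x => u * x.1 + ∑ i, x.2 i • T k ^ (i : ℕ)
      map_zero' := by simp
      map_add' := fun x y => by
        simp only [Prod.fst_add, Prod.snd_add, Pi.add_apply, add_smul, Finset.sum_add_distrib,
          mul_add]
        abel }
  have hS : Continuous S := by
    change Continuous fun x : TateAlgebra k × (Fin N → k) => u * x.1 + ∑ i, x.2 i • T k ^ (i : ℕ)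
    fun_prop
  -- A polynomial truncation of `v` is divided by `U`. The errors are the tail of `v`, made smaller
  -- than `‖v‖ / 2`, and `u - U` times the quotient; hence the contraction factor.
  have happrox : ∀ v, ∃ x : TateAlgebra k × (Fin N → k), ‖x‖ ≤ ‖v‖ ∧
      ‖v - S x‖ ≤ max ‖u - U‖ (1 / 2) * ‖v‖ := by
    intro v
    rcases eq_or_ne v 0 with rfl | hv
    · exact ⟨0, by simp, by simp⟩
    have hvp := norm_pos_iff.2 hv
    choose q r hq hr hqr using exists_T_pow_eq_mul_add hu hN
    obtain ⟨M, hM⟩ := exists_norm_sub_sum_lt v (half_pos hvp)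
    have hq' : ‖∑ i ∈ Finset.range M, coeff i v • q i‖ ≤ ‖v‖ := by
      refine IsUltrametricDist.norm_sum_le_of_forall_le_of_nonneg hvp.le fun i _ => ?_
      rw [norm_smul]
      exact (mul_le_of_le_one_right (norm_nonneg _) (hq i)).trans (norm_coeff_le v i)
    refine ⟨(∑ i ∈ Finset.range M, coeff i v • q i, ∑ i ∈ Finset.range M, coeff i v • r i), ?_, ?_⟩
    · rw [Prod.norm_def]
      refine max_le hq' ((pi_norm_le_iff_of_nonneg hvp.le).2 fun j => ?_)
      change ‖(∑ i ∈ Finset.range M, coeff i v • r i) j‖ ≤ ‖v‖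
      rw [Finset.sum_apply]
      refine IsUltrametricDist.norm_sum_le_of_forall_le_of_nonneg hvp.le fun i _ => ?_
      rw [Pi.smul_apply, norm_smul]
      exact (mul_le_of_le_one_right (norm_nonneg _)
        ((norm_le_pi_norm _ _).trans (hr i))).trans (norm_coeff_le v i)
    · have h1 : ∑ i ∈ Finset.range M, coeff i v • T k ^ i =
          U * (∑ i ∈ Finset.range M, coeff i v • q i) +
            ∑ j, (∑ i ∈ Finset.range M, coeff i v • r i) j • T k ^ (j : ℕ) := by
        rw [Finset.sum_congr rfl fun i _ => congrArg (coeff i v • ·) (hqr i)]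
        simp only [smul_add, Finset.sum_add_distrib, Finset.mul_sum, mul_smul_comm,
          Finset.sum_apply, Finset.sum_smul, Finset.smul_sum, Pi.smul_apply, smul_eq_mul, mul_smul]
        rw [Finset.sum_comm (s := Finset.range M)]
      have h2 : v - S (∑ i ∈ Finset.range M, coeff i v • q i, ∑ i ∈ Finset.range M, coeff i v • r i)
          = (v - ∑ i ∈ Finset.range M, coeff i v • T k ^ i) -
            (u - U) * ∑ i ∈ Finset.range M, coeff i v • q i := by
        rw [h1]
        change v - (u * (∑ i ∈ Finset.range M, coeff i v • q i) +
          ∑ j, (∑ i ∈ Finset.range M, coeff i v • r i) j • T k ^ (j : ℕ)) = _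
        ring
      rw [h2]
      refine (IsUltrametricDist.norm_sub_le_max' _ _).trans (max_le ?_ ?_)
      · refine hM.le.trans ?_
        have := le_max_right ‖u - U‖ (1 / 2)
        nlinarith
      · rw [norm_mul]
        exact mul_le_mul (le_max_left _ _) hq' (norm_nonneg _) (le_max_of_le_left (norm_nonneg _))
  obtain ⟨x, hx, -⟩ := exists_preimage_of_approx S hS (fun x => ‖x‖) continuous_norm (by simp)
    (fun a b => by
      simp only [Prod.norm_def, Prod.fst_add, Prod.snd_add]
      exact max_le ((IsUltrametricDist.norm_add_le_max _ _).trans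
          (max_le_max (le_max_left _ _) (le_max_left _ _)))
        ((IsUltrametricDist.norm_add_le_max _ _).trans
          (max_le_max (le_max_right _ _) (le_max_right _ _))))
    zero_le_one (fun u => by simp) (le_max_of_le_right (by norm_num : (0 : ℝ) ≤ 1 / 2))
    (max_lt hε (by norm_num))
    happrox g
  exact ⟨x.1, x.2, hx.symm⟩

/-- A function on the disc without zeros is invertible. -/
theorem exists_algHom_eq_zero [IsAlgClosed k] {u : TateAlgebra k} (hu0 : u ≠ 0)
    (hu : ¬ IsUnit u) : ∃ ψ : TateAlgebra k →ₐ[k] k, ψ u = 0 := by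
  obtain ⟨N, hN, hN'⟩ := exists_last u hu0
  have hne : coeff N u ≠ 0 := norm_ne_zero_iff.1 (by rw [hN]; exact norm_ne_zero_iff.2 hu0)
  set v := (coeff N u)⁻¹ • u with hv
  have hvn : ‖v‖ = 1 := by
    rw [hv, norm_smul, norm_inv, hN, inv_mul_cancel₀ (norm_ne_zero_iff.2 hu0)]
  have hvN : ‖coeff N v‖ = 1 := by simp [hv, hne]
  have hvN' : ∀ i, N < i → ‖coeff i v‖ < 1 := fun i hi => by
    rw [hv, map_smul, norm_smul, norm_inv, hN, inv_mul_lt_one₀ (norm_pos_iff.2 hu0)]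
    exact hN' i hi
  obtain ⟨M, hM, huM⟩ := exists_max_ideal_of_mem_nonunits hu
  have hvM : v ∈ M := by rw [hv, Algebra.smul_def]; exact M.mul_mem_left _ huM
  -- Weierstrass division leaves only the powers `t ^ i` with `i < N`, so the residue field of a
  -- maximal ideal containing `u` is finite over `k`, hence equal to `k`.
  have hfin : Module.Finite k (TateAlgebra k ⧸ M) := by
    refine Module.Finite.of_surjective
      (∑ i : Fin N, (LinearMap.proj i : (Fin N → k) →ₗ[k] k).smulRight
        (Ideal.Quotient.mkₐ k M (T k ^ (i : ℕ)))) fun x => ?_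
    obtain ⟨g, rfl⟩ := Ideal.Quotient.mkₐ_surjective k M x
    obtain ⟨q, r, rfl⟩ := exists_eq_mul_add hvn hvN hvN' g
    refine ⟨r, ?_⟩
    have : Ideal.Quotient.mkₐ k M (v * q) = 0 :=
      Ideal.Quotient.eq_zero_iff_mem.2 (M.mul_mem_right _ hvM)
    rw [map_add, this, zero_add]
    simp only [map_sum, map_smul, LinearMap.sum_apply, LinearMap.smulRight_apply,
      LinearMap.proj_apply]
  have hint : Algebra.IsIntegral k (TateAlgebra k ⧸ M) := Algebra.IsIntegral.of_finite _ _
  let e : k ≃ₐ[k] TateAlgebra k ⧸ M := AlgEquiv.ofBijective (Algebra.ofId _ _)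
    (IsAlgClosed.algebraMap_bijective_of_isIntegral (k := k) (K := TateAlgebra k ⧸ M))
  refine ⟨e.symm.toAlgHom.comp (Ideal.Quotient.mkₐ k M), ?_⟩
  have : Ideal.Quotient.mkₐ k M u = 0 := Ideal.Quotient.eq_zero_iff_mem.2 huM
  change e.symm (Ideal.Quotient.mkₐ k M u) = 0
  rw [this]
  exact e.symm.map_zero

end Division

/-! ### Automatic continuity of homomorphisms, and coordinates -/

section Hom

set_option linter.unusedSectionVars false

variable [CompleteSpace k]

/-- Otherwise the constant `χ g` dominates `g`, so `χ g - g` is a unit, yet `χ` kills it. -/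
theorem norm_algHom_field_le (χ : TateAlgebra k →ₐ[k] k) (g : TateAlgebra k) : ‖χ g‖ ≤ ‖g‖ := by
  by_contra! h
  have hu : IsUnit (algebraMap k _ (χ g) - g) := isUnit_of_norm_sub_lt (c := χ g) (by simpa using h)
  have := hu.map χ
  simp at this

theorem algHom_field_ext {χ χ' : TateAlgebra k →ₐ[k] k} (h : χ (T k) = χ' (T k)) : χ = χ' :=
  algHom_ext (continuous_of_norm_le (norm_algHom_field_le χ))
    (continuous_of_norm_le (norm_algHom_field_le χ')) h

/-- Homomorphisms between Tate algebras are automatically contracting. -/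
theorem norm_algHom_le (F : TateAlgebra k →ₐ[k] TateAlgebra k) (g : TateAlgebra k) :
    ‖F g‖ ≤ ‖g‖ := by
  by_contra! h
  have hF0 : F g ≠ 0 := norm_pos_iff.1 ((norm_nonneg _).trans_lt h)
  -- For `c` the coefficient of `F g` at `N`, `c - g` is a unit, hence so is `c - F g`. But its
  -- constant term is not strictly dominant: it vanishes if `N = 0`, and if `N > 0` its norm is at
  -- most `‖F g‖`, the norm of the coefficient at `N`.
  obtain ⟨N, hN, -⟩ := exists_last (F g) hF0
  have hu : IsUnit (algebraMap k _ (coeff N (F g)) - g) :=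
    isUnit_of_norm_sub_lt (c := coeff N (F g)) (by simpa [hN] using h)
  have hu' := hu.map F
  rw [map_sub, AlgHom.commutes] at hu'
  obtain ⟨h0, hi⟩ := norm_coeff_zero_of_isUnit hu'
  rcases Nat.eq_zero_or_pos N with rfl | hpos
  · rw [map_sub, coeff_zero_algebraMap, sub_self, norm_zero] at h0
    exact hu'.ne_zero (norm_eq_zero.1 h0.symm)
  · have h1 := hi N hpos
    rw [map_sub, coeff_algebraMap, if_neg hpos.ne', zero_sub, norm_neg, hN] at h1
    refine absurd h1 (not_lt.2 ((IsUltrametricDist.norm_sub_le_max' _ _).trans (max_le ?_ le_rfl)))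
    rw [norm_algebraMap', hN]

theorem algHom_continuous (F : TateAlgebra k →ₐ[k] TateAlgebra k) : Continuous F :=
  continuous_of_norm_le (norm_algHom_le F)

theorem algHom_ext' {F G : TateAlgebra k →ₐ[k] TateAlgebra k} (h : F (T k) = G (T k)) : F = G :=
  algHom_ext (algHom_continuous F) (algHom_continuous G) h

theorem algHom_eq_eval (F : TateAlgebra k →ₐ[k] TateAlgebra k) (h : ‖F (T k)‖ ≤ 1) :
    F = eval (F (T k)) h := algHom_ext' (by simp)

theorem norm_algHom_T_le (F : TateAlgebra k →ₐ[k] TateAlgebra k) : ‖F (T k)‖ ≤ 1 := by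
  simpa using norm_algHom_le F (T k)

theorem norm_algEquiv (e : TateAlgebra k ≃ₐ[k] TateAlgebra k) (g : TateAlgebra k) :
    ‖e g‖ = ‖g‖ := by
  refine le_antisymm (norm_algHom_le (e : TateAlgebra k →ₐ[k] TateAlgebra k) g) ?_
  simpa using norm_algHom_le (e.symm : TateAlgebra k →ₐ[k] TateAlgebra k) (e g)

theorem norm_smul_T_pow_le {c : k} (hc : ‖c‖ ≤ 1) (m : ℕ) : ‖c • T k ^ m‖ ≤ 1 := by
  simpa [norm_smul] using hc

theorem coeff_eval_smul_T_pow {c : k} (hc : ‖c‖ ≤ 1) {m : ℕ} (hm : 0 < m) (g : TateAlgebra k)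
    (n : ℕ) : coeff n (eval (c • T k ^ m) (norm_smul_T_pow_le hc m) g) =
      if m ∣ n then c ^ (n / m) * coeff (n / m) g else 0 := by
  have hs := (summable_coeff_smul g
    (norm_pow_le_one_of_norm_le_one (norm_smul_T_pow_le hc m))).hasSum.map (coeff n)
      (continuous_coeff n)
  have hterm : ∀ i, (coeff n ∘ fun i => coeff i g • (c • T k ^ m) ^ i) i =
      if n = m * i then coeff i g * c ^ i else 0 := fun i => by
    simp [smul_pow, ← pow_mul, coeff_T_pow]
  rw [eval_apply]
  refine hs.unique ?_
  split_ifs with h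
  · obtain ⟨j, rfl⟩ := h
    rw [Nat.mul_div_cancel_left _ hm]
    have := hasSum_single (f := coeff (m * j) ∘ fun i => coeff i g • (c • T k ^ m) ^ i) j
      fun i hi => by
        rw [hterm, if_neg]
        exact fun h => hi (Nat.eq_of_mul_eq_mul_left hm h).symm
    rw [hterm, if_pos rfl, mul_comm (coeff j g)] at this
    exact this
  · have : (coeff n ∘ fun i => coeff i g • (c • T k ^ m) ^ i) = fun _ => 0 := by
      ext i
      rw [hterm, if_neg]
      rintro rfl
      exact h (dvd_mul_right _ _)
    rw [this]
    exact hasSum_zero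

theorem norm_eval_smul_T_pow {c : k} (hc : ‖c‖ = 1) {m : ℕ} (hm : 0 < m) (g : TateAlgebra k) :
    ‖eval (c • T k ^ m) (norm_smul_T_pow_le hc.le m) g‖ = ‖g‖ := by
  refine le_antisymm (norm_eval_le _ _ _) (norm_le_of_coeff fun i => ?_)
  have h := coeff_eval_smul_T_pow hc.le hm g (m * i)
  rw [if_pos (dvd_mul_right _ _), Nat.mul_div_cancel_left _ hm] at h
  have h2 := norm_coeff_le (eval (c • T k ^ m) (norm_smul_T_pow_le hc.le m) g) (m * i)
  have h3 : ‖coeff (m * i) (eval (c • T k ^ m) (norm_smul_T_pow_le hc.le m) g)‖ =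
      ‖coeff i g‖ := by
    rw [h, norm_mul, norm_pow, hc, one_pow, one_mul]
  exact h3 ▸ h2

theorem norm_eval_sub_eval_le {a b : TateAlgebra k} (ha : ‖a‖ ≤ 1) (hb : ‖b‖ ≤ 1)
    (f : TateAlgebra k) : ‖eval a ha f - eval b hb f‖ ≤ ‖a - b‖ * ‖f‖ := by
  obtain ⟨q, hq, h⟩ := eval_sub_eval ha hb f
  rw [h, norm_mul]
  exact mul_le_mul_of_nonneg_left hq (norm_nonneg _)

/-- A function close to `c t` with `|c| = 1` is a coordinate. -/
theorem exists_algEquiv_of_norm_sub_lt {y : TateAlgebra k} {c : k} (hc : ‖c‖ = 1)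
    (h : ‖y - c • T k‖ < 1) : ∃ e : TateAlgebra k ≃ₐ[k] TateAlgebra k, e (T k) = y := by
  have hcT : ‖c • T k‖ ≤ 1 := by simpa using norm_smul_T_pow_le hc.le 1
  have hy : ‖y‖ ≤ 1 := by
    have := (IsUltrametricDist.norm_add_le_max (y - c • T k) (c • T k)).trans (max_le h.le hcT)
    simpa using this
  have heq : ∀ g, ‖eval (c • T k) hcT g‖ = ‖g‖ := fun g => by
    simpa using norm_eval_smul_T_pow hc one_pos g
  have hci : ‖c⁻¹‖ = 1 := by rw [norm_inv, hc, inv_one]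
  have hciT : ‖c⁻¹ • T k‖ ≤ 1 := by simpa using norm_smul_T_pow_le hci.le 1
  have hinv : ∀ g, eval (c • T k) hcT (eval (c⁻¹ • T k) hciT g) = g := fun g => by
    have hc0 : c ≠ 0 := norm_ne_zero_iff.1 (by rw [hc]; exact one_ne_zero)
    have : (eval (c • T k) hcT).comp (eval (c⁻¹ • T k) hciT) = AlgHom.id k _ :=
      algHom_ext' (by simp [smul_smul, hc0])
    exact DFunLike.congr_fun this g
  -- `eval y` differs from the isometry `t ↦ c t` by a relative error `‖y - c t‖ < 1`. This gives
  -- injectivity, and the inverse of the isometry supplies approximate preimages.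
  have hinj : Function.Injective (eval y hy : TateAlgebra k →ₐ[k] TateAlgebra k) := by
    rw [injective_iff_map_eq_zero]
    intro g hg
    by_contra hg0
    have h1 := norm_eval_sub_eval_le hy hcT g
    rw [hg, zero_sub, norm_neg, heq] at h1
    have := norm_pos_iff.2 hg0
    nlinarith
  have hsurj : Function.Surjective (eval y hy : TateAlgebra k →ₐ[k] TateAlgebra k) := fun g => by
    have happrox : ∀ v, ∃ u, ‖u‖ ≤ ‖v‖ ∧ ‖v - (eval y hy : TateAlgebra k →ₐ[k]
        TateAlgebra k).toRingHom.toAddMonoidHom u‖ ≤ ‖y - c • T k‖ * ‖v‖ := fun v => by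
      refine ⟨eval (c⁻¹ • T k) hciT v, norm_eval_le _ _ _, ?_⟩
      have h1 := norm_eval_sub_eval_le hy hcT (eval (c⁻¹ • T k) hciT v)
      rw [hinv, norm_sub_rev] at h1
      exact h1.trans (mul_le_mul_of_nonneg_left (norm_eval_le _ _ _) (norm_nonneg _))
    obtain ⟨u, hu, -⟩ := exists_preimage_of_approx
      (eval y hy : TateAlgebra k →ₐ[k] TateAlgebra k).toRingHom.toAddMonoidHom
      (algHom_continuous (eval y hy)) (fun x => ‖x‖) continuous_norm (by simp)
      IsUltrametricDist.norm_add_le_max zero_le_one (fun u => by simp) (norm_nonneg _) h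
      happrox g
    exact ⟨u, hu⟩
  exact ⟨AlgEquiv.ofBijective (eval y hy) ⟨hinj, hsurj⟩, eval_T y hy⟩

end Hom

end TateAlgebra

namespace TateAlgebra

/-! ### Finite morphisms totally ramified at the origin -/

section Structure

variable {k : Type*} [NormedField k] [IsUltrametricDist k] [CompleteSpace k]

/-- Evaluation at the origin. -/
noncomputable def constCoeff : TateAlgebra k →ₐ[k] k := eval 0 (by simp)

@[simp] theorem constCoeff_apply (f : TateAlgebra k) : constCoeff f = coeff 0 f := by
  obtain ⟨g, hg, -⟩ := exists_eq_add_T_mul f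
  have h : constCoeff (T k) = 0 := eval_T (k := k) (B := k) 0 (by simp)
  have h2 := congrArg constCoeff hg
  rwa [map_add, map_mul, h, zero_mul, add_zero, AlgHom.commutes] at h2

theorem coeff_zero_algHom {F : TateAlgebra k →ₐ[k] TateAlgebra k} (hF : coeff 0 (F (T k)) = 0)
    (f : TateAlgebra k) : coeff 0 (F f) = coeff 0 f := by
  have : constCoeff.comp F = constCoeff := algHom_field_ext (by simp [hF, coeff_T])
  simpa using DFunLike.congr_fun this f

/-- A nonzero function without zeros outside of the origin is a power of the coordinate times a
unit. -/
theorem exists_eq_T_pow_mul_isUnit [IsAlgClosed k] {g : TateAlgebra k} (hg0 : g ≠ 0)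
    (hg : ∀ ψ : TateAlgebra k →ₐ[k] k, ψ g = 0 → ψ (T k) = 0) :
    ∃ (n : ℕ) (u : TateAlgebra k), g = T k ^ n * u ∧ IsUnit u := by
  obtain ⟨n, u, hu, hu0⟩ := exists_eq_T_pow_mul_coeff_zero_ne hg0
  refine ⟨n, u, hu, ?_⟩
  by_contra hnu
  obtain ⟨ψ, hψ⟩ := exists_algHom_eq_zero (fun h => hu0 (by simp [h])) hnu
  have hT := hg ψ (by rw [hu, map_mul, hψ, mul_zero])
  have : ψ = constCoeff := algHom_field_ext (by simp [hT, coeff_T])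
  rw [this, constCoeff_apply] at hψ
  exact hu0 hψ

/-- `F` preserves constant terms, so a factor with nonzero constant term survives; a power of `T`
survives because `F T ≠ 0`. -/
theorem injective_algHom {F : TateAlgebra k →ₐ[k] TateAlgebra k} (hF : coeff 0 (F (T k)) = 0)
    (hF0 : F (T k) ≠ 0) : Function.Injective F := by
  rw [injective_iff_map_eq_zero]
  intro s hs
  by_contra hs0
  obtain ⟨n, u, hu, hu0⟩ := exists_eq_T_pow_mul_coeff_zero_ne hs0
  rw [hu, map_mul, map_pow] at hs
  rcases mul_eq_zero.1 hs with h | h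
  · exact hF0 (by by_contra hne; exact pow_ne_zero n hne h)
  · exact hu0 (by rw [← coeff_zero_algHom hF, h, map_zero])

/-- The shape of a finite morphism of discs totally ramified at the origin. -/
theorem exists_coeff_of_isIntegral [IsAlgClosed k] {F : TateAlgebra k →ₐ[k] TateAlgebra k}
    (hF : coeff 0 (F (T k)) = 0) (hint : (F : TateAlgebra k →+* TateAlgebra k).IsIntegral)
    (hfib : ∀ ψ : TateAlgebra k →ₐ[k] k, ψ (F (T k)) = 0 → ψ (T k) = 0) :
    ∃ m, 0 < m ∧ (∀ i < m, coeff i (F (T k)) = 0) ∧ ‖coeff m (F (T k))‖ = 1 ∧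
      ∀ i, m < i → ‖coeff i (F (T k))‖ < 1 := by
  have hF0 : F (T k) ≠ 0 := by
    intro h0
    have := hfib (eval 1 (by simp)) (by rw [h0, map_zero])
    rw [eval_T] at this
    exact one_ne_zero this
  obtain ⟨m, u, hu, huu⟩ := exists_eq_T_pow_mul_isUnit hF0 hfib
  obtain ⟨hu1, hu2⟩ := norm_coeff_zero_of_isUnit huu
  have hcoeff : ∀ i, coeff i (F (T k)) = if m ≤ i then coeff (i - m) u else 0 := fun i => by
    rw [hu, coeff_T_pow_mul]
  have hle : ‖F (T k)‖ ≤ 1 := norm_algHom_T_le F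
  have hnorm : ‖F (T k)‖ = ‖u‖ := by rw [hu, norm_mul, norm_pow, norm_T]; simp
  have hu0 : coeff 0 u ≠ 0 := by
    rw [← norm_ne_zero_iff, hu1]
    exact norm_ne_zero_iff.2 huu.ne_zero
  have hone : ‖u‖ = 1 := by
    by_contra hne
    have hlt : ‖u‖ < 1 := lt_of_le_of_ne (hnorm ▸ hle) hne
    -- A square root of `u(0)` satisfies `‖u‖ < ‖b‖ < 1`, so `b` is a point of the disc outside the
    -- image. Then `F (T - b)` is a unit while `T - b` is not, but an injective integral map
    -- reflects units.
    obtain ⟨b, hb⟩ := IsAlgClosed.exists_pow_nat_eq (coeff 0 u) two_pos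
    have hb2 : ‖b‖ ^ 2 = ‖u‖ := by rw [← norm_pow, hb, hu1]
    have hupos : 0 < ‖u‖ := by rw [← hu1]; exact norm_pos_iff.2 hu0
    have hb1 : ‖b‖ < 1 := by nlinarith [norm_nonneg b]
    have hbu : ‖u‖ < ‖b‖ := by
      have : 0 < ‖b‖ := by
        rcases (norm_nonneg b).eq_or_lt with h | h
        · rw [← h] at hb2; rw [zero_pow two_ne_zero] at hb2; exact absurd hb2.symm hupos.ne'
        · exact h
      nlinarith
    have hloc := hint.isLocalHom (injective_algHom hF hF0)
    have hunit : IsUnit (F (T k - algebraMap k _ b)) := by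
      refine isUnit_of_norm_sub_lt (c := -b) ?_
      rw [map_sub, AlgHom.commutes, map_neg, sub_neg_eq_add, sub_add_cancel, norm_neg, hnorm]
      exact hbu
    have hunit' : IsUnit (T k - algebraMap k _ b) := hloc.map_nonunit _ hunit
    have h0 := (norm_coeff_zero_of_isUnit hunit').1
    have h1 := norm_coeff_le (T k - algebraMap k _ b) 1
    rw [← h0] at h1
    simp [coeff_T, coeff_algebraMap] at h1
    linarith
  refine ⟨m, ?_, fun i hi => ?_, ?_, fun i hi => ?_⟩
  · rcases Nat.eq_zero_or_pos m with rfl | h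
    · rw [hcoeff] at hF
      simp [hu0] at hF
    · exact h
  · rw [hcoeff, if_neg (by omega)]
  · rw [hcoeff, if_pos le_rfl, Nat.sub_self, hu1, hone]
  · rw [hcoeff, if_pos hi.le]
    exact hone ▸ hu2 _ (by omega)

/-- If the derivative of a function has no zeros outside of the origin, then it has a dominant
leading term. -/
theorem exists_dominant_deriv_coeff [IsAlgClosed k] {h : TateAlgebra k}
    (hh : ∀ ψ : TateAlgebra k →ₐ[k] k, ψ (deriv h) = 0 → ψ (T k) = 0) :
    ∃ n : ℕ, 0 < n ∧ (∀ i : ℕ, i < n → (i : k) * coeff i h = 0) ∧ (n : k) * coeff n h ≠ 0 ∧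
      ∀ i : ℕ, n < i → ‖(i : k) * coeff i h‖ < ‖(n : k) * coeff n h‖ := by
  have h0 : deriv h ≠ 0 := by
    intro h0
    have := hh (eval 1 (by simp)) (by rw [h0, map_zero])
    rw [eval_T] at this
    exact one_ne_zero this
  -- If the derivative vanishes to order `n` at the origin, its leading coefficient is `(n + 1)
  -- a_(n+1)`; hence the witness `n + 1`.
  obtain ⟨n, u, hu, huu⟩ := exists_eq_T_pow_mul_isUnit h0 hh
  obtain ⟨hu1, hu2⟩ := norm_coeff_zero_of_isUnit huu
  have hcoeff : ∀ i, ((i + 1 : ℕ) : k) * coeff (i + 1) h =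
      if n ≤ i then coeff (i - n) u else 0 := fun i => by
    rw [← coeff_T_pow_mul, ← hu, coeff_deriv, mul_comm]; push_cast; rfl
  refine ⟨n + 1, by omega, fun i hi => ?_, ?_, fun i hi => ?_⟩
  · rcases i with - | i
    · simp
    · rw [hcoeff, if_neg (by omega)]
  · rw [hcoeff, if_pos le_rfl, Nat.sub_self, ← norm_ne_zero_iff, hu1]
    exact norm_ne_zero_iff.2 huu.ne_zero
  · obtain ⟨i, rfl⟩ : ∃ j, i = j + 1 := ⟨i - 1, by omega⟩
    rw [hcoeff, hcoeff, if_pos (by omega), if_pos le_rfl, Nat.sub_self, hu1]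
    exact hu2 _ (by omega)

section Degree

/-- An exponent is uniquely `m * i + j` with `j < m`, so the summands have disjoint supports. -/
theorem coeff_sum_eval_mul {c : k} (hc : ‖c‖ ≤ 1) {m : ℕ} (hm : 0 < m)
    (s : Fin m → TateAlgebra k) (i : ℕ) (j : Fin m) :
    coeff (m * i + j) (∑ l, eval (c • T k ^ m) (norm_smul_T_pow_le hc m) (s l) * T k ^ (l : ℕ)) =
      c ^ i * coeff i (s j) := by
  rw [map_sum, Finset.sum_eq_single j]
  · rw [mul_comm (eval _ _ _), coeff_T_pow_mul, if_pos (by omega), Nat.add_sub_cancel,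
      coeff_eval_smul_T_pow hc hm, if_pos (dvd_mul_right _ _), Nat.mul_div_cancel_left _ hm]
  · intro l _ hl
    rw [mul_comm (eval _ _ _), coeff_T_pow_mul]
    split_ifs with h
    · rw [coeff_eval_smul_T_pow hc hm, if_neg]
      intro hd
      apply hl
      have h1 : m * i + j ≡ l [MOD m] := ((Nat.modEq_iff_dvd' h).2 hd).symm
      have h2 : (j : ℕ) ≡ l [MOD m] := by
        have : m * i + j ≡ j [MOD m] := by simp [Nat.ModEq]
        exact this.symm.trans h1
      exact Fin.ext (Nat.ModEq.eq_of_lt_of_lt h2 j.2 l.2).symm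
    · rfl
  · simp

/-- For a morphism of discs with a dominant term of degree `m`, the first `m` powers of the
coordinate form a basis. -/
theorem bijective_sum_mul_T_pow {F : TateAlgebra k →ₐ[k] TateAlgebra k} {m : ℕ} (hm : 0 < m) {c : k}
    (hc : ‖c‖ = 1) (hF : ‖F (T k) - c • T k ^ m‖ < 1) :
    Function.Bijective fun s : Fin m → TateAlgebra k => ∑ j, F (s j) * T k ^ (j : ℕ) := by
  set Ψ : TateAlgebra k →ₐ[k] TateAlgebra k :=
    eval (c • T k ^ m) (norm_smul_T_pow_le hc.le m) with hΨ
  have hFΨ : ∀ g, ‖F g - Ψ g‖ ≤ ‖F (T k) - c • T k ^ m‖ * ‖g‖ := fun g => by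
    conv_lhs => rw [algHom_eq_eval F (norm_algHom_T_le F)]
    exact norm_eval_sub_eval_le _ _ g
  have hc0 : c ≠ 0 := norm_ne_zero_iff.1 (by rw [hc]; exact one_ne_zero)
  let S : (Fin m → TateAlgebra k) →+ TateAlgebra k :=
    { toFun := fun s => ∑ j, F (s j) * T k ^ (j : ℕ)
      map_zero' := by simp
      map_add' := fun x y => by simp [add_mul, Finset.sum_add_distrib] }
  have hSdef : ∀ s, S s = ∑ j, F (s j) * T k ^ (j : ℕ) := fun s => rfl
  -- `F` is compared with the model `Ψ : t ↦ c t ^ m`, for which sorting exponents modulo `m` gives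
  -- the bijection and preserves norms. The relative error is `‖F T - c T ^ m‖ < 1`.
  have hdiff : ∀ s : Fin m → TateAlgebra k, ‖S s - ∑ j, Ψ (s j) * T k ^ (j : ℕ)‖ ≤
      ‖F (T k) - c • T k ^ m‖ * ‖s‖ := fun s => by
    rw [hSdef, ← Finset.sum_sub_distrib]
    refine IsUltrametricDist.norm_sum_le_of_forall_le_of_nonneg (by positivity) fun j _ => ?_
    rw [← sub_mul, norm_mul, norm_pow, norm_T, one_pow, mul_one]
    exact (hFΨ _).trans (mul_le_mul_of_nonneg_left (norm_le_pi_norm s j) (norm_nonneg _))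
  have hinj : Function.Injective S := by
    rw [injective_iff_map_eq_zero]
    intro s hs
    have h1 := hdiff s
    rw [hs, zero_sub, norm_neg] at h1
    have h2 : ‖s‖ ≤ ‖∑ j, Ψ (s j) * T k ^ (j : ℕ)‖ := by
      refine (pi_norm_le_iff_of_nonneg (norm_nonneg _)).2 fun j => norm_le_of_coeff fun i => ?_
      have h3 := norm_coeff_le (∑ j, Ψ (s j) * T k ^ (j : ℕ)) (m * i + j)
      rw [coeff_sum_eval_mul hc.le hm, norm_mul, norm_pow] at h3
      simpa [hc] using h3
    by_contra hs0
    have := norm_pos_iff.2 hs0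
    nlinarith
  have hsurj : Function.Surjective S := by
    intro g
    have happrox : ∀ v, ∃ s, ‖s‖ ≤ ‖v‖ ∧ ‖v - S s‖ ≤ ‖F (T k) - c • T k ^ m‖ * ‖v‖ := by
      intro v
      have hlim : ∀ j : Fin m, Tendsto (fun i => (c ^ i)⁻¹ * coeff (m * i + j) v) atTop (𝓝 0) := by
        intro j
        rw [tendsto_zero_iff_norm_tendsto_zero]
        have hidx : Tendsto (fun i => m * i + (j : ℕ)) atTop atTop :=
          tendsto_atTop_mono (fun i => (Nat.le_mul_of_pos_left i hm).trans (Nat.le_add_right _ _))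
            tendsto_id
        refine ((tendsto_norm_coeff v).comp hidx).congr fun i => ?_
        simp [hc]
      let s : Fin m → TateAlgebra k := fun j => mk _ (hlim j)
      have hs : ‖s‖ ≤ ‖v‖ := by
        refine (pi_norm_le_iff_of_nonneg (norm_nonneg _)).2 fun j => norm_le_of_coeff fun i => ?_
        simpa [s, hc] using norm_coeff_le v (m * i + j)
      have hsv : ∑ j, Ψ (s j) * T k ^ (j : ℕ) = v := by
        ext n
        have h := coeff_sum_eval_mul hc.le hm s (n / m) ⟨n % m, Nat.mod_lt _ hm⟩
        simp only [Nat.div_add_mod] at h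
        rw [hΨ, h]
        simp [s, Nat.div_add_mod, hc0]
      refine ⟨s, hs, ?_⟩
      have h1 := hdiff s
      rw [hsv, norm_sub_rev] at h1
      exact h1.trans (mul_le_mul_of_nonneg_left hs (norm_nonneg _))
    have hcont : Continuous S := by
      change Continuous fun s : Fin m → TateAlgebra k => ∑ j, F (s j) * T k ^ (j : ℕ)
      refine continuous_finsetSum _ fun j _ => ?_
      exact ((algHom_continuous F).comp (continuous_apply j)).mul continuous_const
    obtain ⟨s, hs, -⟩ := exists_preimage_of_approx S hcont (fun x => ‖x‖) continuous_norm
      (by simp) (fun a b => (pi_norm_le_iff_of_nonneg (by positivity)).2 fun j =>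
        (IsUltrametricDist.norm_add_le_max _ _).trans
          (max_le_max (norm_le_pi_norm a j) (norm_le_pi_norm b j)))
      zero_le_one (fun u => by simp) (norm_nonneg _) hF happrox g
    exact ⟨s, hs⟩
  exact ⟨hinj, hsurj⟩

end Degree

end Structure

end TateAlgebra

theorem Module.finrank_of_bijective {A B : Type*} [CommRing A] [Nontrivial A] [CommRing B]
    [Algebra A B] {m : ℕ} (b : Fin m → B)
    (hb : Function.Bijective fun s : Fin m → A => ∑ j, s j • b j) : Module.finrank A B = m := by
  let S : (Fin m → A) →ₗ[A] B :=
    { toFun := fun s => ∑ j, s j • b j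
      map_add' := fun x y => by simp [add_smul, Finset.sum_add_distrib]
      map_smul' := fun a s => by simp [Finset.smul_sum, mul_smul] }
  rw [← (LinearEquiv.ofBijective S hb).finrank_eq, Module.finrank_fin_fun]

/-! ### Derivations at étale points -/

/-- A derivation into a residue field of an étale point vanishes. -/
theorem Algebra.IsEtaleAt.derivation_eq_zero {A B K : Type*} [CommRing A] [CommRing B] [Field K]
    [Algebra A B] (q : Ideal B) [q.IsPrime] [Algebra.IsEtaleAt A q] (ψ : B →+* K)
    (hψ : RingHom.ker ψ = q) (D : B →+ K) (hD : ∀ a b, D (a * b) = ψ a * D b + ψ b * D a)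
    (hD0 : ∀ a : A, D (algebraMap A B a) = 0) (b : B) : D b = 0 := by
  let _ : Algebra A K := (ψ.comp (algebraMap A B)).toAlgebra
  have hA : ∀ a, algebraMap A K a = ψ (algebraMap A B a) := fun _ => rfl
  have hD1 : D 1 = 0 := by simpa using hD 1 1
  -- `ψ + ε D` and `ψ` are `A`-homomorphisms to the dual numbers with the same reduction. They
  -- extend to the localization at `q`, which is unramified over `A`, so they agree.
  let g₁ : B →ₐ[A] DualNumber K :=
    { toFun := fun b => TrivSqZeroExt.inl (ψ b) + TrivSqZeroExt.inr (D b)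
      map_one' := by ext <;> simp [hD1]
      map_mul' := fun a b => by ext <;> simp [hD, mul_comm]
      map_zero' := by ext <;> simp
      map_add' := fun a b => by ext <;> simp
      commutes' := fun a => by
        ext <;> simp [hD0, TrivSqZeroExt.algebraMap_eq_inl', hA] }
  let g₂ : B →ₐ[A] DualNumber K :=
    { toFun := fun b => TrivSqZeroExt.inl (ψ b)
      map_one' := by ext <;> simp
      map_mul' := fun a b => by ext <;> simp
      map_zero' := by ext <;> simp
      map_add' := fun a b => by ext <;> simp
      commutes' := fun a => by
        ext <;> simp [TrivSqZeroExt.algebraMap_eq_inl', hA] }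
  have hne : ∀ y : q.primeCompl, ψ y ≠ 0 := fun y h => by
    have h' : (y : B) ∈ RingHom.ker ψ := h
    rw [hψ] at h'
    exact y.2 h'
  have h₁ : ∀ y : q.primeCompl, IsUnit (g₁ y) := fun y => by
    rw [TrivSqZeroExt.isUnit_iff_isUnit_fst]
    simpa [g₁] using hne y
  have h₂ : ∀ y : q.primeCompl, IsUnit (g₂ y) := fun y => by
    rw [TrivSqZeroExt.isUnit_iff_isUnit_fst]
    simpa [g₂] using hne y
  have key := Algebra.FormallyUnramified.lift_unique_of_ringHom (R := A)
    (A := Localization.AtPrime q) (TrivSqZeroExt.fstHom K K K).toRingHom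
    ⟨2, TrivSqZeroExt.kerIdeal_sq K K⟩
    (IsLocalization.liftAlgHom (M := q.primeCompl) h₁)
    (IsLocalization.liftAlgHom (M := q.primeCompl) h₂) (by
      refine IsLocalization.ringHom_ext q.primeCompl ?_
      ext b
      simp [g₁, g₂])
  have := DFunLike.congr_fun key (algebraMap B _ b)
  simp only [IsLocalization.liftAlgHom_apply, IsLocalization.lift_eq] at this
  simpa [g₁, g₂] using congrArg TrivSqZeroExt.snd this

/-! ### Expansions of powers in ultrametric rings -/

section UltrametricRing

set_option linter.unusedSectionVars false

variable {R : Type*} [NormedCommRing R] [NormOneClass R] [IsUltrametricDist R]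

theorem norm_pow_mul_pow_le_one {x d : R} (hx : ‖x‖ ≤ 1) (hd : ‖d‖ ≤ 1) (i j : ℕ) :
    ‖x ^ i * d ^ j‖ ≤ 1 :=
  (norm_mul_le _ _).trans (mul_le_one₀ ((norm_pow_le _ _).trans (pow_le_one₀ (norm_nonneg _) hx))
    (norm_nonneg _) ((norm_pow_le _ _).trans (pow_le_one₀ (norm_nonneg _) hd)))

theorem norm_mul_natCast_le (x : R) (m : ℕ) : ‖x * (m : R)‖ ≤ ‖x‖ :=
  (norm_mul_le _ _).trans (mul_le_of_le_one_right (norm_nonneg _)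
    (IsUltrametricDist.norm_natCast_le_one R m))

/-- Second order expansion of a power, with a bounded remainder. -/
theorem exists_add_pow_eq_of_norm_le_one {x d : R} (hx : ‖x‖ ≤ 1) (hd : ‖d‖ ≤ 1) (n : ℕ) :
    ∃ r : R, ‖r‖ ≤ 1 ∧ (x + d) ^ n = x ^ n + n * x ^ (n - 1) * d + d ^ 2 * r := by
  induction n with
  | zero => exact ⟨0, by simp, by simp⟩
  | succ n ih =>
    obtain ⟨r, hr, h⟩ := ih
    refine ⟨x ^ (n - 1) * n + r * (x + d), ?_, ?_⟩
    · refine (IsUltrametricDist.norm_add_le_max _ _).trans (max_le ?_ ?_)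
      · refine (norm_mul_natCast_le _ _).trans ?_
        simpa using norm_pow_mul_pow_le_one hx hd (n - 1) 0
      · exact (norm_mul_le _ _).trans (mul_le_one₀ hr (norm_nonneg _)
          ((IsUltrametricDist.norm_add_le_max _ _).trans (max_le hx hd)))
    · rw [pow_succ, h]
      rcases n with - | n
      · simp; ring
      · simp only [Nat.add_sub_cancel, Nat.cast_add, Nat.cast_one]
        ring

/-- Expansion of a `p`-th power, with a bounded remainder. -/
theorem exists_add_pow_prime_eq_of_norm_le_one {p : ℕ} (hp : p.Prime) {x d : R} (hx : ‖x‖ ≤ 1)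
    (hd : ‖d‖ ≤ 1) : ∃ r : R, ‖r‖ ≤ 1 ∧
      (x + d) ^ p = x ^ p + d ^ p + p * x ^ (p - 1) * d + p * (d ^ 2 * r) := by
  have hp2 := hp.two_le
  -- Among the mixed terms, `i = p - 1` is the one linear in `d`, with binomial coefficient `p`; the
  -- others are divisible by `p d ^ 2`.
  refine ⟨∑ i ∈ Finset.Ioo 0 (p - 1), x ^ i * d ^ (p - i - 2) * (p.choose i / p : ℕ), ?_, ?_⟩
  · refine IsUltrametricDist.norm_sum_le_of_forall_le_of_nonneg zero_le_one fun i _ => ?_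
    exact (norm_mul_natCast_le _ _).trans (norm_pow_mul_pow_le_one hx hd _ _)
  · have hI : Finset.Ioo 0 p = insert (p - 1) (Finset.Ioo 0 (p - 1)) := by
      ext i
      simp only [Finset.mem_Ioo, Finset.mem_insert]
      omega
    have hch : p.choose (p - 1) / p = 1 := by
      rw [Nat.choose_symm (by omega : 1 ≤ p), Nat.choose_one_right, Nat.div_self hp.pos]
    rw [add_pow_prime_eq' hp, hI, Finset.sum_insert (by simp), hch, Nat.sub_sub_self (by omega),
      Finset.mul_sum]
    have : ∀ i ∈ Finset.Ioo 0 (p - 1), d ^ 2 * (x ^ i * d ^ (p - i - 2) * (p.choose i / p : ℕ)) =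
        x ^ i * d ^ (p - i) * (p.choose i / p : ℕ) := fun i hi => by
      rw [Finset.mem_Ioo] at hi
      have : p - i = (p - i - 2) + 2 := by omega
      rw [this, pow_add]
      simp only [Nat.add_sub_cancel]
      ring
    rw [Finset.sum_congr rfl this]
    push_cast
    ring

theorem norm_add_pow_prime_sub_le {p : ℕ} (hp : p.Prime) {x d : R} {C : ℝ} (hx : ‖x‖ ≤ C)
    (hd : ‖d‖ ≤ C) : ‖(x + d) ^ p - x ^ p - d ^ p‖ ≤ ‖(p : R)‖ * C ^ p := by
  have hC : 0 ≤ C := (norm_nonneg _).trans hx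
  have h : (x + d) ^ p - x ^ p - d ^ p =
      p * ∑ i ∈ Finset.Ioo 0 p, x ^ i * d ^ (p - i) * (p.choose i / p : ℕ) := by
    rw [add_pow_prime_eq' hp]
    ring
  rw [h]
  refine (norm_mul_le _ _).trans (mul_le_mul_of_nonneg_left ?_ (norm_nonneg _))
  refine IsUltrametricDist.norm_sum_le_of_forall_le_of_nonneg (by positivity) fun i hi => ?_
  rw [Finset.mem_Ioo] at hi
  refine (norm_mul_natCast_le _ _).trans ((norm_mul_le _ _).trans ?_)
  calc ‖x ^ i‖ * ‖d ^ (p - i)‖ ≤ C ^ i * C ^ (p - i) :=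
        mul_le_mul ((norm_pow_le _ _).trans (pow_le_pow_left₀ (norm_nonneg _) hx _))
          ((norm_pow_le _ _).trans (pow_le_pow_left₀ (norm_nonneg _) hd _)) (norm_nonneg _)
          (by positivity)
    _ = C ^ p := by rw [← pow_add]; congr 1; omega

end UltrametricRing

/-! ### Newton iteration towards the normal form -/

namespace TateAlgebra

set_option linter.unusedSectionVars false

variable {k : Type*} [NormedField k] [IsUltrametricDist k] [CompleteSpace k]

theorem norm_T_pow (m : ℕ) : ‖T k ^ m‖ = 1 := by simp

/-- The substitution `t ↦ t ^ m`. -/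
noncomputable def subst (m : ℕ) : TateAlgebra k →ₐ[k] TateAlgebra k :=
  eval (T k ^ m) (norm_T_pow m).le

@[simp] theorem subst_T (m : ℕ) : subst m (T k) = T k ^ m := eval_T _ _

theorem coeff_subst {m : ℕ} (hm : 0 < m) (g : TateAlgebra k) (n : ℕ) :
    coeff n (subst m g) = if m ∣ n then coeff (n / m) g else 0 := by
  have h := coeff_eval_smul_T_pow (c := (1 : k)) (by simp) hm g n
  simp only [one_pow, one_mul, one_smul] at h
  exact h

/-- The series whose coefficients are the powers of the coefficients of the given one. -/
noncomputable def powCoeff (p : ℕ) (hp : p ≠ 0) (d : TateAlgebra k) : TateAlgebra k :=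
  mk (fun i => coeff i d ^ p) (by simpa [zero_pow hp] using (tendsto_coeff d).pow p)

theorem norm_powCoeff_le {p : ℕ} (hp : p ≠ 0) (d : TateAlgebra k) :
    ‖powCoeff p hp d‖ ≤ ‖d‖ ^ p :=
  norm_le_of_coeff fun i => by
    rw [powCoeff, coeff_mk, norm_pow]
    exact pow_le_pow_left₀ (norm_nonneg _) (norm_coeff_le d i) p

/-- Modulo `p`, the `p`-th power is a series in `t ^ p`. -/
theorem norm_pow_prime_sub_le {p : ℕ} (hp : p.Prime) (d : TateAlgebra k) :
    ‖d ^ p - subst p (powCoeff p hp.ne_zero d)‖ ≤ ‖(p : k)‖ * ‖d‖ ^ p := by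
  have hpk : ‖(p : TateAlgebra k)‖ = ‖(p : k)‖ := by
    rw [← map_natCast (algebraMap k (TateAlgebra k)), norm_algebraMap']
  -- The bound on the mixed terms does not depend on the number of summands, so it passes from
  -- partial sums to the limit.
  have hfin : ∀ s : Finset ℕ, ‖(∑ i ∈ s, coeff i d • T k ^ i) ^ p -
      ∑ i ∈ s, (coeff i d ^ p) • T k ^ (p * i)‖ ≤ ‖(p : k)‖ * ‖d‖ ^ p := by
    intro s
    have hb : ∀ i, ‖coeff i d • T k ^ i‖ ≤ ‖d‖ := fun i => by
      rw [norm_smul, norm_T_pow, mul_one]; exact norm_coeff_le d i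
    induction s using Finset.induction_on with
    | empty => simp [hp.ne_zero]; positivity
    | insert a s ha ih =>
      rw [Finset.sum_insert ha, Finset.sum_insert ha]
      have h1 := norm_add_pow_prime_sub_le hp (hb a)
        (IsUltrametricDist.norm_sum_le_of_forall_le_of_nonneg (norm_nonneg d) fun i _ => hb i :
          ‖∑ i ∈ s, coeff i d • T k ^ i‖ ≤ ‖d‖)
      rw [hpk] at h1
      have h2 := IsUltrametricDist.norm_add_le_max
        ((coeff a d • T k ^ a + ∑ i ∈ s, coeff i d • T k ^ i) ^ p - (coeff a d • T k ^ a) ^ p -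
          (∑ i ∈ s, coeff i d • T k ^ i) ^ p)
        ((∑ i ∈ s, coeff i d • T k ^ i) ^ p - ∑ i ∈ s, (coeff i d ^ p) • T k ^ (p * i))
      refine le_trans (le_of_eq ?_) (h2.trans (max_le h1 ih))
      rw [smul_pow, ← pow_mul, mul_comm a p]
      congr 1
      ring
  have h1 : HasSum (fun i => (coeff i d ^ p) • T k ^ (p * i))
      (subst p (powCoeff p hp.ne_zero d)) := by
    have := (hasSum_coeff_smul (powCoeff p hp.ne_zero d)).map (subst p) (algHom_continuous _)
    convert this using 1
    ext1 i
    simp [powCoeff, pow_mul]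
  have h2 : Tendsto (fun s : Finset ℕ => ‖(∑ i ∈ s, coeff i d • T k ^ i) ^ p -
      ∑ i ∈ s, (coeff i d ^ p) • T k ^ (p * i)‖) atTop
      (𝓝 ‖d ^ p - subst p (powCoeff p hp.ne_zero d)‖) :=
    (((hasSum_coeff_smul d).pow p).sub h1).norm
  exact le_of_tendsto h2 (Eventually.of_forall hfin)

theorem continuous_deriv : Continuous (deriv (k := k)) :=
  AddMonoidHomClass.continuous_of_bound (deriv (k := k)) 1 fun f => by
    rw [one_mul]
    refine norm_le_of_coeff fun i => ?_
    rw [coeff_deriv]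
    have := norm_mul_natCast_le (coeff (i + 1) f) (i + 1)
    push_cast at this
    exact this.trans (norm_coeff_le f _)

/-- A tangent vector killed by the image of the coordinate is killed by the image of every
function. -/
theorem algHom_deriv_eq_zero {F : TateAlgebra k →ₐ[k] TateAlgebra k} {ψ : TateAlgebra k →ₐ[k] k}
    (h : ψ (deriv (F (T k))) = 0) (g : TateAlgebra k) : ψ (deriv (F g)) = 0 := by
  have hψ : Continuous ψ := continuous_of_norm_le (norm_algHom_field_le ψ)
  have h1 := (hasSum_coeff_smul g).map
    ((ψ : TateAlgebra k →+ k).comp ((deriv : Derivation k (TateAlgebra k) (TateAlgebra k)) :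
      TateAlgebra k →+ TateAlgebra k) |>.comp (F : TateAlgebra k →+ TateAlgebra k))
    ((hψ.comp continuous_deriv).comp (algHom_continuous F))
  refine h1.unique ?_
  convert hasSum_zero with i
  change ψ (deriv (F (coeff i g • T k ^ i))) = 0
  simp [h]

section NormalForm

variable {F : TateAlgebra k →ₐ[k] TateAlgebra k} {p n : ℕ}

/-- `F` and `subst p ∘ e` are evaluations at elements that differ by `δ`, so on every function they
differ by a multiple of `δ`. This turns a series in `t ^ p` into a value of `F` with a controlled
error. -/
theorem exists_subst_eq {e : TateAlgebra k ≃ₐ[k] TateAlgebra k} {δ : TateAlgebra k}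
    (hF : F (T k) = subst p (e (T k)) + δ) (D : TateAlgebra k) :
    ∃ q, ‖q‖ ≤ ‖D‖ ∧ subst p (e D) = F D - δ * q := by
  have h1 : ‖subst p (e (T k))‖ ≤ 1 := by
    simpa using norm_algHom_le ((subst p).comp (e : TateAlgebra k →ₐ[k] TateAlgebra k)) (T k)
  obtain ⟨q, hq, h⟩ := eval_sub_eval h1 (norm_algHom_T_le F) D
  refine ⟨q, hq, ?_⟩
  have h2 : subst p (e D) = eval (subst p (e (T k))) h1 D := by
    have : (subst p).comp (e : TateAlgebra k →ₐ[k] TateAlgebra k) =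
      eval (subst p (e (T k))) h1 := algHom_ext' (by simp)
    exact DFunLike.congr_fun this D
  have h3 : F D = eval (F (T k)) (norm_algHom_T_le F) D :=
    DFunLike.congr_fun (algHom_eq_eval F (norm_algHom_T_le F)) D
  rw [← h2, ← h3] at h
  linear_combination h - q * hF

/-- The data entering the construction of the normal form `x = y ^ p + c y ^ n`: either
`c = 0`, `n = p` and `κ = p`, or the characteristic is `p` and `κ = n c` with `n` prime to `p`. -/
def NormalFormData (p n : ℕ) (c κ : k) : Prop :=
  κ ≠ 0 ∧ ((c = 0 ∧ n = p ∧ κ = p) ∨ ((p : k) = 0 ∧ κ = n * c ∧ ‖(n : k)‖ = 1))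

theorem NormalFormData.norm_div_le {c κ : k} (h : NormalFormData p n c κ) : ‖c / κ‖ ≤ 1 := by
  obtain ⟨h0, ⟨rfl, -, -⟩ | ⟨-, rfl, hn⟩⟩ := h
  · simp
  · rw [norm_div, norm_mul, hn, one_mul]
    exact div_self_le_one _

/-- One step of the Newton approximation. -/
theorem NormalFormData.exists_step (hp : p.Prime) {c κ : k} (hd : NormalFormData p n c κ)
    {e : TateAlgebra k ≃ₐ[k] TateAlgebra k} {ω : TateAlgebra k} (hω : ‖ω‖ < 1)
    (hF : F (T k) = subst p (e (T k)) +
      (algebraMap k _ c * T k ^ n + algebraMap k _ κ * T k ^ n * ω))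
    {a g w : TateAlgebra k} (hg : ‖g‖ < 1) (hw : ‖w‖ < 1)
    (h : (T k * (1 + g)) ^ p + algebraMap k _ c * (T k * (1 + g)) ^ n =
      F a + algebraMap k _ κ * T k ^ n * w) :
    ∃ a' g' w' : TateAlgebra k, ‖a' - a‖ ≤ ‖w‖ ∧ ‖g' - g‖ ≤ ‖w‖ ∧ ‖w'‖ ≤ ‖w‖ ^ 2 ∧
      (T k * (1 + g')) ^ p + algebraMap k _ c * (T k * (1 + g')) ^ n =
        F a' + algebraMap k _ κ * T k ^ n * w' := by
  have hu : IsUnit (1 + g) := by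
    refine isUnit_of_norm_sub_lt (c := 1) ?_
    simpa using hg
  have hg1 : ‖1 + g‖ ≤ 1 :=
    (IsUltrametricDist.norm_add_le_max _ _).trans (max_le norm_one.le hg.le)
  have hg2 : ‖1 + g‖ = 1 := by
    have h1 : ‖(1 : TateAlgebra k)‖ ≠ ‖g‖ := by rw [norm_one]; exact hg.ne'
    rw [IsUltrametricDist.norm_add_eq_max_of_norm_ne_norm h1, norm_one, max_eq_left hg.le]
  obtain ⟨v, hv⟩ := (hu.pow (n - 1)).exists_right_inv
  have hvn : ‖v‖ = 1 := by
    have := congrArg norm hv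
    rwa [norm_mul, norm_pow, hg2, one_pow, one_mul, norm_one] at this
  -- `d` solves the linearized equation: the linear term in an increment `d` of `g` is `κ T ^ n (1 +
  -- g) ^ (n - 1) d`, where `κ` is `p` or `n c`, and it has to cancel `κ T ^ n w`.
  set d := -(w * v) with hdw
  have hdn : ‖d‖ = ‖w‖ := by rw [hdw, norm_neg, norm_mul, hvn, mul_one]
  have hd1 : ‖d‖ ≤ 1 := hdn.trans_le hw.le
  have hdeq : (1 + g) ^ (n - 1) * d = -w := by rw [hdw]; linear_combination -w * hv
  obtain ⟨R₁, hR₁, h₁⟩ := exists_add_pow_prime_eq_of_norm_le_one hp hg1 hd1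
  obtain ⟨R₂, hR₂, h₂⟩ := exists_add_pow_eq_of_norm_le_one hg1 hd1 n
  set P := powCoeff p hp.ne_zero d with hP
  have hPn : ‖P‖ ≤ ‖w‖ ^ 2 := by
    refine (norm_powCoeff_le _ _).trans ?_
    rw [hdn]
    exact pow_le_pow_of_le_one (norm_nonneg _) hw.le hp.two_le
  have hfrob := norm_pow_prime_sub_le hp d
  rw [hdn] at hfrob
  -- `T ^ p d ^ p` need not be small compared with `κ T ^ n`. But modulo `p` it is the series `subst
  -- p (T * P)` in `t ^ p`, so it is absorbed by adding `e.symm (T * P)` to `a`; the cost is `κ T ^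
  -- n` times a term of norm at most `‖w‖ ^ 2`.
  obtain ⟨q, hq, hsub⟩ := exists_subst_eq hF (e.symm (T k * P))
  have hqn : ‖q‖ ≤ ‖w‖ ^ 2 := by
    refine hq.trans ?_
    rw [norm_algEquiv, norm_mul, norm_T, one_mul]
    exact hPn
  rw [AlgEquiv.apply_symm_apply, map_mul, subst_T] at hsub
  have hκ := hd.1
  set μ := c / κ with hμ
  have hμn : ‖μ‖ ≤ 1 := hd.norm_div_le
  have hcμ : algebraMap k (TateAlgebra k) c = algebraMap k _ κ * algebraMap k _ μ := by
    rw [← map_mul, hμ, mul_div_cancel₀ _ hκ]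
  have hAμ : ‖algebraMap k (TateAlgebra k) μ‖ ≤ 1 := by rwa [norm_algebraMap']
  have hw1 : ‖(algebraMap k _ μ + ω) * q‖ ≤ ‖w‖ ^ 2 := by
    rw [norm_mul]
    refine le_trans (mul_le_of_le_one_left (norm_nonneg _) ?_) hqn
    exact (IsUltrametricDist.norm_add_le_max _ _).trans (max_le hAμ hω.le)
  have hsq : ∀ R : TateAlgebra k, ‖R‖ ≤ 1 → ‖d ^ 2 * R‖ ≤ ‖w‖ ^ 2 := fun R hR => by
    rw [norm_mul, norm_pow, hdn]
    exact mul_le_of_le_one_right (by positivity) hR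
  have ha : ‖a + e.symm (T k * P) - a‖ ≤ ‖w‖ := by
    rw [add_sub_cancel_left, norm_algEquiv, norm_mul, norm_T, one_mul]
    refine hPn.trans ?_
    nlinarith [norm_nonneg w]
  have hgg : ‖g + d - g‖ ≤ ‖w‖ := by rw [add_sub_cancel_left, hdn]
  have hpC : (p : TateAlgebra k) = algebraMap k _ (p : k) := (map_natCast _ p).symm
  have hnC : (n : TateAlgebra k) = algebraMap k _ (n : k) := (map_natCast _ n).symm
  obtain ⟨-, ⟨rfl, rfl, rfl⟩ | ⟨hp0, hκn, -⟩⟩ := hd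
  · set E := algebraMap k _ ((n : k)⁻¹) * (d ^ n - subst n P) with hE
    have hEn : ‖E‖ ≤ ‖w‖ ^ 2 := by
      rw [hE, norm_mul, norm_algebraMap', norm_inv, inv_mul_le_iff₀ (norm_pos_iff.2 hκ)]
      refine hfrob.trans (mul_le_mul_of_nonneg_left ?_ (norm_nonneg _))
      exact pow_le_pow_of_le_one (norm_nonneg _) hw.le hp.two_le
    have hEeq : d ^ n = subst n P + algebraMap k _ (n : k) * E := by
      rw [hE, ← mul_assoc, ← map_mul, mul_inv_cancel₀ hκ, map_one]
      ring
    refine ⟨a + e.symm (T k * P), g + d, -((algebraMap k _ μ + ω) * q) + d ^ 2 * R₁ + E, ha, hgg,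
      ?_, ?_⟩
    · refine (IsUltrametricDist.norm_add_le_max _ _).trans (max_le
        ((IsUltrametricDist.norm_add_le_max _ _).trans (max_le ?_ (hsq _ hR₁))) hEn)
      rwa [norm_neg]
    · rw [map_add]
      rw [hpC] at h₁
      simp only [mul_pow, map_zero, zero_mul, zero_add, add_zero] at h hsub hcμ ⊢
      rw [← add_assoc, h₁]
      linear_combination h + hsub + T k ^ n * hEeq + algebraMap k _ (n : k) * T k ^ n * hdeq -
        T k ^ n * q * hcμ
  · have hE : d ^ p = subst p P := by
      rw [hp0, norm_zero, zero_mul] at hfrob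
      exact sub_eq_zero.1 (norm_le_zero_iff.1 hfrob)
    refine ⟨a + e.symm (T k * P), g + d,
      -((algebraMap k _ μ + ω) * q) + d ^ 2 * (algebraMap k _ μ * R₂), ha, hgg, ?_, ?_⟩
    · refine (IsUltrametricDist.norm_add_le_max _ _).trans (max_le ?_ (hsq _ ?_))
      · rwa [norm_neg]
      · rw [norm_mul]
        exact mul_le_one₀ hAμ (norm_nonneg _) hR₂
    · rw [map_add]
      rw [hpC, hp0] at h₁
      rw [hnC] at h₂
      have hκn' : algebraMap k (TateAlgebra k) κ = algebraMap k _ (n : k) * algebraMap k _ c := by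
        rw [← map_mul, hκn]
      simp only [mul_pow, map_zero, zero_mul, add_zero] at h h₁ ⊢
      rw [← add_assoc, h₁, h₂]
      linear_combination h + hsub + T k ^ p * hE + algebraMap k _ κ * T k ^ n * hdeq -
        T k ^ n * (1 + g) ^ (n - 1) * d * hκn' + (T k ^ n * d ^ 2 * R₂ - T k ^ n * q) * hcμ

/-- Applying `exists_subst_eq` to `e.symm T - T` rather than to `e.symm T` makes the remainder `q`
small and not merely bounded. This lets the iteration start from `e.symm T` with an error of norm
less than 1. -/
theorem exists_subst_sub_eq {e : TateAlgebra k ≃ₐ[k] TateAlgebra k} {δ : TateAlgebra k}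
    (hF : F (T k) = subst p (e (T k)) + δ) :
    ∃ q, ‖q‖ ≤ ‖e (T k) - T k‖ ∧ T k ^ p = F (e.symm (T k)) - δ - δ * q := by
  obtain ⟨q, hq, hsub⟩ := exists_subst_eq hF (e.symm (T k) - T k)
  have hn : ‖e.symm (T k) - T k‖ = ‖e (T k) - T k‖ := by
    rw [← norm_algEquiv e (e.symm (T k) - T k), map_sub, AlgEquiv.apply_symm_apply, norm_sub_rev]
  refine ⟨q, hn ▸ hq, ?_⟩
  rw [map_sub, map_sub, map_sub, AlgEquiv.apply_symm_apply, subst_T] at hsub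
  linear_combination hsub - hF

theorem cauchySeq_of_norm_sub_le_geometric {E : Type*} [SeminormedAddCommGroup E] {u : ℕ → E}
    {τ : ℝ} (hτ : τ < 1) (h : ∀ N, ‖u (N + 1) - u N‖ ≤ τ ^ N) : CauchySeq u :=
  cauchySeq_of_le_geometric τ 1 hτ fun N => by
    rw [dist_eq_norm, norm_sub_rev, one_mul]
    exact h N

/-- The normal form of a morphism of discs which is close to `t ^ p`. -/
theorem NormalFormData.exists_normalForm (hp : p.Prime) {c κ : k} (hd : NormalFormData p n c κ)
    {e : TateAlgebra k ≃ₐ[k] TateAlgebra k} (he : ‖e (T k) - T k‖ < 1) {ω : TateAlgebra k}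
    (hω : ‖ω‖ < 1)
    (hF : F (T k) = subst p (e (T k)) +
      (algebraMap k _ c * T k ^ n + algebraMap k _ κ * T k ^ n * ω)) :
    ∃ a g : TateAlgebra k, ‖a - T k‖ < 1 ∧ ‖g‖ < 1 ∧
      F a = (T k * (1 + g)) ^ p + algebraMap k _ c * (T k * (1 + g)) ^ n := by
  obtain ⟨q, hq, hsub⟩ := exists_subst_sub_eq hF
  have hκ := hd.1
  have hcμ : algebraMap k (TateAlgebra k) c = algebraMap k _ κ * algebraMap k _ (c / κ) := by
    rw [← map_mul, mul_div_cancel₀ _ hκ]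
  have hAμ : ‖algebraMap k (TateAlgebra k) (c / κ)‖ ≤ 1 := by
    rw [norm_algebraMap']; exact hd.norm_div_le
  set w₀ := -ω - (algebraMap k _ (c / κ) + ω) * q with hw₀
  -- `τ` bounds the initial error and all later ones, so the quadratic gain `‖w‖ ^ 2` can be used
  -- simply as a contraction by `τ`.
  set τ := max ‖e (T k) - T k‖ ‖ω‖ with hτ
  have hτ1 : τ < 1 := max_lt he hω
  have hτ0 : 0 ≤ τ := le_max_of_le_left (norm_nonneg _)
  have hw₀n : ‖w₀‖ ≤ τ := by
    refine (IsUltrametricDist.norm_sub_le_max' _ _).trans (max_le ?_ ?_)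
    · rw [norm_neg]; exact le_max_right _ _
    · rw [norm_mul]
      refine (mul_le_of_le_one_left (norm_nonneg _) ?_).trans (hq.trans (le_max_left _ _))
      exact (IsUltrametricDist.norm_add_le_max _ _).trans (max_le hAμ hω.le)
  have ha₀n : ‖e.symm (T k) - T k‖ ≤ τ := by
    rw [← norm_algEquiv e (e.symm (T k) - T k), map_sub, AlgEquiv.apply_symm_apply, norm_sub_rev]
    exact le_max_left _ _
  let Good (x : TateAlgebra k × TateAlgebra k × TateAlgebra k) : Prop :=
    ‖x.1 - T k‖ ≤ τ ∧ ‖x.2.1‖ ≤ τ ∧ ‖x.2.2‖ ≤ τ ∧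
      (T k * (1 + x.2.1)) ^ p + algebraMap k _ c * (T k * (1 + x.2.1)) ^ n =
        F x.1 + algebraMap k _ κ * T k ^ n * x.2.2
  have hstep : ∀ x : {x // Good x}, ∃ y : {y // Good y}, ‖y.1.1 - x.1.1‖ ≤ ‖x.1.2.2‖ ∧
      ‖y.1.2.1 - x.1.2.1‖ ≤ ‖x.1.2.2‖ ∧ ‖y.1.2.2‖ ≤ τ * ‖x.1.2.2‖ := by
    rintro ⟨⟨a, g, w⟩, h1, h2, h3, h4⟩
    obtain ⟨a', g', w', ha, hg, hw, h⟩ :=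
      hd.exists_step hp hω hF (h2.trans_lt hτ1) (h3.trans_lt hτ1) h4
    have hw' : ‖w'‖ ≤ τ * ‖w‖ := by
      rw [sq] at hw
      exact hw.trans (mul_le_mul_of_nonneg_right h3 (norm_nonneg _))
    refine ⟨⟨(a', g', w'), ?_, ?_, ?_, h⟩, ha, hg, hw'⟩
    · have := IsUltrametricDist.norm_add_le_max (a' - a) (a - T k)
      rw [sub_add_sub_cancel] at this
      exact this.trans (max_le (ha.trans h3) h1)
    · have := IsUltrametricDist.norm_add_le_max (g' - g) g
      rw [sub_add_cancel] at this
      exact this.trans (max_le (hg.trans h3) h2)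
    · exact hw'.trans ((mul_le_of_le_one_left (norm_nonneg _) hτ1.le).trans h3)
  choose next hnext using hstep
  have hstart : Good (e.symm (T k), 0, w₀) := by
    refine ⟨ha₀n, by simpa using hτ0, hw₀n, ?_⟩
    simp only [add_zero, mul_one]
    rw [hw₀]
    linear_combination hsub - T k ^ n * q * hcμ
  let x : ℕ → {x // Good x} := fun N => next^[N] ⟨_, hstart⟩
  have hx : ∀ N, x (N + 1) = next (x N) := fun N => Function.iterate_succ_apply' _ _ _
  have hw : ∀ N, ‖(x N).1.2.2‖ ≤ τ ^ N := by
    intro N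
    induction N with
    | zero => simpa [x] using hw₀n.trans hτ1.le
    | succ N ih =>
      rw [hx, pow_succ']
      exact (hnext _).2.2.trans (mul_le_mul_of_nonneg_left ih hτ0)
  obtain ⟨a, ha⟩ := cauchySeq_tendsto_of_complete
    (cauchySeq_of_norm_sub_le_geometric (u := fun N => (x N).1.1) hτ1
      fun N => by rw [hx]; exact (hnext _).1.trans (hw N))
  obtain ⟨g, hg⟩ := cauchySeq_tendsto_of_complete
    (cauchySeq_of_norm_sub_le_geometric (u := fun N => (x N).1.2.1) hτ1
      fun N => by rw [hx]; exact (hnext _).2.1.trans (hw N))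
  have hw0 : Tendsto (fun N => (x N).1.2.2) atTop (𝓝 0) := by
    rw [tendsto_zero_iff_norm_tendsto_zero]
    exact squeeze_zero (fun _ => norm_nonneg _) hw (tendsto_pow_atTop_nhds_zero_of_lt_one hτ0 hτ1)
  refine ⟨a, g, ?_, ?_, ?_⟩
  · exact (le_of_tendsto (ha.sub_const _).norm
      (Eventually.of_forall fun N => (x N).2.1)).trans_lt hτ1
  · exact (le_of_tendsto hg.norm (Eventually.of_forall fun N => (x N).2.2.1)).trans_lt hτ1
  · have h1 := (((hg.const_add 1).const_mul (T k)).pow p).add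
      ((((hg.const_add 1).const_mul (T k)).pow n).const_mul (algebraMap k (TateAlgebra k) c))
    have h2 := (((algHom_continuous F).tendsto a).comp ha).add
      (hw0.const_mul (algebraMap k _ κ * T k ^ n))
    rw [mul_zero, add_zero] at h2
    refine (tendsto_nhds_unique (h1.congr fun N => ?_) h2).symm
    exact (x N).2.2.2.2

end NormalForm

end TateAlgebra

/-- By Bézout 1 is a combination of `p` and `i` with integer coefficients; since `‖p‖ < 1`, the
bound `‖i‖ < 1` would give `‖1‖ < 1`. -/
theorem norm_natCast_eq_one_of_not_dvd {k : Type*} [NormedField k] [IsUltrametricDist k] {p : ℕ}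
    (hp : p.Prime) (hres : ‖(p : k)‖ < 1) {i : ℕ} (hi : ¬p ∣ i) : ‖(i : k)‖ = 1 := by
  refine le_antisymm (IsUltrametricDist.norm_natCast_le_one k i) ?_
  by_contra! hlt
  have hb := Nat.gcd_eq_gcd_ab p i
  rw [(Nat.Prime.coprime_iff_not_dvd hp).2 hi] at hb
  have h1 : (1 : k) = p * (p.gcdA i : ℤ) + i * (p.gcdB i : ℤ) := by
    exact_mod_cast congrArg (Int.cast : ℤ → k) hb
  have h2 := IsUltrametricDist.norm_add_le_max ((p : k) * (p.gcdA i : ℤ)) (i * (p.gcdB i : ℤ))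
  rw [← h1, norm_one, norm_mul, norm_mul] at h2
  have h3 := IsUltrametricDist.norm_intCast_le_one k (p.gcdA i)
  have h4 := IsUltrametricDist.norm_intCast_le_one k (p.gcdB i)
  rcases le_max_iff.1 h2 with h | h
  · nlinarith [norm_nonneg (p : k)]
  · nlinarith [norm_nonneg (i : k)]

namespace TateAlgebra

set_option linter.unusedSectionVars false

variable {k : Type*} [NormedField k] [IsUltrametricDist k] [CompleteSpace k]

/-- `ω` is the part of `δ` beyond degree `n`, divided by `κ T ^ n`. The scale `κ` is independent of
the coefficient at `n`, because in mixed characteristic that coefficient is 0 while `κ = p`. -/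
theorem exists_eq_leading_add {δ : TateAlgebra k} {n : ℕ} {κ : k} (hκ : κ ≠ 0)
    (h1 : ∀ i < n, coeff i δ = 0) (h2 : ∀ i, n < i → ‖coeff i δ‖ < ‖κ‖) :
    ∃ ω : TateAlgebra k, ‖ω‖ < 1 ∧
      δ = algebraMap k _ (coeff n δ) * T k ^ n + algebraMap k _ κ * T k ^ n * ω := by
  have hlim : Tendsto (fun i => if i = 0 then 0 else κ⁻¹ * coeff (n + i) δ) atTop (𝓝 0) := by
    have h : Tendsto (fun i => κ⁻¹ * coeff (n + i) δ) atTop (𝓝 0) := by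
      have := ((tendsto_coeff δ).comp (tendsto_add_atTop_nat n)).const_mul κ⁻¹
      rw [mul_zero] at this
      refine this.congr fun i => ?_
      simp [add_comm]
    refine h.congr' ?_
    filter_upwards [eventually_gt_atTop 0] with i hi
    rw [if_neg (by omega)]
  refine ⟨mk _ hlim, norm_lt_of_coeff zero_lt_one fun i => ?_, ?_⟩
  · rw [coeff_mk]
    split_ifs with h
    · simp
    · rw [norm_mul, norm_inv, inv_mul_lt_iff₀ (norm_pos_iff.2 hκ), mul_one]
      exact h2 _ (by omega)
  · ext i
    rw [mul_assoc, ← Algebra.smul_def, ← Algebra.smul_def, map_add, map_smul, map_smul,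
      coeff_T_pow_mul, coeff_T_pow]
    rcases lt_trichotomy i n with h | rfl | h
    · rw [h1 i h, if_neg (by omega), if_neg (by omega)]; simp
    · simp
    · rw [if_neg (by omega), if_pos (by omega), coeff_mk, if_neg (by omega), smul_zero, zero_add,
        smul_eq_mul, mul_inv_cancel_left₀ hκ, Nat.add_sub_cancel' h.le]

/-- `F T` splits into `φ(t ^ p)`, where `φ` is a coordinate, and the terms `δ` of exponents prime to
`p`. On these exponents `‖i‖ = 1`, so the dominance of `n a_n` in the derivative bounds `δ` itself.
-/
theorem exists_normalForm_of_coeff_eq_one {p n : ℕ} (hp : p.Prime) (hres : ‖(p : k)‖ < 1)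
    {F : TateAlgebra k →ₐ[k] TateAlgebra k} (h1 : ∀ i < p, coeff i (F (T k)) = 0)
    (h2 : coeff p (F (T k)) = 1) (h3 : ∀ i, p < i → ‖coeff i (F (T k))‖ < 1)
    (h4 : ∀ i : ℕ, i < n → (i : k) * coeff i (F (T k)) = 0)
    (h5 : (n : k) * coeff n (F (T k)) ≠ 0)
    (h6 : ∀ i : ℕ, n < i → ‖(i : k) * coeff i (F (T k))‖ < ‖(n : k) * coeff n (F (T k))‖) :
    ∃ (c : k) (a g : TateAlgebra k), ((p : k) ≠ 0 → c = 0) ∧ ‖a - T k‖ < 1 ∧ ‖g‖ < 1 ∧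
      F a = (T k * (1 + g)) ^ p + algebraMap k _ c * (T k * (1 + g)) ^ n := by
  have hp0 := hp.pos
  set h := F (T k) with hh
  have hlim : Tendsto (fun i => coeff (p * i) h) atTop (𝓝 0) :=
    (tendsto_coeff h).comp (tendsto_atTop_mono (fun i => Nat.le_mul_of_pos_left i hp0) tendsto_id)
  set φ : TateAlgebra k := mk _ hlim with hφ
  have hφT : ‖φ - T k‖ < 1 := by
    refine norm_lt_of_coeff zero_lt_one fun i => ?_
    rw [map_sub, hφ, coeff_mk, coeff_T]
    rcases Nat.lt_trichotomy i 1 with hi | rfl | hi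
    · obtain rfl : i = 0 := by omega
      rw [mul_zero, h1 0 hp0]; simp
    · simp [h2]
    · rw [if_neg (by omega), sub_zero]
      exact h3 _ (by nlinarith)
  obtain ⟨e, he⟩ := exists_algEquiv_of_norm_sub_lt (c := (1 : k)) norm_one (by rwa [one_smul])
  set δ := h - subst p φ with hδ
  have hδc : ∀ i, coeff i δ = if p ∣ i then 0 else coeff i h := fun i => by
    rw [hδ, map_sub, coeff_subst hp0]
    split_ifs with hd
    · rw [hφ, coeff_mk, Nat.mul_div_cancel' hd, sub_self]
    · rw [sub_zero]
  have key : ∀ c κ : k, coeff n δ = c → NormalFormData p n c κ →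
      (∀ i < n, coeff i δ = 0) → (∀ i, n < i → ‖coeff i δ‖ < ‖κ‖) →
      ∃ (a g : TateAlgebra k), ‖a - T k‖ < 1 ∧ ‖g‖ < 1 ∧
      F a = (T k * (1 + g)) ^ p + algebraMap k _ c * (T k * (1 + g)) ^ n := by
    intro c κ hc hd hlt hgt
    obtain ⟨ω, hω, hωδ⟩ := exists_eq_leading_add hd.1 hlt hgt
    refine hd.exists_normalForm hp (e := e) (by rwa [he]) hω ?_
    rw [he, ← hc, ← hωδ, hδ, ← hh]
    ring
  have hnorm : ∀ i : ℕ, ¬p ∣ i → ‖(i : k)‖ = 1 := fun i => norm_natCast_eq_one_of_not_dvd hp hres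
  have hlt : ∀ i < n, coeff i δ = 0 := fun i hi => by
    rw [hδc]
    split_ifs with hd
    · rfl
    · refine (mul_eq_zero.1 (h4 i hi)).resolve_left fun h0 => ?_
      have := hnorm i hd
      rw [h0, norm_zero] at this
      exact zero_ne_one this
  have hgt : ∀ i, n < i → ‖coeff i δ‖ < ‖(n : k) * coeff n h‖ := fun i hi => by
    rw [hδc]
    split_ifs with hd
    · rw [norm_zero]; exact norm_pos_iff.2 h5
    · have := h6 i hi
      rwa [norm_mul, hnorm i hd, one_mul] at this
  -- If `p = 0` in `k`, then `n a_n ≠ 0` forces `n` to be prime to `p`. Otherwise the first nonzero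
  -- `i a_i` is `p a_p`, so `n = p`, and `δ` has no term of degree `n`, whence `c = 0`.
  by_cases hpk : (p : k) = 0
  · have hpn : ¬p ∣ n := by
      rintro ⟨m, rfl⟩
      rw [Nat.cast_mul, hpk, zero_mul, zero_mul] at h5
      exact h5 rfl
    obtain ⟨a, g, H⟩ := key (coeff n h) (n * coeff n h) (by rw [hδc, if_neg hpn])
      ⟨h5, Or.inr ⟨hpk, rfl, hnorm n hpn⟩⟩ hlt hgt
    exact ⟨_, a, g, fun h => absurd hpk h, H⟩
  · obtain rfl : n = p := by
      rcases lt_trichotomy n p with hnp | hnp | hnp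
      · rw [h1 n hnp, mul_zero] at h5; exact absurd rfl h5
      · exact hnp
      · have := h4 p hnp
        rw [h2, mul_one] at this
        exact absurd this hpk
    obtain ⟨a, g, H⟩ := key 0 n (by rw [hδc, if_pos dvd_rfl])
      ⟨hpk, Or.inl ⟨rfl, rfl, rfl⟩⟩ hlt (by simpa [h2] using hgt)
    exact ⟨0, a, g, fun _ => rfl, H⟩

/-- A function on the unit disc is a coordinate if it is the image of the standard coordinate
under an automorphism. -/
def IsCoordinate (a : TateAlgebra k) : Prop := ∃ e : TateAlgebra k ≃ₐ[k] TateAlgebra k, e (T k) = a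

theorem isCoordinate_of_norm_sub_lt {c : k} (hc : ‖c‖ = 1) {a : TateAlgebra k}
    (h : ‖a - c • T k‖ < 1) : IsCoordinate a := exists_algEquiv_of_norm_sub_lt hc h

/-- Rescaling the coordinate of the target disc makes the coefficient at `p` equal to 1. -/
theorem exists_isCoordinate_normalForm {p n : ℕ} (hp : p.Prime) (hres : ‖(p : k)‖ < 1)
    {F : TateAlgebra k →ₐ[k] TateAlgebra k} (h1 : ∀ i < p, coeff i (F (T k)) = 0)
    (h2 : ‖coeff p (F (T k))‖ = 1) (h3 : ∀ i, p < i → ‖coeff i (F (T k))‖ < 1)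
    (h4 : ∀ i : ℕ, i < n → (i : k) * coeff i (F (T k)) = 0)
    (h5 : (n : k) * coeff n (F (T k)) ≠ 0)
    (h6 : ∀ i : ℕ, n < i → ‖(i : k) * coeff i (F (T k))‖ < ‖(n : k) * coeff n (F (T k))‖) :
    ∃ (c : k) (a z : TateAlgebra k), ((p : k) ≠ 0 → c = 0) ∧ IsCoordinate a ∧ IsCoordinate z ∧
      coeff 0 z = 0 ∧ F a = z ^ p + algebraMap k _ c * z ^ n := by
  set γ := coeff p (F (T k)) with hγ
  have hγ0 : γ ≠ 0 := norm_ne_zero_iff.1 (by rw [h2]; exact one_ne_zero)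
  obtain ⟨s, hs⟩ := exists_algEquiv_of_norm_sub_lt (c := γ⁻¹) (y := γ⁻¹ • T k)
    (by rw [norm_inv, h2, inv_one]) (by simp)
  have hFs : F.comp (s : TateAlgebra k →ₐ[k] TateAlgebra k) (T k) = γ⁻¹ • F (T k) := by
    simp [hs]
  have hco : ∀ i, coeff i (F.comp (s : TateAlgebra k →ₐ[k] TateAlgebra k) (T k)) =
      γ⁻¹ * coeff i (F (T k)) := fun i => by rw [hFs, map_smul, smul_eq_mul]
  have hm : ∀ (i : ℕ) (x : k), (i : k) * (γ⁻¹ * x) = γ⁻¹ * (i * x) := fun i x => by ring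
  have hγn : ‖γ⁻¹‖ = 1 := by rw [norm_inv, h2, inv_one]
  obtain ⟨c, a, g, hc, ha, hg, H⟩ := exists_normalForm_of_coeff_eq_one (n := n) hp hres
    (F := F.comp (s : TateAlgebra k →ₐ[k] TateAlgebra k))
    (fun i hi => by rw [hco, h1 i hi, mul_zero])
    (by rw [hco, ← hγ, inv_mul_cancel₀ hγ0])
    (fun i hi => by rw [hco, norm_mul, hγn, one_mul]; exact h3 i hi)
    (fun i hi => by rw [hco, hm, h4 i hi, mul_zero])
    (by rw [hco, hm]; exact mul_ne_zero (inv_ne_zero hγ0) h5)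
    (fun i hi => by
      rw [hco, hco, hm, hm, norm_mul γ⁻¹, norm_mul γ⁻¹, hγn, one_mul, one_mul]
      exact h6 i hi)
  obtain ⟨e, he⟩ := exists_algEquiv_of_norm_sub_lt (c := (1 : k)) (y := a) norm_one
    (by rwa [one_smul])
  refine ⟨c, s a, T k * (1 + g), hc, ⟨e.trans s, by simp [he]⟩,
    isCoordinate_of_norm_sub_lt (c := 1) norm_one ?_, ?_, H⟩
  · have hz : T k * (1 + g) - (1 : k) • T k = T k * g := by rw [one_smul]; ring
    rwa [hz, norm_mul, norm_T, one_mul]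
  · rw [coeff_zero_mul, coeff_T, if_neg zero_ne_one, zero_mul]

end TateAlgebra

namespace TateAlgebra

set_option linter.unusedSectionVars false

variable {k : Type*} [NormedField k] [IsUltrametricDist k] [CompleteSpace k]

theorem norm_T_add_algebraMap_le {a : k} (ha : ‖a‖ ≤ 1) :
    ‖T k + algebraMap k (TateAlgebra k) a‖ ≤ 1 :=
  (IsUltrametricDist.norm_add_le_max _ _).trans
    (max_le norm_T.le (by rwa [norm_algebraMap']))

/-- Translations are automorphisms of the unit disc. -/
theorem isCoordinate_T_add_algebraMap {a : k} (ha : ‖a‖ ≤ 1) :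
    IsCoordinate (T k + algebraMap k (TateAlgebra k) a) := by
  have ha' : ‖-a‖ ≤ 1 := by rwa [norm_neg]
  let τ : ∀ b : k, ‖b‖ ≤ 1 → (TateAlgebra k →ₐ[k] TateAlgebra k) := fun b hb =>
    eval (T k + algebraMap k (TateAlgebra k) b) (norm_T_add_algebraMap_le hb)
  have hτ : ∀ b hb, τ b hb (T k) = T k + algebraMap k (TateAlgebra k) b := fun b hb => eval_T _ _
  refine ⟨AlgEquiv.ofAlgHom (τ a ha) (τ (-a) ha') (algHom_ext' ?_) (algHom_ext' ?_), hτ a ha⟩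
  · simp [hτ, -eval_T]
  · simp [hτ, -eval_T]

end TateAlgebra

/-! ### Étale covers in centered coordinates -/

namespace PointedDisc

open TateAlgebra

set_option linter.unusedSectionVars false

variable {k : Type u} [NormedField k] [IsUltrametricDist k] [CompleteSpace k]

theorem exists_centered_equiv (D : PointedDisc.{u, v} k) :
    ∃ e : TateAlgebra k ≃ₐ[k] D.ring, D.origin (e (T k)) = 0 := by
  obtain ⟨e⟩ := D.exists_equiv
  set a := D.origin (e (T k)) with ha
  have hle : ‖-a‖ ≤ 1 := by
    have := norm_algHom_field_le (D.origin.comp (e : TateAlgebra k →ₐ[k] D.ring)) (T k)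
    rw [norm_T] at this
    rw [norm_neg]
    exact this
  obtain ⟨τ, hτ⟩ := isCoordinate_T_add_algebraMap hle
  refine ⟨τ.trans e, ?_⟩
  rw [AlgEquiv.trans_apply, hτ, map_add, map_add, AlgEquiv.commutes, AlgHom.commutes, ← ha]
  simp

section Centered

variable {D : PointedDisc.{u, v} k} {e : TateAlgebra k ≃ₐ[k] D.ring}

theorem origin_eq (he : D.origin (e (T k)) = 0) (a : D.ring) :
    D.origin a = coeff 0 (e.symm a) := by
  have : D.origin.comp (e : TateAlgebra k →ₐ[k] D.ring) = constCoeff :=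
    algHom_field_ext (by simp [he, coeff_T])
  have h := DFunLike.congr_fun this (e.symm a)
  simpa using h

theorem isMonicCoordinate_iff (he : D.origin (e (T k)) = 0) (a : TateAlgebra k) :
    D.IsMonicCoordinate (e a) ↔ coeff 0 a = 0 ∧ IsCoordinate a := by
  rw [IsMonicCoordinate, origin_eq he, AlgEquiv.symm_apply_apply]
  refine and_congr_right fun _ => ⟨fun ⟨s, hs⟩ => ⟨s.trans e.symm, by simp [hs]⟩,
    fun ⟨s, hs⟩ => ⟨s.trans e, by simp [hs]⟩⟩

end Centered

section Cover

variable {Y : PointedDisc.{u, v} k} {X : PointedDisc.{u, w} k} {f : X.ring →ₐ[k] Y.ring}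
  {eX : TateAlgebra k ≃ₐ[k] X.ring} {eY : TateAlgebra k ≃ₐ[k] Y.ring}

/-- The morphism `f` in the given coordinates. -/
noncomputable def inCoordinates (f : X.ring →ₐ[k] Y.ring) (eX : TateAlgebra k ≃ₐ[k] X.ring)
    (eY : TateAlgebra k ≃ₐ[k] Y.ring) : TateAlgebra k →ₐ[k] TateAlgebra k :=
  (eY.symm : Y.ring →ₐ[k] TateAlgebra k).comp (f.comp (eX : TateAlgebra k →ₐ[k] X.ring))

theorem inCoordinates_apply (g : TateAlgebra k) :
    inCoordinates f eX eY g = eY.symm (f (eX g)) := rfl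

theorem IsCover.coeff_zero {m : ℕ} (hf : IsCover f m) (hX : X.origin (eX (T k)) = 0)
    (hY : Y.origin (eY (T k)) = 0) : coeff 0 (inCoordinates f eX eY (T k)) = 0 := by
  rw [inCoordinates_apply, ← origin_eq hY, ← hX, ← (hf.fiber_origin _).2 rfl]
  rfl

theorem IsCover.eq_zero_of_fiber {m : ℕ} (hf : IsCover f m) (hX : X.origin (eX (T k)) = 0)
    (hY : Y.origin (eY (T k)) = 0) (ψ : TateAlgebra k →ₐ[k] k)
    (hψ : ψ (inCoordinates f eX eY (T k)) = 0) : ψ (T k) = 0 := by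
  set y : Y.ring →ₐ[k] k := ψ.comp (eY.symm : Y.ring →ₐ[k] TateAlgebra k) with hy
  have h1 : (y.comp f).comp (eX : TateAlgebra k →ₐ[k] X.ring) =
      X.origin.comp (eX : TateAlgebra k →ₐ[k] X.ring) :=
    algHom_field_ext (by
      change ψ (inCoordinates f eX eY (T k)) = X.origin (eX (T k))
      rw [hψ, hX])
  have h2 : y.comp f = X.origin := by
    ext a
    have := DFunLike.congr_fun h1 (eX.symm a)
    simpa using this
  have h3 := DFunLike.congr_fun ((hf.fiber_origin y).1 h2) (eY (T k))
  rw [hY] at h3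
  simpa [hy] using h3

theorem IsCover.isIntegral {m : ℕ} (hf : IsCover f m) :
    (inCoordinates f eX eY : TateAlgebra k →+* TateAlgebra k).IsIntegral := by
  have h1 : (eX : TateAlgebra k →+* X.ring).IsIntegral :=
    RingHom.isIntegral_of_surjective _ eX.surjective
  have h2 : (eY.symm : Y.ring →+* TateAlgebra k).IsIntegral :=
    RingHom.isIntegral_of_surjective _ eY.symm.surjective
  exact (h1.trans _ _ hf.finite.to_isIntegral).trans _ _ h2

/-- For the coordinate `y = eY T`, the powers `1, y, ..., y ^ (m' - 1)` are a basis of the functions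
on `Y` over those on `X`. -/
theorem IsCover.eq_degree {m m' : ℕ} (hf : IsCover f m) (hm : 0 < m') {c : k} (hc : ‖c‖ = 1)
    (hF : ‖inCoordinates f eX eY (T k) - c • T k ^ m'‖ < 1) : m = m' := by
  have hb := bijective_sum_mul_T_pow hm hc hF
  let _ := (f : X.ring →+* Y.ring).toAlgebra
  have : Nontrivial X.ring := eX.symm.toRingHom.domain_nontrivial
  rw [← hf.degree]
  refine Module.finrank_of_bijective (fun j : Fin m' => eY (T k) ^ (j : ℕ)) ?_
  have h1 : Function.Bijective fun s : Fin m' → X.ring => fun j => eX.symm (s j) :=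
    (Equiv.arrowCongr (Equiv.refl (Fin m')) eX.symm.toEquiv).bijective
  convert eY.bijective.comp (hb.comp h1) using 1
  ext1 s
  simp [inCoordinates_apply, Algebra.smul_def, RingHom.algebraMap_toAlgebra]

/-- At a zero `ψ` of the derivative, `ψ ∘ d/dt` is a tangent vector that vanishes on all functions
pulled back from `X`. Away from the origin étaleness makes it zero, although its value on `t` is 1.
-/
theorem IsEtaleOutsideOrigin.eq_zero_of_deriv (hf : IsEtaleOutsideOrigin f)
    (hY : Y.origin (eY (T k)) = 0) (ψ : TateAlgebra k →ₐ[k] k)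
    (hψ : ψ (deriv (inCoordinates f eX eY (T k))) = 0) : ψ (T k) = 0 := by
  let _ := (f : X.ring →+* Y.ring).toAlgebra
  let y : Y.ring →+* k := (ψ : TateAlgebra k →+* k).comp (eY.symm : Y.ring →+* TateAlgebra k)
  have hker : (RingHom.ker y).IsPrime := RingHom.ker_isPrime y
  by_cases hq : RingHom.ker y = RingHom.ker Y.origin
  · have h1 : eY (T k) ∈ RingHom.ker y := by rw [hq]; exact hY
    simpa [y, RingHom.mem_ker] using h1
  · have := hf ⟨RingHom.ker y, hker⟩ hq
    let D : Y.ring →+ k := ((ψ : TateAlgebra k →+ k).comp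
      ((deriv : Derivation k (TateAlgebra k) (TateAlgebra k)) :
      TateAlgebra k →+ TateAlgebra k)).comp (eY.symm : Y.ring →+ TateAlgebra k)
    have hDdef : ∀ b, D b = ψ (deriv (eY.symm b)) := fun _ => rfl
    have hydef : ∀ b, y b = ψ (eY.symm b) := fun _ => rfl
    have h0 := Algebra.IsEtaleAt.derivation_eq_zero (A := X.ring) (RingHom.ker y) y rfl D
      (fun a b => by simp [hDdef, hydef])
      (fun a => by
        rw [hDdef]
        have := algHom_deriv_eq_zero hψ (eX.symm a)
        rwa [inCoordinates_apply, AlgEquiv.apply_symm_apply] at this) (eY (T k))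
    rw [hDdef, AlgEquiv.symm_apply_apply, deriv_T, map_one] at h0
    exact absurd h0 one_ne_zero

/-- The shape of an étale cover in coordinates. -/
theorem IsEtaleCover.coeff [IsAlgClosed k] {m : ℕ} (hf : IsEtaleCover f m)
    (hX : X.origin (eX (T k)) = 0) (hY : Y.origin (eY (T k)) = 0) :
    (∀ i < m, coeff i (inCoordinates f eX eY (T k)) = 0) ∧
    ‖coeff m (inCoordinates f eX eY (T k))‖ = 1 ∧
    (∀ i, m < i → ‖coeff i (inCoordinates f eX eY (T k))‖ < 1) ∧
    ∃ n : ℕ, (∀ i : ℕ, i < n → (i : k) * coeff i (inCoordinates f eX eY (T k)) = 0) ∧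
      (n : k) * coeff n (inCoordinates f eX eY (T k)) ≠ 0 ∧
      ∀ i : ℕ, n < i → ‖(i : k) * coeff i (inCoordinates f eX eY (T k))‖ <
        ‖(n : k) * coeff n (inCoordinates f eX eY (T k))‖ := by
  obtain ⟨m', hm, h1, h2, h3⟩ := exists_coeff_of_isIntegral (hf.coeff_zero hX hY)
    hf.isIntegral (hf.eq_zero_of_fiber hX hY)
  obtain rfl : m = m' := hf.eq_degree hm h2 (eX := eX) (eY := eY) (by
    refine norm_lt_of_coeff zero_lt_one fun i => ?_
    rw [map_sub, map_smul, coeff_T_pow, smul_eq_mul]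
    rcases Nat.lt_trichotomy i m' with hi | rfl | hi
    · rw [h1 i hi, if_neg (by omega)]; simp
    · simp
    · rw [if_neg (by omega), mul_zero, sub_zero]
      exact h3 i hi)
  obtain ⟨n, -, h4, h5, h6⟩ := exists_dominant_deriv_coeff (hf.etale.eq_zero_of_deriv hY)
  exact ⟨h1, h2, h3, n, h4, h5, h6⟩

/-- An étale `p`-cover is binomial, and it is Kummer if `p ≠ 0` in `k`. -/
theorem IsEtaleCover.exists_presentation [IsAlgClosed k] {p : ℕ} (hp : p.Prime)
    (hres : ‖(p : k)‖ < 1) (hf : IsEtaleCover f p) :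
    ∃ (c : k) (n : ℕ), ((p : k) ≠ 0 → c = 0) ∧ HasBinomialPresentation f p c n := by
  obtain ⟨eX, hX⟩ := X.exists_centered_equiv
  obtain ⟨eY, hY⟩ := Y.exists_centered_equiv
  obtain ⟨h1, h2, h3, n, h4, h5, h6⟩ := hf.coeff hX hY
  obtain ⟨c, a, z, hc, ha, hz, hz0, H⟩ := exists_isCoordinate_normalForm hp hres h1 h2 h3 h4 h5 h6
  refine ⟨c, n, hc, eX a, eY z, (isMonicCoordinate_iff hX a).2 ⟨?_, ha⟩,
    (isMonicCoordinate_iff hY z).2 ⟨hz0, hz⟩, ?_⟩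
  · rw [← coeff_zero_algHom (hf.coeff_zero hX hY), H, map_add, coeff_zero_mul]
    have hpow : ∀ i, i ≠ 0 → TateAlgebra.coeff 0 (z ^ i) = 0 := fun i hi => by
      rw [← constCoeff_apply, map_pow, constCoeff_apply, hz0, zero_pow hi]
    have hn : n ≠ 0 := by rintro rfl; simp at h5
    rw [hpow p hp.ne_zero, hpow n hn, mul_zero, add_zero]
  · have := congrArg eY H
    rw [inCoordinates_apply, AlgEquiv.apply_symm_apply] at this
    simpa using this

/-- The shape of a binomial presentation of an étale `p`-cover in characteristic `p`. -/
theorem IsEtaleCover.of_presentation [IsAlgClosed k] {p : ℕ} (hp : p.Prime) [CharP k p]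
    (hf : IsEtaleCover f p) {x : X.ring} {y : Y.ring} {c : k} {n : ℕ}
    (hx : X.IsMonicCoordinate x) (hy : Y.IsMonicCoordinate y)
    (h : f x = y ^ p + algebraMap k Y.ring c * y ^ n) : p < n ∧ ¬p ∣ n ∧ 0 < ‖c‖ ∧ ‖c‖ < 1 := by
  obtain ⟨hx0, eX, rfl⟩ := hx
  obtain ⟨hy0, eY, rfl⟩ := hy
  obtain ⟨h1, h2, h3, m, h4, h5, h6⟩ := hf.coeff hx0 hy0
  have hF : inCoordinates f eX eY (T k) = T k ^ p + c • T k ^ n := by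
    rw [inCoordinates_apply, h, Algebra.smul_def]
    simp
  have hco : ∀ i, TateAlgebra.coeff i (inCoordinates f eX eY (T k)) =
      (if i = p then 1 else 0) + c * (if i = n then 1 else 0) := fun i => by
    rw [hF, map_add, map_smul, coeff_T_pow, coeff_T_pow, smul_eq_mul]
  -- In characteristic `p` the derivative of `t ^ p + c t ^ n` is `n c t ^ (n - 1)`, so its dominant
  -- term can only come from `n`.
  have hm : m = n := by
    by_contra hne
    rw [hco, if_neg hne, mul_zero, add_zero] at h5
    split_ifs at h5 with hmp
    · rw [hmp, CharP.cast_eq_zero, zero_mul] at h5; exact h5 rfl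
    · rw [mul_zero] at h5; exact h5 rfl
  subst hm
  have hpm : ¬p ∣ m := fun hd => by
    rw [(CharP.cast_eq_zero_iff k p m).2 hd, zero_mul] at h5; exact h5 rfl
  have hne : m ≠ p := by rintro rfl; exact hpm dvd_rfl
  rw [hco, if_neg hne, if_pos rfl, zero_add, mul_one] at h5
  have hlt : p < m := by
    by_contra! hle
    have := h1 m (lt_of_le_of_ne hle hne)
    rw [hco, if_neg hne, if_pos rfl, zero_add, mul_one] at this
    rw [this, mul_zero] at h5
    exact h5 rfl
  have hc1 := h3 m hlt
  rw [hco, if_neg hne, if_pos rfl, zero_add, mul_one] at hc1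
  exact ⟨hlt, hpm, norm_pos_iff.2 (right_ne_zero_of_mul h5), hc1⟩

end Cover

end PointedDisc

theorem HasSum.norm_le_of_forall_norm_le {E I : Type*} [SeminormedAddCommGroup E]
    [IsUltrametricDist E] {f : I → E} {a : E} (h : HasSum f a) {C : ℝ} (hC : 0 ≤ C)
    (hf : ∀ i, ‖f i‖ ≤ C) : ‖a‖ ≤ C :=
  le_of_tendsto h.norm (Eventually.of_forall fun _ =>
    IsUltrametricDist.norm_sum_le_of_forall_le_of_nonneg hC fun i _ => hf i)

/-- The absolute values of an algebraically closed field are dense. -/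
theorem exists_lt_norm_lt {k : Type*} [NormedField k] [IsAlgClosed k] {c : k} (hc0 : 0 < ‖c‖)
    (hc1 : ‖c‖ < 1) {α β : ℝ} (hα : 0 ≤ α) (hαβ : α < β) : ∃ b : k, α < ‖b‖ ∧ ‖b‖ < β := by
  obtain ⟨α', hα', hα'β⟩ := exists_between hαβ
  have hα'0 : 0 < α' := hα.trans_lt hα'
  have hq : 1 < β / α' := (one_lt_div hα'0).2 hα'β
  -- An `N`-th root `d` of `c⁻¹` has norm between 1 and `β / α'`, so the powers of `‖d‖` cannot jump
  -- over the interval from `α'` to `β`.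
  obtain ⟨N, hN⟩ := pow_unbounded_of_one_lt ‖c‖⁻¹ hq
  have hN0 : N ≠ 0 := by
    rintro rfl
    rw [pow_zero] at hN
    exact absurd ((one_lt_inv₀ hc0).2 hc1) hN.not_gt
  obtain ⟨d, hd⟩ := IsAlgClosed.exists_pow_nat_eq c⁻¹ (Nat.pos_of_ne_zero hN0)
  have hdn : ‖d‖ ^ N = ‖c‖⁻¹ := by rw [← norm_pow, hd, norm_inv]
  have hd1 : 1 < ‖d‖ := by
    by_contra! hle
    have := pow_le_one₀ (n := N) (norm_nonneg d) hle
    rw [hdn] at this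
    exact absurd ((one_lt_inv₀ hc0).2 hc1) this.not_gt
  have hdq : ‖d‖ < β / α' := by
    rw [← hdn] at hN
    exact lt_of_pow_lt_pow_left₀ N (by positivity) hN
  obtain ⟨m, hm1, hm2⟩ := exists_mem_Ico_zpow (x := α') (y := ‖d‖) hα'0 hd1
  have hd0 : (0 : ℝ) < ‖d‖ := by positivity
  refine ⟨d ^ (m + 1), ?_, ?_⟩
  · rw [norm_zpow]; exact hα'.trans hm2
  · rw [norm_zpow, zpow_add_one₀ hd0.ne']
    calc ‖d‖ ^ m * ‖d‖ ≤ α' * ‖d‖ := by gcongr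
      _ < α' * (β / α') := by gcongr
      _ = β := by field_simp

/-! ### Seminorms on the skeleton and the derivation of the residue field -/

namespace TateAlgebra

set_option linter.unusedSectionVars false

variable {k : Type*} [NormedField k] [IsUltrametricDist k]

section Skeletal

variable {L : Type*} [NormedField L] [IsUltrametricDist L]

/-- A bounded homomorphism from the Tate algebra to a nonarchimedean field such that the induced
seminorm lies on the skeleton `[O, q]` and differs from `O`. -/
structure IsSkeletal (ι : TateAlgebra k →+* L) : Prop where
  norm_algebraMap : ∀ a, ‖ι (algebraMap k _ a)‖ = ‖a‖
  norm_le : ∀ g, ‖ι g‖ ≤ ‖g‖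
  norm_coeff_zero_le : ∀ g, ‖coeff 0 g‖ ≤ ‖ι g‖
  map_T_ne_zero : ι (T k) ≠ 0

variable {ι : TateAlgebra k →+* L}

namespace IsSkeletal

theorem norm_T_pos (hι : IsSkeletal ι) : 0 < ‖ι (T k)‖ := norm_pos_iff.2 hι.map_T_ne_zero

theorem norm_T_le (hι : IsSkeletal ι) : ‖ι (T k)‖ ≤ 1 := (hι.norm_le _).trans norm_T.le

/-- Subtracting the constant term does not increase the norm, by `norm_coeff_zero_le`, and what
remains is divided by `T`. Together with `norm_le_of_forall` this identifies the seminorm as the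
Gauss norm of radius `‖ι T‖`. -/
theorem norm_coeff_mul_pow_le (hι : IsSkeletal ι) (g : TateAlgebra k) (i : ℕ) :
    ‖coeff i g‖ * ‖ι (T k)‖ ^ i ≤ ‖ι g‖ := by
  induction i generalizing g with
  | zero => simpa using hι.norm_coeff_zero_le g
  | succ i ih =>
    obtain ⟨h, hg, -⟩ := exists_eq_add_T_mul g
    have hco : coeff (i + 1) g = coeff i h := by
      rw [hg, map_add, coeff_algebraMap, if_neg (by omega), zero_add]
      simpa using coeff_T_pow_mul 1 (i + 1) h
    have h1 : ‖ι (T k * h)‖ ≤ ‖ι g‖ := by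
      have : T k * h = g - algebraMap k _ (coeff 0 g) := eq_sub_of_add_eq' hg.symm
      rw [this, map_sub]
      refine (IsUltrametricDist.norm_sub_le_max' _ _).trans (max_le le_rfl ?_)
      rw [hι.norm_algebraMap]
      exact hι.norm_coeff_zero_le g
    rw [map_mul, norm_mul] at h1
    rw [hco, pow_succ']
    calc ‖coeff i h‖ * (‖ι (T k)‖ * ‖ι (T k)‖ ^ i)
        = ‖ι (T k)‖ * (‖coeff i h‖ * ‖ι (T k)‖ ^ i) := by ring
      _ ≤ ‖ι (T k)‖ * ‖ι h‖ := mul_le_mul_of_nonneg_left (ih h) (norm_nonneg _)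
      _ ≤ ‖ι g‖ := h1

theorem continuous (hι : IsSkeletal ι) : Continuous ι :=
  AddMonoidHomClass.continuous_of_bound ι 1 fun g => by simpa using hι.norm_le g

theorem hasSum (hι : IsSkeletal ι) (g : TateAlgebra k) :
    HasSum (fun i => ι (algebraMap k _ (coeff i g)) * ι (T k) ^ i) (ι g) := by
  have := (hasSum_coeff_smul g).map ι hι.continuous
  convert this using 1
  ext1 i
  simp [Algebra.smul_def]

theorem norm_le_of_forall (hι : IsSkeletal ι) {g : TateAlgebra k} {C : ℝ}
    (h : ∀ i, ‖coeff i g‖ * ‖ι (T k)‖ ^ i ≤ C) : ‖ι g‖ ≤ C :=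
  (hι.hasSum g).norm_le_of_forall_norm_le ((by positivity : (0 : ℝ) ≤ _).trans (h 0)) fun i => by
    rw [norm_mul, norm_pow, hι.norm_algebraMap]
    exact h i

theorem injective (hι : IsSkeletal ι) : Function.Injective ι := by
  rw [injective_iff_map_eq_zero]
  intro g hg
  ext i
  have := hι.norm_coeff_mul_pow_le g i
  rw [hg, norm_zero] at this
  have h2 := pow_pos hι.norm_T_pos i
  have h3 : ‖coeff i g‖ ≤ 0 := by
    by_contra! h
    exact absurd this (mul_pos h h2).not_ge
  simpa using h3

theorem norm_deriv_mul_le (hι : IsSkeletal ι) (g : TateAlgebra k) :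
    ‖ι (deriv g)‖ * ‖ι (T k)‖ ≤ ‖ι g‖ := by
  rw [← le_div_iff₀ hι.norm_T_pos]
  refine hι.norm_le_of_forall fun i => ?_
  rw [le_div_iff₀ hι.norm_T_pos, coeff_deriv]
  have h1 := norm_mul_natCast_le (coeff (i + 1) g) (i + 1)
  push_cast at h1
  calc ‖coeff (i + 1) g * (i + 1)‖ * ‖ι (T k)‖ ^ i * ‖ι (T k)‖
      = ‖coeff (i + 1) g * (i + 1)‖ * ‖ι (T k)‖ ^ (i + 1) := by ring
    _ ≤ ‖coeff (i + 1) g‖ * ‖ι (T k)‖ ^ (i + 1) := by gcongr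
    _ ≤ ‖ι g‖ := hι.norm_coeff_mul_pow_le g _

theorem norm_quotient_rule_le (hι : IsSkeletal ι) (g h : TateAlgebra k) (hh : h ≠ 0) :
    ‖(ι (deriv g) - ι g / ι h * ι (deriv h)) / ι h‖ * ‖ι (T k)‖ ≤ ‖ι g / ι h‖ := by
  have h0 : ι h ≠ 0 := (map_ne_zero_iff _ hι.injective).2 hh
  have hn : 0 < ‖ι h‖ := norm_pos_iff.2 h0
  rw [norm_div, norm_div, div_mul_eq_mul_div]
  gcongr
  refine le_trans (mul_le_mul_of_nonneg_right (IsUltrametricDist.norm_sub_le_max' _ _)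
    (norm_nonneg _)) ?_
  rw [max_mul_of_nonneg _ _ (norm_nonneg _)]
  refine max_le (hι.norm_deriv_mul_le g) ?_
  rw [norm_mul, norm_div, mul_assoc]
  calc ‖ι g‖ / ‖ι h‖ * (‖ι (deriv h)‖ * ‖ι (T k)‖) ≤ ‖ι g‖ / ‖ι h‖ * ‖ι h‖ := by
        gcongr
        exact hι.norm_deriv_mul_le h
    _ = ‖ι g‖ := by field_simp

/-- A derivation is a homomorphism to the dual numbers that lifts the identity. In this form `d/dt`
extends to fractions by localization and to `L` by uniform continuity; the quotient rule gives the
bound `1 / ‖ι T‖` that makes it continuous. -/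
theorem exists_derivation_of_isFractionRing [CompleteSpace L] (hι : IsSkeletal ι) {Q : Type*}
    [NormedField Q] [Algebra (TateAlgebra k) Q] [IsFractionRing (TateAlgebra k) Q] (j : Q →+* L)
    (hj : ∀ g, j (algebraMap _ _ g) = ι g) (hjn : ∀ q, ‖j q‖ = ‖q‖) (hdr : DenseRange j) :
    ∃ D : L →+ L, (∀ a b, D (a * b) = a * D b + b * D a) ∧ (∀ g, D (ι g) = ι (deriv g)) ∧
      ∀ l, ‖D l‖ * ‖ι (T k)‖ ≤ ‖l‖ := by
  have hiso : Isometry j := AddMonoidHomClass.isometry_of_norm j hjn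
  let ρ : TateAlgebra k →+* DualNumber L :=
    { toFun := fun g => TrivSqZeroExt.inl (ι g) + TrivSqZeroExt.inr (ι (deriv g))
      map_one' := by ext <;> simp
      map_mul' := fun a b => by ext <;> simp [mul_comm]
      map_zero' := by ext <;> simp
      map_add' := fun a b => by ext <;> simp }
  have hρ1 : ∀ g, (ρ g).fst = ι g := fun g => by simp [ρ]
  have hρ2 : ∀ g, (ρ g).snd = ι (deriv g) := fun g => by simp [ρ]
  have hunit : ∀ g : nonZeroDivisors (TateAlgebra k), IsUnit (ρ g) := fun g => by
    rw [TrivSqZeroExt.isUnit_iff_isUnit_fst, hρ1, isUnit_iff_ne_zero,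
      map_ne_zero_iff _ hι.injective]
    exact nonZeroDivisors.ne_zero g.2
  let σ : Q →+* DualNumber L := IsLocalization.lift hunit
  have hσ : ∀ g, σ (algebraMap _ _ g) = ρ g := fun g => IsLocalization.lift_eq hunit g
  have hσ1 : ∀ q, (σ q).fst = j q := by
    intro q
    have : (TrivSqZeroExt.fstHom L L L).toRingHom.comp σ = j := by
      refine IsLocalization.ringHom_ext (nonZeroDivisors (TateAlgebra k)) ?_
      ext g
      simp [hσ, hρ1, hj]
    exact DFunLike.congr_fun this q
  have hσ2 : ∀ q, ‖(σ q).snd‖ * ‖ι (T k)‖ ≤ ‖q‖ := by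
    intro q
    obtain ⟨g, h, hh, rfl⟩ := IsFractionRing.div_surjective (A := TateAlgebra k) q
    have hh0 : h ≠ 0 := nonZeroDivisors.ne_zero hh
    have h0 : ι h ≠ 0 := (map_ne_zero_iff _ hι.injective).2 hh0
    have h1 : algebraMap _ Q h ≠ 0 := by
      intro h1
      rw [← hj, h1, map_zero] at h0
      exact h0 rfl
    set q := algebraMap _ Q g / algebraMap _ _ h with hq
    have h2 : σ q * ρ h = ρ g := by
      rw [← hσ, ← hσ, ← map_mul, hq, div_mul_cancel₀ _ h1]
    have h3 := congrArg TrivSqZeroExt.snd h2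
    have hjq : j q = ι g / ι h := by rw [hq, map_div₀, hj, hj]
    rw [TrivSqZeroExt.snd_mul, hρ1, hρ2, hρ2, hσ1, hjq, smul_eq_mul,
      op_smul_eq_smul, smul_eq_mul] at h3
    have h4 : (σ q).snd = (ι (deriv g) - ι g / ι h * ι (deriv h)) / ι h := by
      rw [eq_div_iff h0]; linear_combination h3
    rw [h4, ← hjn, hjq]
    exact hι.norm_quotient_rule_le g h hh0
  have hbound : ∀ q, ‖(σ q).snd‖ ≤ ‖ι (T k)‖⁻¹ * ‖q‖ := fun q => by
    rw [← div_eq_inv_mul, le_div_iff₀ hι.norm_T_pos]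
    exact hσ2 q
  have hcs : Continuous fun q => (σ q).snd :=
    AddMonoidHomClass.continuous_of_bound
      ((TrivSqZeroExt.sndHom L L : DualNumber L →ₗ[L] L).toAddMonoidHom.comp σ.toAddMonoidHom)
      _ hbound
  have hc : Continuous σ := by
    have h1 : Continuous fun q => (σ q).fst := by
      simp_rw [hσ1]; exact hiso.continuous
    have : (σ : Q → DualNumber L) =
        fun q => TrivSqZeroExt.inl (σ q).fst + TrivSqZeroExt.inr (σ q).snd := by
      ext1 q; exact (TrivSqZeroExt.inl_fst_add_inr_snd_eq _).symm
    rw [this]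
    exact (TrivSqZeroExt.continuous_inl.comp h1).add (TrivSqZeroExt.continuous_inr.comp hcs)
  have huc : UniformContinuous σ := uniformContinuous_addMonoidHom_of_continuous hc
  let E : L →+* DualNumber L :=
    IsDenseInducing.extendRingHom hiso.isUniformInducing hdr huc
  have hEc : Continuous E :=
    (uniformContinuous_uniformly_extend hiso.isUniformInducing hdr huc).continuous
  have hE : ∀ q, E (j q) = σ q := fun q =>
    IsDenseInducing.extend_eq (hiso.isUniformInducing.isDenseInducing hdr) hc q
  have hE1 : ∀ l, (E l).fst = l := by
    intro l
    refine hdr.induction_on l (isClosed_eq (TrivSqZeroExt.continuous_fst.comp hEc) continuous_id)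
      fun q => ?_
    rw [hE, hσ1]
  refine ⟨(TrivSqZeroExt.sndHom L L : DualNumber L →ₗ[L] L).toAddMonoidHom.comp E.toAddMonoidHom,
    fun a b => ?_, fun g => ?_, fun l => ?_⟩
  · change (E (a * b)).snd = a * (E b).snd + b * (E a).snd
    rw [map_mul, TrivSqZeroExt.snd_mul, hE1, hE1, smul_eq_mul, op_smul_eq_smul,
      smul_eq_mul]
  · change (E (ι g)).snd = _
    rw [← hj, hE, hσ, hρ2]
  · change ‖(E l).snd‖ * _ ≤ _
    refine hdr.induction_on l (isClosed_le ?_ continuous_norm) fun q => ?_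
    · exact (TrivSqZeroExt.continuous_snd.comp hEc).norm.mul continuous_const
    · rw [hE, hjn]
      exact hσ2 q

/-- The derivation of the Tate algebra extends to the completed fraction field. -/
theorem exists_derivation [CompleteSpace L] (hι : IsSkeletal ι)
    (hdense : ∀ (l : L) (ε : ℝ), 0 < ε → ∃ g h, h ≠ 0 ∧ ‖l - ι g / ι h‖ < ε) :
    ∃ D : L →+ L, (∀ a b, D (a * b) = a * D b + b * D a) ∧ (∀ g, D (ι g) = ι (deriv g)) ∧
      ∀ l, ‖D l‖ * ‖ι (T k)‖ ≤ ‖l‖ := by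
  let j : FractionRing (TateAlgebra k) →+* L := IsFractionRing.lift hι.injective
  have hj : ∀ g, j (algebraMap _ _ g) = ι g := fun g => IsFractionRing.lift_algebraMap _ g
  have hdr : DenseRange j := by
    intro l
    rw [Metric.mem_closure_range_iff]
    intro ε hε
    obtain ⟨g, h, -, hgh⟩ := hdense l ε hε
    refine ⟨algebraMap _ _ g / algebraMap _ _ h, ?_⟩
    rw [map_div₀, hj, hj, dist_eq_norm]
    exact hgh
  let _ : NormedField (FractionRing (TateAlgebra k)) :=
    NormedField.induced _ L j j.injective
  exact hι.exists_derivation_of_isFractionRing j hj (fun _ => rfl) hdr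

end IsSkeletal

end Skeletal

end TateAlgebra

theorem norm_pow_sub_pow_le_of_norm_sub_le {L : Type*} [NormedField L] [IsUltrametricDist L]
    {a b : L} {M ε : ℝ} (hε : 0 ≤ ε) (ha : ‖a‖ ≤ M) (hb : ‖b‖ ≤ M) (hab : ‖a - b‖ ≤ ε * M) (i : ℕ) :
    ‖a ^ i - b ^ i‖ ≤ ε * M ^ i := by
  have hM : 0 ≤ M := (norm_nonneg _).trans ha
  induction i with
  | zero => simpa using hε
  | succ i ih =>
    have h : a ^ (i + 1) - b ^ (i + 1) = a * (a ^ i - b ^ i) + (a - b) * b ^ i := by ring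
    rw [h]
    refine (IsUltrametricDist.norm_add_le_max _ _).trans (max_le ?_ ?_)
    · rw [norm_mul]
      calc ‖a‖ * ‖a ^ i - b ^ i‖ ≤ M * (ε * M ^ i) := by gcongr
        _ = ε * M ^ (i + 1) := by ring
    · rw [norm_mul, norm_pow]
      calc ‖a - b‖ * ‖b‖ ^ i ≤ ε * M * M ^ i := by gcongr
        _ = ε * M ^ (i + 1) := by ring

/-! ### Decomposition of the residue field `L` over `K` by powers of the coordinate -/

namespace TateAlgebra

set_option linter.unusedSectionVars false

variable {k : Type*} [NormedField k] [IsUltrametricDist k] [CompleteSpace k]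

/-- The chain rule. -/
theorem deriv_algHom (F : TateAlgebra k →ₐ[k] TateAlgebra k) (g : TateAlgebra k) :
    deriv (F g) = F (deriv g) * deriv (F (T k)) := by
  have hc := algHom_continuous F
  have h1 := (hasSum_coeff_smul g).map
    (((deriv : Derivation k (TateAlgebra k) (TateAlgebra k)) :
      TateAlgebra k →+ TateAlgebra k).comp (F : TateAlgebra k →+ TateAlgebra k))
    (continuous_deriv.comp hc)
  have h2 := (((hasSum_coeff_smul g).map
    ((F : TateAlgebra k →+ TateAlgebra k).comp
      ((deriv : Derivation k (TateAlgebra k) (TateAlgebra k)) : TateAlgebra k →+ TateAlgebra k))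
    (hc.comp continuous_deriv))).mul_right (deriv (F (T k)))
  refine h1.unique ?_
  refine (congrArg (HasSum · _) (funext fun i => ?_)).mpr h2
  change deriv (F (coeff i g • T k ^ i)) = F (deriv (coeff i g • T k ^ i)) * deriv (F (T k))
  simp only [map_smul, map_pow, Derivation.map_smul, Derivation.leibniz_pow, deriv_T, map_nsmul,
    smul_eq_mul, mul_one, smul_mul_assoc]

section Decomposition

variable {K L : Type*} [NormedField K] [IsUltrametricDist K] [NormedField L] [IsUltrametricDist L]
  {φ : K →+* L} {κ : TateAlgebra k →+* K} {ι : TateAlgebra k →+* L}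
  {F : TateAlgebra k →ₐ[k] TateAlgebra k} {p : ℕ} {ε : ℝ}

theorem IsSkeletal.of_comp (hι : IsSkeletal ι) (hφ : ∀ a, ‖φ a‖ = ‖a‖)
    (hcomm : ∀ g, φ (κ g) = ι (F g)) (hF : coeff 0 (F (T k)) = 0) (hF0 : F (T k) ≠ 0) :
    IsSkeletal κ where
  norm_algebraMap a := by rw [← hφ, hcomm, AlgHom.commutes, hι.norm_algebraMap]
  norm_le g := by rw [← hφ, hcomm]; exact (hι.norm_le _).trans (norm_algHom_le F g)
  norm_coeff_zero_le g := by
    rw [← hφ, hcomm, ← coeff_zero_algHom hF]; exact hι.norm_coeff_zero_le _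
  map_T_ne_zero h := by
    have := hcomm (T k)
    rw [h, map_zero] at this
    exact hF0 (hι.injective (by rw [← this, map_zero]))

/-- If `t ^ p` and `F T` agree up to a relative error `ε`, so do their powers, and hence the values
at them of any series, measured by the Gauss norm of radius `‖ι T‖ ^ p`. -/
theorem IsSkeletal.norm_subst (hι : IsSkeletal ι) (hε0 : 0 ≤ ε) (hε1 : ε ≤ 1)
    (hFT : ‖ι (T k) ^ p - ι (F (T k))‖ ≤ ε * ‖ι (T k)‖ ^ p) {G : TateAlgebra k} {C : ℝ}
    (hC : ∀ i, ‖coeff i G‖ * (‖ι (T k)‖ ^ p) ^ i ≤ C) :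
    ‖ι (F G)‖ ≤ C ∧ ‖ι (subst p G) - ι (F G)‖ ≤ ε * C := by
  have hC0 : 0 ≤ C := (by positivity : (0 : ℝ) ≤ _).trans (hC 0)
  have hsum : ∀ H : TateAlgebra k →ₐ[k] TateAlgebra k,
      HasSum (fun i => ι (algebraMap k _ (coeff i G)) * ι (H (T k)) ^ i) (ι (H G)) := fun H => by
    have := (hasSum_coeff_smul G).map (ι.comp (H : TateAlgebra k →+* TateAlgebra k))
      (hι.continuous.comp (algHom_continuous H))
    refine (congrArg (HasSum · _) (funext fun i => ?_)).mpr this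
    simp [Algebra.smul_def]
  have ha : ‖ι (subst p (T k))‖ ≤ ‖ι (T k)‖ ^ p := by rw [subst_T, map_pow, norm_pow]
  have hab : ‖ι (subst p (T k)) - ι (F (T k))‖ ≤ ε * ‖ι (T k)‖ ^ p := by
    rwa [subst_T, map_pow]
  have hb : ‖ι (F (T k))‖ ≤ ‖ι (T k)‖ ^ p := by
    have h := IsUltrametricDist.norm_sub_le_max' (ι (subst p (T k)))
      (ι (subst p (T k)) - ι (F (T k)))
    rw [sub_sub_cancel] at h
    refine h.trans (max_le ha (hab.trans ?_))
    exact mul_le_of_le_one_left (by positivity) hε1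
  constructor
  · refine (hsum F).norm_le_of_forall_norm_le hC0 fun i => ?_
    rw [norm_mul, norm_pow, hι.norm_algebraMap]
    exact le_trans (by gcongr) (hC i)
  · refine ((hsum (subst p)).sub (hsum F)).norm_le_of_forall_norm_le (by positivity) fun i => ?_
    rw [← mul_sub, norm_mul, hι.norm_algebraMap]
    calc ‖coeff i G‖ * ‖ι (subst p (T k)) ^ i - ι (F (T k)) ^ i‖
        ≤ ‖coeff i G‖ * (ε * (‖ι (T k)‖ ^ p) ^ i) := by
          gcongr
          exact norm_pow_sub_pow_le_of_norm_sub_le hε0 ha hb hab i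
      _ = ε * (‖coeff i G‖ * (‖ι (T k)‖ ^ p) ^ i) := by ring
      _ ≤ ε * C := by gcongr; exact hC i

/-- The part of a series consisting of the exponents congruent to `j` modulo `p`. -/
noncomputable def residuePart (p : ℕ) (hp : 0 < p) (g : TateAlgebra k) (j : ℕ) : TateAlgebra k :=
  mk (fun i => coeff (p * i + j) g) ((tendsto_coeff g).comp (tendsto_atTop_mono
    (fun i => (Nat.le_mul_of_pos_left i hp).trans (Nat.le_add_right _ _)) tendsto_id))

theorem sum_subst_residuePart (hp : 0 < p) (g : TateAlgebra k) :
    ∑ j : Fin p, subst p (residuePart p hp g j) * T k ^ (j : ℕ) = g := by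
  ext n
  have h := coeff_sum_eval_mul (c := (1 : k)) (by simp) hp
    (fun j : Fin p => residuePart p hp g j) (n / p) ⟨n % p, Nat.mod_lt _ hp⟩
  simp only [Nat.div_add_mod, one_pow, one_mul, one_smul, residuePart, coeff_mk] at h
  exact h

theorem pow_prime_eq_subst (hp : p.Prime) (hpk : (p : k) = 0) (d : TateAlgebra k) :
    d ^ p = subst p (powCoeff p hp.ne_zero d) := by
  have := norm_pow_prime_sub_le hp d
  rw [hpk, norm_zero, zero_mul] at this
  exact sub_eq_zero.1 (norm_le_zero_iff.1 this)

/-- Write `u / d = u d ^ (p - 1) / d ^ p`. In characteristic `p` the denominator is a series in `t ^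
p`, and the numerator splits by exponents modulo `p`; replacing `t ^ p` by `F T` costs a relative
error `ε`. -/
theorem IsSkeletal.exists_approx (hι : IsSkeletal ι) (hp : p.Prime) (hpk : (p : k) = 0)
    (hφ : ∀ a, ‖φ a‖ = ‖a‖) (hcomm : ∀ g, φ (κ g) = ι (F g)) (hε0 : 0 ≤ ε) (hε1 : ε < 1)
    (hFT : ‖ι (T k) ^ p - ι (F (T k))‖ ≤ ε * ‖ι (T k)‖ ^ p) (u d : TateAlgebra k) (hd : d ≠ 0) :
    ∃ a : Fin p → K, (∀ j, ‖a j‖ * ‖ι (T k)‖ ^ (j : ℕ) ≤ ‖ι u / ι d‖) ∧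
      ‖ι u / ι d - ∑ j, φ (a j) * ι (T k) ^ (j : ℕ)‖ ≤ ε * ‖ι u / ι d‖ := by
  set r := ‖ι (T k)‖ with hr
  have hr0 : 0 < r := hι.norm_T_pos
  have hd0 : ι d ≠ 0 := (map_ne_zero_iff _ hι.injective).2 hd
  have hdn : 0 < ‖ι d‖ := norm_pos_iff.2 hd0
  set P := powCoeff p hp.ne_zero d with hP
  set g := u * d ^ (p - 1) with hg
  have hp1 : p = (p - 1) + 1 := by have := hp.pos; omega
  have hud : ι u / ι d = ι g / ι d ^ p := by
    rw [hg, map_mul, map_pow, div_eq_div_iff hd0 (pow_ne_zero _ hd0)]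
    nth_rw 1 [hp1]
    ring
  obtain ⟨hB1, hB⟩ := hι.norm_subst (F := F) (G := P) (C := ‖ι d‖ ^ p) hε0 hε1.le hFT (fun i => by
    rw [hP, powCoeff, coeff_mk, norm_pow, ← pow_mul, mul_comm p i, pow_mul, ← mul_pow]
    exact pow_le_pow_left₀ (by positivity) (hι.norm_coeff_mul_pow_le d i) p)
  rw [hP, ← pow_prime_eq_subst hp hpk, map_pow, ← hP, ← hcomm] at hB
  have hBn : ‖φ (κ P)‖ = ‖ι d‖ ^ p := by
    refine le_antisymm (by rw [hcomm]; exact hB1) ?_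
    by_contra! hlt
    have h := IsUltrametricDist.norm_add_le_max (ι d ^ p - φ (κ P)) (φ (κ P))
    rw [sub_add_cancel, norm_pow] at h
    rcases le_max_iff.1 h with h | h
    · have : 0 < ‖ι d‖ ^ p := by positivity
      nlinarith
    · exact absurd h hlt.not_ge
  have hB0 : φ (κ P) ≠ 0 := norm_ne_zero_iff.1 (by rw [hBn]; positivity)
  have hG : ∀ j : Fin p, ‖ι (F (residuePart p hp.pos g j))‖ ≤ ‖ι g‖ / r ^ (j : ℕ) ∧
      ‖ι (subst p (residuePart p hp.pos g j)) - ι (F (residuePart p hp.pos g j))‖ ≤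
        ε * (‖ι g‖ / r ^ (j : ℕ)) := fun j =>
    hι.norm_subst (F := F) hε0 hε1.le hFT (fun i => by
      rw [residuePart, coeff_mk, le_div_iff₀ (by positivity), ← pow_mul, mul_assoc, ← pow_add]
      exact hι.norm_coeff_mul_pow_le g _)
  refine ⟨fun j => κ (residuePart p hp.pos g j) / κ P, fun j => ?_, ?_⟩
  · rw [← hφ, map_div₀, norm_div, hBn, hcomm, hud, norm_div, norm_pow, div_mul_eq_mul_div]
    gcongr
    rw [← le_div_iff₀ (by positivity)]
    exact (hG j).1
  · have hA : ‖ι g - ∑ j : Fin p, ι (F (residuePart p hp.pos g j)) * ι (T k) ^ (j : ℕ)‖ ≤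
        ε * ‖ι g‖ := by
      conv_lhs => rw [← sum_subst_residuePart hp.pos g]
      rw [map_sum, ← Finset.sum_sub_distrib, sum_subst_residuePart]
      refine IsUltrametricDist.norm_sum_le_of_forall_le_of_nonneg (by positivity) fun j _ => ?_
      rw [map_mul, map_pow, ← sub_mul, norm_mul, norm_pow, ← hr, ← le_div_iff₀ (by positivity),
        mul_div_assoc]
      exact (hG j).2
    set A' := ∑ j : Fin p, ι (F (residuePart p hp.pos g j)) * ι (T k) ^ (j : ℕ) with hA'
    have hsum : ∑ j : Fin p, φ (κ (residuePart p hp.pos g j) / κ P) * ι (T k) ^ (j : ℕ) =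
        A' / φ (κ P) := by
      rw [hA', Finset.sum_div]
      refine Finset.sum_congr rfl fun j _ => ?_
      rw [map_div₀, hcomm]
      ring
    have hdp : ι d ^ p ≠ 0 := pow_ne_zero _ hd0
    have hkey : ι g / ι d ^ p - A' / φ (κ P) =
        (ι g - A') / φ (κ P) - ι g / ι d ^ p * ((ι d ^ p - φ (κ P)) / φ (κ P)) := by
      field_simp
      ring
    rw [hsum, hud, hkey]
    refine (IsUltrametricDist.norm_sub_le_max' _ _).trans (max_le ?_ ?_)
    · rw [norm_div, hBn, norm_div, norm_pow, ← mul_div_assoc]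
      gcongr
    · rw [norm_mul, mul_comm]
      gcongr
      rw [norm_div, hBn, div_le_iff₀ (by positivity)]
      exact hB

/-- The completed fraction field of the Tate algebra is generated by the first powers of the
coordinate over the subfield given by a finite morphism close to `t ^ p`. -/
theorem IsSkeletal.exists_decomposition [CompleteSpace K] (hι : IsSkeletal ι) (hp : p.Prime)
    (hpk : (p : k) = 0) (hφ : ∀ a, ‖φ a‖ = ‖a‖) (hcomm : ∀ g, φ (κ g) = ι (F g))
    (hdense : ∀ (l : L) (ε : ℝ), 0 < ε → ∃ g h, h ≠ 0 ∧ ‖l - ι g / ι h‖ < ε) (hε0 : 0 < ε)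
    (hε1 : ε < 1) (hFT : ‖ι (T k) ^ p - ι (F (T k))‖ ≤ ε * ‖ι (T k)‖ ^ p) (l : L) :
    ∃ a : Fin p → K, ∑ j, φ (a j) * ι (T k) ^ (j : ℕ) = l ∧
      ∀ j, ‖a j‖ * ‖ι (T k)‖ ^ (j : ℕ) ≤ ‖l‖ := by
  have hr0 := hι.norm_T_pos
  have hφc : Continuous φ := (AddMonoidHomClass.isometry_of_norm φ hφ).continuous
  let S : (Fin p → K) →+ L :=
    { toFun := fun a => ∑ j, φ (a j) * ι (T k) ^ (j : ℕ)
      map_zero' := by simp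
      map_add' := fun x y => by simp [add_mul, Finset.sum_add_distrib] }
  have hSdef : ∀ a, S a = ∑ j, φ (a j) * ι (T k) ^ (j : ℕ) := fun _ => rfl
  -- The bound sought is on the terms `φ(a_j) t ^ j` and not on the `a_j`. Since `‖ι T‖ ≤ 1` and `j
  -- < p`, the constant `C = (‖ι T‖ ^ p)⁻¹` below compares the two.
  let wt : (Fin p → K) → ℝ := fun a => ‖fun j : Fin p => φ (a j) * ι (T k) ^ (j : ℕ)‖
  have hwt : ∀ (a : Fin p → K) (j : Fin p), ‖a j‖ * ‖ι (T k)‖ ^ (j : ℕ) ≤ wt a := fun a j => by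
    have := norm_le_pi_norm (fun j : Fin p => φ (a j) * ι (T k) ^ (j : ℕ)) j
    rwa [norm_mul, norm_pow, hφ] at this
  have hwt' : ∀ (a : Fin p → K) (C : ℝ), 0 ≤ C →
      (∀ j : Fin p, ‖a j‖ * ‖ι (T k)‖ ^ (j : ℕ) ≤ C) → wt a ≤ C :=
    fun a C hC h => (pi_norm_le_iff_of_nonneg hC).2 fun j => by
      rw [norm_mul, norm_pow, hφ]; exact h j
  have happrox : ∀ v, ∃ a, wt a ≤ ‖v‖ ∧ ‖v - S a‖ ≤ ε * ‖v‖ := by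
    intro v
    by_cases hv : v = 0
    · exact ⟨0, by simp [wt, hv]; rfl, by simp [hv]⟩
    have hvn : 0 < ‖v‖ := norm_pos_iff.2 hv
    obtain ⟨u, d, hd, hud⟩ := hdense v (ε * ‖v‖) (by positivity)
    have hle : ‖ι u / ι d‖ ≤ ‖v‖ := by
      have h := IsUltrametricDist.norm_sub_le_max' v (v - ι u / ι d)
      rw [sub_sub_cancel] at h
      refine h.trans (max_le le_rfl (hud.le.trans ?_))
      exact mul_le_of_le_one_left hvn.le hε1.le
    obtain ⟨a, ha1, ha2⟩ := hι.exists_approx hp hpk hφ hcomm hε0.le hε1 hFT u d hd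
    refine ⟨a, hwt' a _ hvn.le fun j => (ha1 j).trans hle, ?_⟩
    have h := IsUltrametricDist.norm_add_le_max (v - ι u / ι d) (ι u / ι d - S a)
    rw [sub_add_sub_cancel] at h
    refine h.trans (max_le hud.le (ha2.trans ?_))
    gcongr
  have hSc : Continuous S := by
    change Continuous fun a : Fin p → K => ∑ j, φ (a j) * ι (T k) ^ (j : ℕ)
    exact continuous_finsetSum _ fun j _ => (hφc.comp (continuous_apply j)).mul continuous_const
  have hwc : Continuous wt :=
    (continuous_pi fun j => (hφc.comp (continuous_apply j)).mul continuous_const).norm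
  obtain ⟨a, ha, hal⟩ := exists_preimage_of_approx S hSc wt hwc (by simp [wt]; rfl)
    (fun a b => hwt' _ _ (le_max_of_le_left (norm_nonneg _)) fun j => by
      have h := IsUltrametricDist.norm_add_le_max (a j) (b j)
      rw [Pi.add_apply]
      refine (mul_le_mul_of_nonneg_right h (by positivity)).trans ?_
      rw [max_mul_of_nonneg _ _ (by positivity)]
      exact max_le_max (hwt a j) (hwt b j))
    (C := (‖ι (T k)‖ ^ p)⁻¹) (by positivity)
    (fun a => (pi_norm_le_iff_of_nonneg (by positivity)).2 fun j => by
      rw [← div_eq_inv_mul, le_div_iff₀ (by positivity)]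
      refine le_trans ?_ (hwt a j)
      gcongr ?_ * ?_
      exact pow_le_pow_of_le_one hr0.le hι.norm_T_le j.2.le)
    hε0.le hε1 happrox l
  exact ⟨a, ha, fun j => (hwt a j).trans hal⟩

end Decomposition

end TateAlgebra

/-! ### Annihilators of Kähler differentials -/

section Kaehler

variable {A B : Type*} [CommRing A] [CommRing B] [Algebra A B]

theorem KaehlerDifferential.mem_annihilator_iff {a : B} :
    a ∈ Module.annihilator B (KaehlerDifferential A B) ↔
      ∀ b, a • KaehlerDifferential.D A B b = 0 := by
  rw [Module.mem_annihilator]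
  refine ⟨fun h b => h _, fun h m => ?_⟩
  have hm : m ∈ Submodule.span B (Set.range (KaehlerDifferential.D A B)) := by
    rw [KaehlerDifferential.span_range_derivation]; trivial
  induction hm using Submodule.span_induction with
  | mem x hx => obtain ⟨b, rfl⟩ := hx; exact h b
  | zero => exact smul_zero _
  | add x y _ _ hx hy => rw [smul_add, hx, hy, add_zero]
  | smul b x _ hx => rw [smul_comm, hx, smul_zero]

/-- Differentiating the relation leaves `n γ η ^ (n - 1) dη = 0`, and the unit `n` cancels. -/
theorem KaehlerDifferential.smul_D_eq_zero_of_binomial {p n : ℕ} (hp : (p : B) = 0)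
    (hn : IsUnit (n : B)) {x γ : A} {η : B}
    (hx : algebraMap A B x = η ^ p + algebraMap A B γ * η ^ n) :
    (algebraMap A B γ * η ^ (n - 1)) • KaehlerDifferential.D A B η = 0 := by
  have h := congrArg (KaehlerDifferential.D A B) hx
  rw [Derivation.map_algebraMap, map_add, Derivation.leibniz, Derivation.map_algebraMap, smul_zero,
    add_zero, Derivation.leibniz_pow, Derivation.leibniz_pow, ← Nat.cast_smul_eq_nsmul B, hp,
    zero_smul, zero_add, ← Nat.cast_smul_eq_nsmul B, smul_comm] at h
  rw [mul_smul]
  exact (hn.smul_eq_zero.1 h.symm)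

/-- An element of `L°` need not be a polynomial in `η` over `K°`, but becomes one after
multiplication by some `t`; the price is a factor `t` in the annihilator. -/
theorem KaehlerDifferential.smul_D_eq_zero_of_sum {m : ℕ} {t : A} {l z η : B} {a : Fin m → A}
    (h : algebraMap A B t * l = ∑ j, algebraMap A B (a j) * η ^ (j : ℕ))
    (hz : z • KaehlerDifferential.D A B η = 0) :
    (z * algebraMap A B t) • KaehlerDifferential.D A B l = 0 := by
  have h1 := congrArg (KaehlerDifferential.D A B) h
  rw [Derivation.leibniz, Derivation.map_algebraMap, smul_zero, add_zero, map_sum] at h1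
  rw [mul_smul, h1, Finset.smul_sum]
  refine Finset.sum_eq_zero fun j _ => ?_
  rw [Derivation.leibniz, Derivation.map_algebraMap, smul_zero, add_zero, Derivation.leibniz_pow,
    smul_comm z, smul_comm z, smul_comm z, hz, smul_zero, smul_zero, smul_zero]

/-- A derivation modulo a submodule gives a bound for the annihilator of the differentials. -/
theorem KaehlerDifferential.apply_mem_of_mem_annihilator {M : Type*} [AddCommGroup M] [Module B M]
    (J : Submodule B M) (D : B →+ M) (hD : ∀ a b, D (a * b) = a • D b + b • D a)
    (hDA : ∀ a : A, D (algebraMap A B a) ∈ J) {a : B}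
    (ha : a ∈ Module.annihilator B (KaehlerDifferential A B)) (b : B) : a • D b ∈ J := by
  let _ : Module A (M ⧸ J) := Module.compHom _ (algebraMap A B)
  have : IsScalarTower A B (M ⧸ J) := IsScalarTower.of_algebraMap_smul fun _ _ => rfl
  have hD1 : D 1 = 0 := by simpa using hD 1 1
  let E : Derivation A B (M ⧸ J) :=
    { toFun := fun b => J.mkQ (D b)
      map_add' := fun x y => by rw [map_add, map_add]
      map_smul' := fun r x => by
        rw [Algebra.smul_def, hD, map_add, map_smul, map_smul, J.mkQ_apply (D (algebraMap A B r)),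
          (Submodule.Quotient.mk_eq_zero J).2 (hDA r), smul_zero, add_zero]
        rfl
      map_one_eq_zero' := by
        change J.mkQ (D 1) = 0
        rw [hD1, map_zero]
      leibniz' := fun x y => by
        change J.mkQ (D (x * y)) = x • J.mkQ (D y) + y • J.mkQ (D x)
        rw [hD, map_add, map_smul, map_smul] }
  have hE : a • E b = 0 := by
    rw [← E.liftKaehlerDifferential_comp_D, ← map_smul, Module.mem_annihilator.1 ha, map_zero]
  rw [← Submodule.Quotient.mk_eq_zero]
  exact hE

end Kaehler

/-! ### The different of a binomial extension -/

namespace TateAlgebra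

set_option linter.unusedSectionVars false

variable {k : Type*} [NormedField k] [IsUltrametricDist k] [CompleteSpace k]

section Different

variable {K L : Type*} [NormedField K] [IsUltrametricDist K] [NormedField L] [IsUltrametricDist L]
  {φ : K →+* L} {κ : TateAlgebra k →+* K} {ι : TateAlgebra k →+* L}
  {F : TateAlgebra k →ₐ[k] TateAlgebra k} {p n : ℕ} {c : k}

theorem exists_forall_lt_pow_of_lt_one {M : ℝ} (hM : M < 1) (N : ℕ) :
    ∃ θ : ℝ, 0 ≤ θ ∧ θ < 1 ∧ ∀ t, θ < t → M < t ^ N := by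
  have h : Tendsto (fun t : ℝ => t ^ N) (𝓝[<] 1) (𝓝 1) := by
    have := (continuous_pow (M := ℝ) N).tendsto 1
    rw [one_pow] at this
    exact this.mono_left nhdsWithin_le_nhds
  have h1 := (h.eventually_const_lt hM).and
    ((Ioo_mem_nhdsLT (zero_lt_one' ℝ)))
  obtain ⟨θ, h2, h3⟩ := h1.exists
  refine ⟨θ, h3.1.le, h3.2, fun t ht => h2.trans_le (pow_le_pow_left₀ h3.1.le ht.le N)⟩

theorem IsSkeletal.map_binomial (hF : F (T k) = T k ^ p + c • T k ^ n) :
    ι (F (T k)) = ι (T k) ^ p + ι (algebraMap k _ c) * ι (T k) ^ n := by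
  rw [hF, Algebra.smul_def, map_add, map_mul, map_pow, map_pow]

theorem IsSkeletal.norm_map_binomial (hι : IsSkeletal ι) (hpn : p < n) (hc1 : ‖c‖ < 1)
    (hF : F (T k) = T k ^ p + c • T k ^ n) : ‖ι (F (T k))‖ = ‖ι (T k)‖ ^ p := by
  have h0 := hι.norm_T_pos
  have hlt : ‖ι (algebraMap k _ c) * ι (T k) ^ n‖ < ‖ι (T k) ^ p‖ := by
    rw [norm_mul, hι.norm_algebraMap, norm_pow, norm_pow]
    calc ‖c‖ * ‖ι (T k)‖ ^ n < 1 * ‖ι (T k)‖ ^ n := by gcongr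
      _ ≤ 1 * ‖ι (T k)‖ ^ p := by
        gcongr ?_ * ?_
        exact pow_le_pow_of_le_one h0.le hι.norm_T_le hpn.le
      _ = _ := one_mul _
  rw [map_binomial hF, IsUltrametricDist.norm_add_eq_max_of_norm_ne_norm hlt.ne',
    max_eq_left hlt.le, norm_pow]

/-- The derivation of `L` is small on `K`. -/
theorem IsSkeletal.norm_derivation_le (hι : IsSkeletal ι) (hκ : IsSkeletal κ)
    (hφ : ∀ a, ‖φ a‖ = ‖a‖) (hcomm : ∀ g, φ (κ g) = ι (F g))
    (hdense : ∀ (l : K) (ε : ℝ), 0 < ε → ∃ g h, h ≠ 0 ∧ ‖l - κ g / κ h‖ < ε)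
    {D : L →+ L} (hD : ∀ a b, D (a * b) = a * D b + b * D a) (hDι : ∀ g, D (ι g) = ι (deriv g))
    (hDn : ∀ l, ‖D l‖ * ‖ι (T k)‖ ≤ ‖l‖) (a : K) :
    ‖D (φ a)‖ * ‖κ (T k)‖ ≤ ‖ι (deriv (F (T k)))‖ * ‖a‖ := by
  have hr := hι.norm_T_pos
  have hDc : Continuous D := AddMonoidHomClass.continuous_of_bound D ‖ι (T k)‖⁻¹ fun l => by
    rw [← div_eq_inv_mul, le_div_iff₀ hr]; exact hDn l
  have hφc : Continuous φ := (AddMonoidHomClass.isometry_of_norm φ hφ).continuous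
  have hcl : IsClosed {a : K | ‖D (φ a)‖ * ‖κ (T k)‖ ≤ ‖ι (deriv (F (T k)))‖ * ‖a‖} :=
    isClosed_le ((hDc.comp hφc).norm.mul continuous_const) (continuous_const.mul continuous_norm)
  have hmem : a ∈ closure {a : K | ‖D (φ a)‖ * ‖κ (T k)‖ ≤ ‖ι (deriv (F (T k)))‖ * ‖a‖} := by
    rw [Metric.mem_closure_iff]
    intro ε hε
    obtain ⟨g, h, hh, hgh⟩ := hdense a ε hε
    refine ⟨κ g / κ h, ?_, by rwa [dist_eq_norm]⟩
    have h0 : κ h ≠ 0 := (map_ne_zero_iff _ hκ.injective).2 hh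
    have h0' : φ (κ h) ≠ 0 := (map_ne_zero_iff _ φ.injective).2 h0
    have hDF : ∀ g, D (φ (κ g)) = φ (κ (deriv g)) * ι (deriv (F (T k))) := fun g => by
      rw [hcomm, hDι, deriv_algHom, map_mul, ← hcomm]
    have h1 : φ (κ g / κ h) * φ (κ h) = φ (κ g) := by rw [← map_mul, div_mul_cancel₀ _ h0]
    have h2 := congrArg D h1
    rw [hD, hDF, hDF] at h2
    have h3 : D (φ (κ g / κ h)) = ι (deriv (F (T k))) *
        φ ((κ (deriv g) - κ g / κ h * κ (deriv h)) / κ h) := by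
      rw [map_div₀ φ (_ - _), map_sub, map_mul φ (_ / _), mul_div_assoc', eq_div_iff h0']
      linear_combination h2
    rw [Set.mem_ofPred_eq, h3, norm_mul, hφ, mul_assoc]
    gcongr
    exact hκ.norm_quotient_rule_le g h hh
  exact hcl.closure_subset hmem

/-- With `h = F T`, the derivation `d/dt` maps `K°` into the ball `J` of radius `ρ = ‖h'‖ / ‖h‖`. So
an annihilating `a` satisfies `‖a D v‖ ≤ ρ` for `v` in `L°`. For `v = b t` this reads `‖a‖ ‖b‖ ≤ ρ`,
and `‖b‖` may approach `1 / r`, which gives `‖a‖ ≤ ρ r`. -/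
theorem IsSkeletal.norm_le_of_mem_annihilator [IsAlgClosed k] [CompleteSpace L]
    (hι : IsSkeletal ι)
    (hF0 : coeff 0 (F (T k)) = 0) (hφ : ∀ a, ‖φ a‖ = ‖a‖) (hcomm : ∀ g, φ (κ g) = ι (F g))
    (hdense : ∀ (l : L) (ε : ℝ), 0 < ε → ∃ g h, h ≠ 0 ∧ ‖l - ι g / ι h‖ < ε)
    (hdense' : ∀ (l : K) (ε : ℝ), 0 < ε → ∃ g h, h ≠ 0 ∧ ‖l - κ g / κ h‖ < ε)
    (hpk : (p : k) = 0) (hpn : p < n) (hn : ‖(n : k)‖ = 1) (hc0 : 0 < ‖c‖) (hc1 : ‖c‖ < 1)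
    (hF : F (T k) = T k ^ p + c • T k ^ n) {a : normIntegers L}
    (ha : letI : Algebra (normIntegers K) (normIntegers L) := (normIntegersMap φ hφ).toAlgebra
      a ∈ Module.annihilator (normIntegers L)
        (KaehlerDifferential (normIntegers K) (normIntegers L))) :
    ‖(a : L)‖ ≤ ‖c‖ * ‖ι (T k)‖ ^ (n - p) := by
  let _ : Algebra (normIntegers K) (normIntegers L) := (normIntegersMap φ hφ).toAlgebra
  set r := ‖ι (T k)‖ with hr
  have hr0 : 0 < r := hι.norm_T_pos
  have hFT0 : F (T k) ≠ 0 := by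
    intro h
    have := hι.norm_map_binomial hpn hc1 hF
    rw [h, map_zero, norm_zero] at this
    exact (pow_pos hr0 p).ne this
  have hκ := hι.of_comp hφ hcomm hF0 hFT0
  obtain ⟨D, hD, hDι, hDn⟩ := hι.exists_derivation hdense
  have hκT : ‖κ (T k)‖ = r ^ p := by
    rw [← hφ, hcomm, hι.norm_map_binomial hpn hc1 hF]
  have hder : ‖ι (deriv (F (T k)))‖ = ‖c‖ * r ^ (n - 1) := by
    have : deriv (F (T k)) = algebraMap k _ (n * c) * T k ^ (n - 1) := by
      rw [hF, map_add, Derivation.map_smul, Derivation.leibniz_pow, Derivation.leibniz_pow, deriv_T,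
        ← Nat.cast_smul_eq_nsmul k p, hpk, zero_smul, zero_add, ← Nat.cast_smul_eq_nsmul k n,
        smul_smul, Algebra.smul_def, mul_comm c, smul_eq_mul, mul_one]
    rw [this, map_mul, norm_mul, hι.norm_algebraMap, norm_mul, hn, one_mul, map_pow, norm_pow]
  set ρ := ‖c‖ * r ^ (n - 1) / r ^ p with hρ
  have hρ0 : 0 ≤ ρ := by positivity
  let J : Submodule (normIntegers L) L :=
    { carrier := {v | ‖v‖ ≤ ρ}
      add_mem' := fun {x y} hx hy => (IsUltrametricDist.norm_add_le_max x y).trans (max_le hx hy)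
      zero_mem' := by simpa using hρ0
      smul_mem' := fun b x hx => by
        change ‖(b : L) * x‖ ≤ ρ
        rw [norm_mul]
        exact (mul_le_of_le_one_left (norm_nonneg _) b.2).trans hx }
  have key : ∀ b : k, ‖b‖ < 1 / r → ‖(a : L)‖ * ‖b‖ ≤ ρ := by
    intro b hb
    have hbT : ‖ι (algebraMap k _ b) * ι (T k)‖ ≤ 1 := by
      rw [norm_mul, hι.norm_algebraMap]
      rw [lt_div_iff₀ hr0] at hb
      exact hb.le
    have h := KaehlerDifferential.apply_mem_of_mem_annihilator (A := normIntegers K) J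
      (D.comp (normIntegers L).subtype.toAddMonoidHom) (fun x y => hD x y)
      (fun x => by
        change ‖D (φ x)‖ ≤ ρ
        rw [hρ, le_div_iff₀ (by positivity), ← hκT, ← hder]
        refine (hι.norm_derivation_le hκ hφ hcomm hdense' hD hDι hDn x).trans ?_
        exact mul_le_of_le_one_right (norm_nonneg _) x.2) ha ⟨_, hbT⟩
    have h' : ‖(a : L) * D (ι (algebraMap k _ b) * ι (T k))‖ ≤ ρ := h
    rwa [← map_mul, hDι, Derivation.leibniz, deriv_T, Derivation.map_algebraMap, smul_zero, add_zero,
      smul_eq_mul, mul_one, norm_mul, hι.norm_algebraMap] at h'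
  have hρr : ρ * r = ‖c‖ * r ^ (n - p) := by
    have : r ^ (n - 1) * r = r ^ (n - p) * r ^ p := by
      rw [← pow_succ, ← pow_add]; congr 1; omega
    rw [hρ, div_mul_eq_mul_div, mul_assoc, this]
    field_simp
  rw [← hρr]
  by_contra! hlt
  have ha0 : 0 < ‖(a : L)‖ := (by positivity : (0 : ℝ) ≤ ρ * r).trans_lt hlt
  obtain ⟨b, hb1, hb2⟩ := exists_lt_norm_lt hc0 hc1 (α := ρ / ‖(a : L)‖) (β := 1 / r)
    (by positivity) (by rwa [div_lt_div_iff₀ ha0 hr0, one_mul])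
  have := key b hb2
  rw [div_lt_iff₀ ha0, mul_comm] at hb1
  exact absurd this hb1.not_ge

/-- Rescale the coordinate to `η` of norm `θ` slightly below 1. The binomial relation yields `z` of
norm `δ θ ^ (p - 1)` that kills `dη`, and multiplication by an element of norm `θ ^ p` brings `L°`
into `K°[η]`. So every `a` with `‖a‖ ≤ δ θ ^ (2 p - 1)` annihilates, and `θ` may be as close to 1 as
needed. -/
theorem IsSkeletal.mem_annihilator_of_norm_lt [IsAlgClosed k] [CompleteSpace K]
    (hι : IsSkeletal ι) (hp : p.Prime)
    (hφ : ∀ a, ‖φ a‖ = ‖a‖) (hcomm : ∀ g, φ (κ g) = ι (F g))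
    (hdense : ∀ (l : L) (ε : ℝ), 0 < ε → ∃ g h, h ≠ 0 ∧ ‖l - ι g / ι h‖ < ε)
    (hpk : (p : k) = 0) (hpn : p < n) (hn : ‖(n : k)‖ = 1) (hc0 : 0 < ‖c‖) (hc1 : ‖c‖ < 1)
    (hF : F (T k) = T k ^ p + c • T k ^ n) {a : normIntegers L}
    (ha : ‖(a : L)‖ < ‖c‖ * ‖ι (T k)‖ ^ (n - p)) :
    letI : Algebra (normIntegers K) (normIntegers L) := (normIntegersMap φ hφ).toAlgebra
    a ∈ Module.annihilator (normIntegers L)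
      (KaehlerDifferential (normIntegers K) (normIntegers L)) := by
  let _ : Algebra (normIntegers K) (normIntegers L) := (normIntegersMap φ hφ).toAlgebra
  set r := ‖ι (T k)‖ with hr
  have hr0 : 0 < r := hι.norm_T_pos
  have hr1 : r ≤ 1 := hι.norm_T_le
  set δ := ‖c‖ * r ^ (n - p) with hδ
  have hδ0 : 0 < δ := by positivity
  have hrn : r ^ n = r ^ (n - p) * r ^ p := by rw [← pow_add]; congr 1; omega
  have hφk : ∀ b : k, φ (κ (algebraMap k _ b)) = ι (algebraMap k _ b) := fun b => by
    rw [hcomm, AlgHom.commutes]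
  have hκk : ∀ b : k, ‖κ (algebraMap k _ b)‖ = ‖b‖ := fun b => by
    rw [← hφ, hφk, hι.norm_algebraMap]
  have hδ1 : δ < 1 := (mul_le_of_le_one_right (norm_nonneg _)
    (pow_le_one₀ hr0.le hr1)).trans_lt hc1
  -- One exponent serves two purposes: `2 p + n` exceeds `2 p - 1`, needed to divide `a`, and `n -
  -- p`, needed to make `γ` integral.
  obtain ⟨θ₀, hθ₀0, hθ₀1, hθ₀⟩ := exists_forall_lt_pow_of_lt_one (M := max (‖(a : L)‖ / δ) ‖c‖)
    (max_lt ((div_lt_one hδ0).2 ha) hc1) (2 * p + n)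
  obtain ⟨b, hb1, hb2⟩ := exists_lt_norm_lt hc0 hc1 (α := θ₀ / r) (β := 1 / r)
    (by positivity) (by gcongr)
  set θ := ‖b‖ * r with hθ
  have hθ1 : θ < 1 := by rwa [lt_div_iff₀ hr0] at hb2
  have hθθ : θ₀ < θ := by rwa [div_lt_iff₀ hr0] at hb1
  have hθ0 : 0 < θ := hθ₀0.trans_lt hθθ
  have hb0 : 0 < ‖b‖ := pos_of_mul_pos_left hθ0 hr0.le
  have hb0' : b ≠ 0 := norm_pos_iff.1 hb0
  have hθN := hθ₀ θ hθθ
  have hθa : ‖(a : L)‖ ≤ δ * θ ^ (2 * p - 1) := by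
    have h1 : ‖(a : L)‖ / δ ≤ θ ^ (2 * p - 1) := (le_max_left _ _).trans (hθN.le.trans
      (pow_le_pow_of_le_one hθ0.le hθ1.le (by omega)))
    rwa [div_le_iff₀ hδ0, mul_comm] at h1
  have hθc : ‖c‖ ≤ ‖b‖ ^ (n - p) := by
    have h1 : ‖c‖ ≤ θ ^ (n - p) := (le_max_right _ _).trans (hθN.le.trans
      (pow_le_pow_of_le_one hθ0.le hθ1.le (by omega)))
    refine h1.trans (pow_le_pow_left₀ hθ0.le ?_ _)
    exact mul_le_of_le_one_right hb0.le hr1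
  have hFn := hι.norm_map_binomial hpn hc1 hF
  have hbin := map_binomial (ι := ι) hF
  set β := ι (algebraMap k _ b) with hβ
  have hβn : ‖β‖ = ‖b‖ := hι.norm_algebraMap b
  have hβ0 : β ≠ 0 := norm_pos_iff.1 (hβn ▸ hb0)
  let η : normIntegers L := ⟨β * ι (T k), by
    change ‖β * ι (T k)‖ ≤ 1
    rw [norm_mul, hβn]; exact hθ1.le⟩
  have hηc : (η : L) = β * ι (T k) := rfl
  have htn : ‖κ (algebraMap k _ b) ^ p * κ (T k)‖ = θ ^ p := by
    rw [norm_mul, norm_pow, hκk, ← hφ (κ (T k)), hcomm, hFn, ← mul_pow]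
  let t : normIntegers K := ⟨κ (algebraMap k _ b) ^ p * κ (T k), by
    change ‖_‖ ≤ (1 : ℝ)
    rw [htn]; exact pow_le_one₀ hθ0.le hθ1.le⟩
  have htc : (t : K) = κ (algebraMap k _ b) ^ p * κ (T k) := rfl
  have hγn : ‖κ (algebraMap k _ (c * (b⁻¹) ^ (n - p)))‖ = ‖c‖ / ‖b‖ ^ (n - p) := by
    rw [hκk, norm_mul, norm_pow, norm_inv, inv_pow]; rfl
  -- Multiplying `x = y ^ p + c y ^ n` by `b ^ p` gives `b ^ p x = η ^ p + γ η ^ n` for `η = b y`.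
  let γ : normIntegers K := ⟨κ (algebraMap k _ (c * (b⁻¹) ^ (n - p))), by
    change ‖_‖ ≤ (1 : ℝ)
    rw [hγn]
    exact div_le_one_of_le₀ hθc (by positivity)⟩
  have hγc : (γ : K) = κ (algebraMap k _ (c * (b⁻¹) ^ (n - p))) := rfl
  have hcast : ∀ m : ℕ, ((m : normIntegers L) : L) = ι (algebraMap k _ (m : k)) := fun m => by
    simp
  have hpL : (p : normIntegers L) = 0 := by
    apply Subtype.ext
    rw [hcast, hpk, map_zero, map_zero]; rfl
  have hn0 : (n : k) ≠ 0 := norm_ne_zero_iff.1 (by rw [hn]; exact one_ne_zero)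
  have hnL : IsUnit (n : normIntegers L) := by
    refine IsUnit.of_mul_eq_one ⟨ι (algebraMap k _ ((n : k)⁻¹)), ?_⟩ (Subtype.ext ?_)
    · change ‖_‖ ≤ (1 : ℝ)
      rw [hι.norm_algebraMap, norm_inv, hn, inv_one]
    · change ((n : normIntegers L) : L) * _ = 1
      rw [hcast, ← map_mul, ← map_mul, mul_inv_cancel₀ hn0, map_one, map_one]
  have hx : algebraMap (normIntegers K) (normIntegers L) t =
      η ^ p + algebraMap (normIntegers K) (normIntegers L) γ * η ^ n := by
    apply Subtype.ext
    change φ t = (η : L) ^ p + φ γ * (η : L) ^ n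
    have hβinv : ι (algebraMap k _ b⁻¹) = β⁻¹ := by
      refine eq_inv_of_mul_eq_one_left ?_
      rw [hβ, ← map_mul, ← map_mul, inv_mul_cancel₀ hb0', map_one,
        map_one]
    have hβpow : β ^ n = β ^ (n - p) * β ^ p := by rw [← pow_add]; congr 1; omega
    rw [htc, hγc, hηc, hφk, map_mul, map_pow, hφk, hcomm, hbin, ← hβ, map_mul, map_mul, map_pow,
      map_pow, hβinv, mul_pow, mul_pow, hβpow, inv_pow]
    field_simp
  have hz := KaehlerDifferential.smul_D_eq_zero_of_binomial hpL hnL hx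
  set z := algebraMap (normIntegers K) (normIntegers L) γ * η ^ (n - 1) with hzdef
  have hzn : ‖(z : L)‖ * θ ^ p = δ * θ ^ (2 * p - 1) := by
    have h1 : (z : L) = φ γ * (η : L) ^ (n - 1) := rfl
    rw [h1, norm_mul, hφ, hγc, hγn, norm_pow, hηc, norm_mul, hβn, ← hr, ← hθ]
    have h2 : δ * ‖b‖ ^ (n - p) = ‖c‖ * θ ^ (n - p) := by rw [hδ, hθ, mul_pow]; ring
    have h3 : θ ^ (n - 1) * θ ^ p = θ ^ (n - p) * θ ^ (2 * p - 1) := by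
      rw [← pow_add, ← pow_add]; congr 1; have := hp.pos; omega
    have h4 : (0 : ℝ) < ‖b‖ ^ (n - p) := by positivity
    rw [mul_assoc, h3, div_mul_eq_mul_div, div_eq_iff h4.ne']
    linear_combination (-θ ^ (2 * p - 1)) * h2
  have hτn : ‖((z * algebraMap (normIntegers K) (normIntegers L) t : normIntegers L) : L)‖ =
      δ * θ ^ (2 * p - 1) := by
    change ‖(z : L) * φ t‖ = _
    rw [norm_mul, hφ, htc, htn, hzn]
  have hτ0 : ((z * algebraMap (normIntegers K) (normIntegers L) t : normIntegers L) : L) ≠ 0 :=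
    norm_pos_iff.1 (by rw [hτn]; positivity)
  set τ := z * algebraMap (normIntegers K) (normIntegers L) t with hτ
  let e : normIntegers L := ⟨a / τ, by
    change ‖(a : L) / τ‖ ≤ 1
    rw [norm_div, hτn]
    exact div_le_one_of_le₀ hθa (by positivity)⟩
  have hae : a = e * τ := Subtype.ext (div_mul_cancel₀ _ hτ0).symm
  rw [KaehlerDifferential.mem_annihilator_iff]
  intro l
  -- `F T` and `T ^ p` differ in norm by `‖c‖ r ^ n = δ r ^ p`, so the relative error of the
  -- decomposition is `δ` itself.
  obtain ⟨s, hs, hsn⟩ := hι.exists_decomposition hp hpk hφ hcomm hdense hδ0 hδ1 (by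
    rw [hbin, sub_add_cancel_left, norm_neg, norm_mul, hι.norm_algebraMap, norm_pow, ← hr, hrn, hδ]
    exact le_of_eq (by ring)) (l : L)
  have hl1 : ‖(l : L)‖ ≤ 1 := l.2
  have hsmall : ∀ j : Fin p, ‖(t : K) * s j * κ (algebraMap k _ b⁻¹) ^ (j : ℕ)‖ ≤ 1 := fun j => by
    have h1 : ‖s j‖ * r ^ (j : ℕ) ≤ 1 := (hsn j).trans hl1
    rw [norm_mul, norm_mul, htc, htn, norm_pow, hκk, norm_inv, inv_pow, ← div_eq_mul_inv]
    refine div_le_one_of_le₀ ?_ (by positivity)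
    refine le_of_mul_le_mul_right ?_ (pow_pos hr0 j)
    calc θ ^ p * ‖s j‖ * r ^ (j : ℕ) = θ ^ p * (‖s j‖ * r ^ (j : ℕ)) := by ring
      _ ≤ θ ^ p * 1 := by gcongr
      _ ≤ θ ^ (j : ℕ) := by
        rw [mul_one]; exact pow_le_pow_of_le_one hθ0.le hθ1.le j.2.le
      _ = ‖b‖ ^ (j : ℕ) * r ^ (j : ℕ) := by rw [← mul_pow]
  have hsum : algebraMap (normIntegers K) (normIntegers L) t * l = ∑ j : Fin p,
      algebraMap (normIntegers K) (normIntegers L) ⟨_, hsmall j⟩ * η ^ (j : ℕ) := by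
    apply Subtype.ext
    rw [AddSubmonoidClass.coe_finsetSum]
    change φ t * (l : L) = ∑ j : Fin p, φ ((t : K) * s j * κ (algebraMap k _ b⁻¹) ^ (j : ℕ)) *
      (η : L) ^ (j : ℕ)
    rw [← hs, Finset.mul_sum]
    refine Finset.sum_congr rfl fun j _ => ?_
    have h1 : ι (algebraMap k _ b⁻¹) * β = 1 := by
      rw [hβ, ← map_mul, ← map_mul, inv_mul_cancel₀ hb0', map_one, map_one]
    rw [map_mul φ ((t : K) * s j), map_mul φ (t : K), map_pow, hφk, hηc, mul_pow]
    have h2 : ι (algebraMap k _ b⁻¹) ^ (j : ℕ) * β ^ (j : ℕ) = 1 := by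
      rw [← mul_pow, h1, one_pow]
    linear_combination (-φ t * φ (s j) * ι (T k) ^ (j : ℕ)) * h2
  rw [hae, mul_smul, KaehlerDifferential.smul_D_eq_zero_of_sum hsum hz, smul_zero]

/-- The different of a binomial extension. -/
theorem IsSkeletal.fieldDifferent_eq [IsAlgClosed k] [CompleteSpace K] [CompleteSpace L]
    (hι : IsSkeletal ι) (hp : p.Prime) (hF0 : coeff 0 (F (T k)) = 0)
    (hφ : ∀ a, ‖φ a‖ = ‖a‖) (hcomm : ∀ g, φ (κ g) = ι (F g))
    (hdense : ∀ (l : L) (ε : ℝ), 0 < ε → ∃ g h, h ≠ 0 ∧ ‖l - ι g / ι h‖ < ε)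
    (hdense' : ∀ (l : K) (ε : ℝ), 0 < ε → ∃ g h, h ≠ 0 ∧ ‖l - κ g / κ h‖ < ε)
    (hpk : (p : k) = 0) (hpn : p < n) (hn : ‖(n : k)‖ = 1) (hc0 : 0 < ‖c‖) (hc1 : ‖c‖ < 1)
    (hF : F (T k) = T k ^ p + c • T k ^ n) :
    fieldDifferent φ hφ = ‖c‖ * ‖ι (T k)‖ ^ (n - p) := by
  have hr0 := hι.norm_T_pos
  have hδ0 : 0 < ‖c‖ * ‖ι (T k)‖ ^ (n - p) := by positivity
  have hδ1 : ‖c‖ * ‖ι (T k)‖ ^ (n - p) ≤ 1 := mul_le_one₀ hc1.le (by positivity)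
    (pow_le_one₀ hr0.le hι.norm_T_le)
  have hmem : ∀ b : k, ‖b‖ < ‖c‖ * ‖ι (T k)‖ ^ (n - p) →
      ∃ a : normIntegers L, ‖(a : L)‖ = ‖b‖ ∧
      letI : Algebra (normIntegers K) (normIntegers L) := (normIntegersMap φ hφ).toAlgebra
      a ∈ Module.annihilator (normIntegers L)
        (KaehlerDifferential (normIntegers K) (normIntegers L)) := fun b hb => by
    have h1 : ‖ι (algebraMap k _ b)‖ = ‖b‖ := hι.norm_algebraMap b
    refine ⟨⟨ι (algebraMap k _ b), ?_⟩, h1, ?_⟩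
    · change ‖_‖ ≤ (1 : ℝ)
      rw [h1]; exact hb.le.trans hδ1
    · exact hι.mem_annihilator_of_norm_lt hp hφ hcomm hdense hpk hpn hn hc0 hc1 hF
        (h1.trans_lt hb)
  unfold fieldDifferent
  refine csSup_eq_of_forall_le_of_forall_lt_exists_gt ?_ ?_ ?_
  · obtain ⟨a, -, ha⟩ := hmem 0 (by rwa [norm_zero])
    exact ⟨_, a, ha, rfl⟩
  · rintro _ ⟨a, ha, rfl⟩
    exact hι.norm_le_of_mem_annihilator hF0 hφ hcomm hdense hdense' hpk hpn hn hc0 hc1 hF ha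
  · intro s hs
    obtain ⟨b, hb1, hb2⟩ := exists_lt_norm_lt hc0 hc1 (α := max s 0) (le_max_right _ _)
      (max_lt hs hδ0)
    obtain ⟨a, han, ha⟩ := hmem b hb2
    exact ⟨_, ⟨a, ha, rfl⟩, by rw [han]; exact (le_max_left _ _).trans_lt hb1⟩

end Different

end TateAlgebra

/-! ### Fractions of functions are dense in completed residue fields -/

section ResidueField

variable {A B : Type*} [CommRing A] [CommRing B]

/-- The value of a function at a point. -/
noncomputable def toCompletedResidueField (z : Valuation A ℝ≥0) : A →+* CompletedResidueField z :=
  UniformSpace.Completion.coeRingHom.comp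
    ((WithAbs.equiv (residueAbs z)).symm.toRingHom.comp (algebraMap A z.supp.ResidueField))

theorem norm_toCompletedResidueField (z : Valuation A ℝ≥0) (a : A) :
    ‖toCompletedResidueField z a‖ = z a := by
  rw [← residueValuation_algebraMap]
  exact UniformSpace.Completion.norm_coe _

theorem completedResidueMap_toCompletedResidueField (f : B →+* A) (z : Valuation A ℝ≥0) (b : B) :
    completedResidueMap f z (toCompletedResidueField (z.comap f) b) =
      toCompletedResidueField z (f b) := by
  change completedResidueMap f z (UniformSpace.Completion.coe' _) = UniformSpace.Completion.coe' _
  rw [completedResidueMap, UniformSpace.Completion.mapRingHom_coe]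
  congr 1
  change (WithAbs.equiv (residueAbs z)).symm (residueMap f z (algebraMap B _ b)) =
    (WithAbs.equiv (residueAbs z)).symm (algebraMap A _ (f b))
  rw [residueMap, Ideal.ResidueField.map_algebraMap]

theorem exists_norm_sub_div_lt (z : Valuation A ℝ≥0) (l : CompletedResidueField z) {ε : ℝ}
    (hε : 0 < ε) : ∃ g h : A, h ≠ 0 ∧
      ‖l - toCompletedResidueField z g / toCompletedResidueField z h‖ < ε := by
  obtain ⟨q, hq⟩ := Metric.mem_closure_range_iff.1
    (UniformSpace.Completion.denseRange_coe (α := WithAbs (residueAbs z)) l) ε hε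
  obtain ⟨x, y, hy, hxy⟩ := IsFractionRing.div_surjective (A ⧸ z.supp) q.ofAbs
  obtain ⟨g, rfl⟩ := Ideal.Quotient.mk_surjective x
  obtain ⟨h, rfl⟩ := Ideal.Quotient.mk_surjective y
  refine ⟨g, h, ?_, ?_⟩
  · rintro rfl
    exact nonZeroDivisors.ne_zero hy (map_zero _)
  · have hq' : (q : CompletedResidueField z) =
        toCompletedResidueField z g / toCompletedResidueField z h := by
      have h1 : q = (WithAbs.equiv (residueAbs z)).symm (algebraMap A z.supp.ResidueField g) /
          (WithAbs.equiv (residueAbs z)).symm (algebraMap A z.supp.ResidueField h) := by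
        rw [← map_div₀, RingEquiv.eq_symm_apply]
        exact hxy.symm
      rw [h1]
      exact map_div₀ UniformSpace.Completion.coeRingHom _ _
    rwa [← hq', ← dist_eq_norm]

theorem exists_norm_sub_comp_div_lt (e : B ≃+* A) (z : Valuation A ℝ≥0)
    (l : CompletedResidueField z) {ε : ℝ} (hε : 0 < ε) : ∃ g h : B, h ≠ 0 ∧
      ‖l - toCompletedResidueField z (e g) / toCompletedResidueField z (e h)‖ < ε := by
  obtain ⟨g, h, hh, hgh⟩ := exists_norm_sub_div_lt z l hε
  refine ⟨e.symm g, e.symm h, (map_ne_zero_iff _ e.symm.injective).2 hh, ?_⟩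
  rwa [e.apply_symm_apply, e.apply_symm_apply]

end ResidueField

/-! ### The skeleton in a monic coordinate, and the different along it -/

namespace PointedDisc

open TateAlgebra

set_option linter.unusedSectionVars false

variable {k : Type u} [NormedField k] [IsUltrametricDist k] [CompleteSpace k]

section Skeleton

variable {D : PointedDisc.{u, v} k} {e : TateAlgebra k ≃ₐ[k] D.ring}

theorem coe_originVal (he : D.origin (e (T k)) = 0) (a : D.ring) :
    (D.originVal a : ℝ) = ‖coeff 0 (e.symm a)‖ := by
  rw [← origin_eq he]
  rfl

theorem Point.val_le_norm (z : D.Point) (e : TateAlgebra k ≃ₐ[k] D.ring) (g : TateAlgebra k) :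
    (z.val (e g) : ℝ) ≤ ‖g‖ := by
  have h := z.val_le e.symm (e g)
  rw [AlgEquiv.symm_apply_apply] at h
  exact h

/-- If `z` killed the coordinate, it would be bounded by the constant term, which is the seminorm of
the origin. -/
theorem Point.val_ne_zero {z : D.Point} (hz : z ∈ D.puncturedSkeleton)
    (he : D.origin (e (T k)) = 0) : z.val (e (T k)) ≠ 0 := by
  intro h0
  refine hz.2 (Valuation.ext fun a => le_antisymm ?_ (hz.1 a))
  obtain ⟨g, hg, -⟩ := exists_eq_add_T_mul (e.symm a)
  have ha : a = algebraMap k _ (coeff 0 (e.symm a)) + e (T k) * e g := by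
    have := congrArg e hg
    simpa using this
  have h1 : z.val a ≤ ‖coeff 0 (e.symm a)‖₊ := by
    conv_lhs => rw [ha]
    refine (z.val.map_add _ _).trans (max_le ?_ ?_)
    · rw [z.val_algebraMap]
    · rw [map_mul, h0, zero_mul]; exact zero_le
  rw [← NNReal.coe_le_coe, coe_originVal he]
  exact h1

theorem isSkeletal_of_mem_puncturedSkeleton {z : D.Point} (hz : z ∈ D.puncturedSkeleton)
    (he : D.origin (e (T k)) = 0) :
    IsSkeletal ((toCompletedResidueField z.val).comp (e : TateAlgebra k →+* D.ring)) where
  norm_algebraMap a := by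
    change ‖toCompletedResidueField z.val (e (algebraMap k _ a))‖ = _
    rw [norm_toCompletedResidueField, AlgEquiv.commutes, z.val_algebraMap]
    rfl
  norm_le g := (norm_toCompletedResidueField z.val (e g)).trans_le (z.val_le_norm e g)
  norm_coeff_zero_le g := by
    change _ ≤ ‖toCompletedResidueField z.val (e g)‖
    rw [norm_toCompletedResidueField]
    have := NNReal.coe_le_coe.2 (hz.1 (e g))
    rwa [coe_originVal he, AlgEquiv.symm_apply_apply] at this
  map_T_ne_zero h := by
    have h1 : ‖toCompletedResidueField z.val (e (T k))‖ = 0 := by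
      rw [norm_eq_zero]; exact h
    rw [norm_toCompletedResidueField] at h1
    exact Point.val_ne_zero hz he (by exact_mod_cast h1)

/-- `y` vanishes at the origin, so it is `y'` times a function of Gauss norm at most 1. -/
theorem Point.val_le_of_isMonicCoordinate (z : D.Point) {y y' : D.ring}
    (hy : D.IsMonicCoordinate y) (hy' : D.IsMonicCoordinate y') : z.val y ≤ z.val y' := by
  obtain ⟨hy0, e', he'⟩ := hy
  obtain ⟨he, e, rfl⟩ := hy'
  obtain ⟨h, hh, hhn⟩ := exists_eq_add_T_mul (e.symm y)
  rw [← origin_eq he, hy0, map_zero, zero_add] at hh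
  have h1 : y = e (T k) * e h := by
    have := congrArg e hh
    simpa using this
  have h2 : ‖h‖ ≤ 1 := by
    refine hhn.trans ?_
    rw [← he']
    simpa using norm_algHom_le ((e.symm : D.ring →ₐ[k] TateAlgebra k).comp
      (e' : TateAlgebra k →ₐ[k] D.ring)) (T k)
  have h3 : z.val (e h) ≤ 1 := by
    rw [← NNReal.coe_le_coe]
    exact (z.val_le_norm e h).trans h2
  rw [h1, map_mul]
  exact mul_le_of_le_one_right zero_le h3

/-- The identification of the skeleton with an interval does not depend on the coordinate. -/
theorem Point.val_eq_of_isMonicCoordinate (z : D.Point) {y y' : D.ring}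
    (hy : D.IsMonicCoordinate y) (hy' : D.IsMonicCoordinate y') : z.val y = z.val y' :=
  le_antisymm (z.val_le_of_isMonicCoordinate hy hy') (z.val_le_of_isMonicCoordinate hy' hy)

/-- The Gauss norm as a valuation. -/
noncomputable def _root_.TateAlgebra.normValuation : Valuation (TateAlgebra k) ℝ≥0 where
  toFun g := ‖g‖₊
  map_zero' := nnnorm_zero
  map_one' := nnnorm_one
  map_mul' := nnnorm_mul
  map_add_le_max' := IsUltrametricDist.norm_add_le_max

/-- There are points of any radius in the value group on the skeleton. -/
theorem exists_mem_puncturedSkeleton {y : D.ring} (hy : D.IsMonicCoordinate y) {ρ : k}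
    (hρ0 : 0 < ‖ρ‖) (hρ1 : ‖ρ‖ ≤ 1) : ∃ z ∈ D.puncturedSkeleton, (z.val y : ℝ) = ‖ρ‖ := by
  obtain ⟨he, e, rfl⟩ := hy
  have hρT : ‖ρ • T k‖ ≤ 1 := by rwa [norm_smul, norm_T, mul_one]
  -- The point of radius `‖ρ‖` is the Gauss norm pulled back along `t ↦ ρ t`.
  let E : D.ring →ₐ[k] TateAlgebra k :=
    (eval (ρ • T k) hρT).comp (e.symm : D.ring →ₐ[k] TateAlgebra k)
  have hET : E (e (T k)) = ρ • T k := by simp [E]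
  let z : D.Point :=
    { val := normValuation.comap (E : D.ring →+* TateAlgebra k)
      val_algebraMap := fun c => by
        change ‖E (algebraMap k _ c)‖₊ = _
        rw [AlgHom.commutes, nnnorm_algebraMap']
      val_le := fun e' a => by
        have h := norm_algHom_le (E.comp (e'.symm : TateAlgebra k →ₐ[k] D.ring)) (e' a)
        change ‖E (e'.symm (e' a))‖ ≤ _ at h
        rwa [AlgEquiv.symm_apply_apply] at h }
  have hzval : ∀ a, (z.val a : ℝ) = ‖E a‖ := fun _ => rfl
  have hzT : (z.val (e (T k)) : ℝ) = ‖ρ‖ := by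
    rw [hzval, hET, norm_smul, norm_T, mul_one]
  refine ⟨z, ⟨fun a => ?_, fun h => ?_⟩, hzT⟩
  · rw [← NNReal.coe_le_coe, coe_originVal he, hzval]
    have h1 : coeff 0 (eval (ρ • T k) hρT (e.symm a)) = coeff 0 (e.symm a) :=
      coeff_zero_algHom (by rw [eval_T, map_smul, coeff_T, if_neg zero_ne_one, smul_zero]) _
    rw [← h1]
    exact norm_coeff_le _ 0
  · rw [h, coe_originVal he, AlgEquiv.symm_apply_apply, coeff_T, if_neg zero_ne_one,
      norm_zero] at hzT
    exact hρ0.ne hzT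

end Skeleton

section Cover

variable {Y : PointedDisc.{u, v} k} {X : PointedDisc.{u, w} k} {f : X.ring →ₐ[k] Y.ring}

/-- The different function of a binomial étale cover. -/
theorem IsEtaleCover.different_eq [IsAlgClosed k] {p : ℕ} (hp : p.Prime) (hres : ‖(p : k)‖ < 1)
    [CharP k p] (hf : IsEtaleCover f p) {x : X.ring} {y : Y.ring} {c : k} {n : ℕ}
    (hx : X.IsMonicCoordinate x) (hy : Y.IsMonicCoordinate y)
    (h : f x = y ^ p + algebraMap k Y.ring c * y ^ n) {z : Y.Point}
    (hz : z ∈ Y.puncturedSkeleton) :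
    different (f : X.ring →+* Y.ring) z.val = ‖c‖ * (z.val y : ℝ) ^ (n - p) := by
  obtain ⟨hpn, hndvd, hc0, hc1⟩ := hf.of_presentation hp hx hy h
  obtain ⟨hx0, eX, rfl⟩ := hx
  obtain ⟨hy0, eY, rfl⟩ := hy
  have hF : inCoordinates f eX eY (T k) = T k ^ p + c • T k ^ n := by
    rw [inCoordinates_apply, h, Algebra.smul_def]
    simp
  have key := (isSkeletal_of_mem_puncturedSkeleton hz hy0).fieldDifferent_eq
    (φ := completedResidueMap (f : X.ring →+* Y.ring) z.val)
    (κ := (toCompletedResidueField (z.val.comap (f : X.ring →+* Y.ring))).comp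
      (eX : TateAlgebra k →+* X.ring))
    (F := inCoordinates f eX eY) hp (hf.coeff_zero hx0 hy0)
    (norm_completedResidueMap (f : X.ring →+* Y.ring) z.val) (fun g => by
      have := completedResidueMap_toCompletedResidueField (f : X.ring →+* Y.ring) z.val (eX g)
      refine this.trans ?_
      change _ = toCompletedResidueField z.val (eY (eY.symm (f (eX g))))
      rw [AlgEquiv.apply_symm_apply]
      rfl) 
    (fun l ε hε => exists_norm_sub_comp_div_lt (eY : TateAlgebra k ≃+* Y.ring) z.val l hε)
    (fun l ε hε => exists_norm_sub_comp_div_lt (eX : TateAlgebra k ≃+* X.ring) _ l hε)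
    (CharP.cast_eq_zero k p) hpn
    (norm_natCast_eq_one_of_not_dvd hp hres hndvd) hc0 hc1 hF
  have hT : ‖(toCompletedResidueField z.val).comp (eY : TateAlgebra k →+* Y.ring) (T k)‖ =
    z.val (eY (T k)) := norm_toCompletedResidueField z.val (eY (T k))
  rw [hT] at key
  exact key

theorem IsMonicCoordinate.smul {D : PointedDisc.{u, v} k} {y : D.ring} (hy : D.IsMonicCoordinate y)
    {b : k} (hb : ‖b‖ = 1) : D.IsMonicCoordinate (b • y) := by
  obtain ⟨he, e, rfl⟩ := hy
  obtain ⟨s, hs⟩ := isCoordinate_of_norm_sub_lt hb (a := b • T k) (by simp)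
  exact ⟨by rw [map_smul, he, smul_zero], s.trans e, by simp [hs]⟩

/-- A binomial presentation may be rescaled. -/
theorem HasBinomialPresentation.of_norm_eq [IsAlgClosed k] {p n : ℕ} {c c' : k} (hpn : p < n)
    (hc0 : c' ≠ 0) (hcc : ‖c‖ = ‖c'‖) (h : HasBinomialPresentation f p c' n) :
    HasBinomialPresentation f p c n := by
  obtain ⟨x, y, hx, hy, h⟩ := h
  have hc : c ≠ 0 := norm_ne_zero_iff.1 (by rwa [hcc, norm_ne_zero_iff])
  -- Rescaling `y` by `b` and `x` by `b ^ p` replaces the coefficient `c'` by `c' b ^ (p - n)`,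
  -- which has to be `c`.
  obtain ⟨b, hb⟩ := IsAlgClosed.exists_pow_nat_eq (c' / c) (Nat.sub_pos_of_lt hpn)
  have hbn : ‖b‖ = 1 := by
    have h1 : ‖b‖ ^ (n - p) = 1 := by
      rw [← norm_pow, hb, norm_div, hcc, div_self (norm_ne_zero_iff.2 hc0)]
    exact (pow_eq_one_iff_of_nonneg (norm_nonneg _) (Nat.sub_pos_of_lt hpn).ne').1 h1
  refine ⟨b ^ p • x, b • y, hx.smul (by rw [norm_pow, hbn, one_pow]), hy.smul hbn, ?_⟩
  have hbc : c * b ^ n = b ^ p * c' := by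
    have : b ^ n = b ^ (n - p) * b ^ p := by rw [← pow_add]; congr 1; omega
    rw [this, hb]
    field_simp
  rw [map_smul, h, smul_pow, smul_pow, smul_add, ← Algebra.smul_def, ← Algebra.smul_def, smul_smul,
    smul_smul, hbc]

end Cover

end PointedDisc
-- The main theorem
theorem theorem3p9 {k : Type u} [NormedField k] [IsUltrametricDist k] [CompleteSpace k]
    [IsAlgClosed k] {p : ℕ} (hp : p.Prime) (hres : ‖(p : k)‖ < 1)
    (Y : PointedDisc.{u, v} k) (X : PointedDisc.{u, w} k) (f : X.ring →ₐ[k] Y.ring)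
    (hf : PointedDisc.IsEtaleCover f p) :
    (CharZero k → PointedDisc.IsKummer f p) ∧
    (CharP k p →
      (∃ (c : k) (n : ℕ), PointedDisc.HasBinomialPresentation f p c n) ∧
      ∀ y₀ : Y.ring, Y.IsMonicCoordinate y₀ → ∀ (c : k) (n : ℕ),
        PointedDisc.HasBinomialPresentation f p c n ↔
          ∀ z ∈ Y.puncturedSkeleton,
            ‖c‖ * (z.val y₀ : ℝ) ^ ((n : ℤ) - (p : ℤ)) =
              different (f : X.ring →+* Y.ring) z.val) := by

  refine ⟨fun hchar => ?_, fun hchar => ?_⟩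
  · obtain ⟨c, n, hc, x, y, hx, hy, h⟩ := hf.exists_presentation hp hres
    refine ⟨x, y, hx, hy, ?_⟩
    rw [h, hc (Nat.cast_ne_zero.2 hp.ne_zero), map_zero, zero_mul, add_zero]
  · obtain ⟨c', n', -, h'⟩ := hf.exists_presentation hp hres
    refine ⟨⟨c', n', h'⟩, fun y₀ hy₀ c n => ⟨fun h z hz => ?_, fun h => ?_⟩⟩
    · obtain ⟨x, y, hx, hy, h⟩ := h
      -- A presentation of an étale cover has `p < n`, so truncated subtraction agrees with the
      -- integer exponent.
      rw [hf.different_eq hp hres hx hy h hz, z.val_eq_of_isMonicCoordinate hy₀ hy,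
        ← Nat.cast_sub (hf.of_presentation hp hx hy h).1.le, zpow_natCast]
    · obtain ⟨x, y, hx, hy, hxy⟩ := h'
      obtain ⟨hpn', -, hc0, hc1⟩ := hf.of_presentation hp hx hy hxy
      -- The given `c, n` and an actual presentation `c', n'` are compared at the skeleton points
      -- with radius in the value group. The radius 1 gives `‖c‖ = ‖c'‖`; the radius `‖c'‖`,
      -- strictly between 0 and 1, then gives `n = n'`.
      have key : ∀ ρ : k, 0 < ‖ρ‖ → ‖ρ‖ ≤ 1 →
          ‖c‖ * ‖ρ‖ ^ ((n : ℤ) - (p : ℤ)) = ‖c'‖ * ‖ρ‖ ^ ((n' : ℤ) - (p : ℤ)) := by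
        intro ρ hρ0 hρ1
        obtain ⟨z, hz, hzy⟩ := PointedDisc.exists_mem_puncturedSkeleton hy₀ hρ0 hρ1
        have := h z hz
        rw [hf.different_eq hp hres hx hy hxy hz, z.val_eq_of_isMonicCoordinate hy hy₀, hzy] at this
        rw [this, ← Nat.cast_sub hpn'.le, zpow_natCast]
      have hcc : ‖c‖ = ‖c'‖ := by simpa using key 1 (by simp) (by simp)
      have hnn : n = n' := by
        have h1 := key c' hc0 hc1.le
        rw [hcc] at h1
        have h2 := zpow_right_injective₀ hc0 hc1.ne (mul_left_cancel₀ hc0.ne' h1)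
        omega
      subst hnn
      exact PointedDisc.HasBinomialPresentation.of_norm_eq hpn' (norm_pos_iff.1 hc0) hcc
        ⟨x, y, hx, hy, hxy⟩
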